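/- Fix $n\ge 2$. Let $\mathfrak V=\{(i,j): 1\le j\le i\le n\}$. A Gelfand-Tsetlin tableau $T(L)$ is an array $L=(l_{ij})_{(i,j)\in\mathfrak V}$ of complex numbers ($i$ is the row; row $n$ is the top row), and $\delta^{ij}$ is the array with $1$ at $(i,j)$ and $0$ elsewhere. $T(L)$ satisfies the relation $(i,j)\ge(s,t)$ (resp. $(i,j)>(s,t)$) if $l_{ij}-l_{st}\in\mathbb Z_{\ge0}$ (resp. $\in\mathbb Z_{>0}$), and it satisfies a set $\mathcal C$ of relations if it satisfies all of them. Put $$\mathcal R=\{(i,j)\ge(i-1,j'),\ (i-1,j')>(i,j)\},\quad \mathcal R^0=\{(n,i)\ge(n,j): i\ne j\},\quad \mathcal S=\{(i+1,j)\ge(i,j)>(i+1,j+1): 1\le j\le i\le n-1\}.$$ For $\mathcal C\subseteq\mathcal R\cup\mathcal R^0$: * $\mathfrak V(\mathcal C)$ is the set of positions occurring in $\mathcal C$. Two sets are disconnected if they have no position in common. A set is indecomposable if it is not a union of two nonempty disconnected sets; a component of $\mathcal C$ is an indecomposable $\mathcal D\subseteq\mathcal C$ that is disconnected from $\mathcal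 C\setminus\mathcal D$. $\mathcal C$ is noncritical if for every component $\mathcal D$ of $\mathcal C$ and every $T(L)$ satisfying $\mathcal D$ one has $l_{ki}\ne l_{kj}$ whenever $k\le n-1$, $i\ne j$ and $(k,i),(k,j)\in\mathfrak V(\mathcal D)$. * $\mathcal B_{\mathcal C}(T(L))$ is the set of all $T(L+z)$ satisfying $\mathcal C$, with $z$ an integral array that is zero in the top row, and $V_{\mathcal C}(T(L))$ is the complex vector space with basis $\mathcal B_{\mathcal C}(T(L))$. $T(L)$ is a $\mathcal C$-realization if it satisfies $\mathcal C$ and no tableau in $\mathcal B_{\mathcal C}(T(L))$ has two equal entries in a common row $k\le n-1$. * $\mathcal C$ is admissible if for every $\mathcal C$-realization $T(L)$ the Gelfand-Tsetlin formulas $$E_{k,k+1}T(L)=-\sum_{i=1}^{k}\frac{\prod_{j=1}^{k+1}(l_{ki}-l_{k+1,j})}{\prod_{j\ne i}(l_{ki}-l_{kj})}T(L+\delta^{ki}),\qquad E_{k+1,k}T(L)=\sum_{i=1}^{k}\frac{\prod_{j=1}^{k-1}(l_{ki}-l_{k-1,j})}{\prod_{j\ne i}(l_{ki}-l_{kj})}T(L-\delta^{ki}),$$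 $$E_{kk}T(L)=\Big(k-1+\sum_{i=1}^{k}l_{ki}-\sum_{i=1}^{k-1}l_{k-1,i}\Big)T(L)$$ (applied to the tableaux of $\mathcal B_{\mathcal C}(T(L))$, summands with a tableau outside $\mathcal B_{\mathcal C}(T(L))$ being zero) define a $\mathfrak{gl}_n(\mathbb C)$-module structure on $V_{\mathcal C}(T(L))$. * A step of the RR-method (relation-removal) at $(k,i)\in\mathfrak V(\mathcal C)$ is allowed if for some $\mathcal C$-realization $T(L)$ the tableau $T(L+m\delta^{ki})$ is a $\mathcal C$-realization for infinitely many $m\in\mathbb Z$; it removes from $\mathcal C$ all relations that involve $(k,i)$. A set is obtained from $\mathcal C$ by the RR-method if it arises by finitely many (possibly no) such steps. For $\sigma=(\sigma[n],\dots,\sigma[1])\in G=S_n\times\cdots\times S_1$ let $\sigma(\mathcal C)$ be the set obtained by replacing each position $(i,j)$ by $(i,\sigma[i](j))$. **Theorem.** 1. If $\mathcal C_1\subseteq\mathcal R\cup\mathcal R^0$ is noncritical and admissible and $\mathcal C_2$ is obtained from $\mathcal C_1$ by the RR-method, then $\mathcal C_2$ is noncritical and admissible. 2. Every set $\mathcal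 C$ obtained from $\mathcal S$ by the RR-method is noncritical and admissible. 3. For every such $\mathcal C$ and every $\sigma\in G$, the set $\sigma(\mathcal C)$ is noncritical and admissible. 4. Every union of pairwise disconnected sets of the form in 3 is noncritical and admissible. -/

import Mathlib

namespace GelfandTsetlin

/-- The index set of a triangular array of height `n`. The pair `⟨k, j⟩` stands for the position
in row `k + 1` and column `j + 1`; so rows run from `1` (bottom) to `n` (top), and row `r` has the
columns `1, …, r`. -/
abbrev Vertex (n : ℕ) : Type := Σ k : Fin n, Fin ((k : ℕ) + 1)

/-- The row of a position, counted from `1`. -/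
def Vertex.row {n : ℕ} (v : Vertex n) : ℕ := (v.1 : ℕ) + 1

/-- The column of a position, counted from `1`. -/
def Vertex.col {n : ℕ} (v : Vertex n) : ℕ := (v.2 : ℕ) + 1

/-- A Gelfand-Tsetlin tableau `T(L)` of height `n`: a triangular array of complex numbers. -/
abbrev Tableau (n : ℕ) : Type := Vertex n → ℂ

/-- The tableau `T(L + m δ^v)`. -/
def shift {n : ℕ} (L : Tableau n) (v : Vertex n) (m : ℤ) : Tableau n :=
  fun w => L w + if w = v then (m : ℂ) else 0

/-! ### Relations -/

/-- A relation between two positions: `ge u v` is `u ≥ v` and `gt u v` is `u > v`. -/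
inductive Rel (n : ℕ) : Type
  | ge (u v : Vertex n) : Rel n
  | gt (u v : Vertex n) : Rel n

/-- The relation `r` involves the position `w`. -/
def Rel.Involves {n : ℕ} : Rel n → Vertex n → Prop
  | .ge u v, w => w = u ∨ w = v
  | .gt u v, w => w = u ∨ w = v

/-- `T(L)` satisfies `u ≥ v` if `L u - L v` is a nonnegative integer, and `u > v` if it is a
positive integer. -/
def Rel.Holds {n : ℕ} (L : Tableau n) : Rel n → Prop
  | .ge u v => ∃ m : ℤ, 0 ≤ m ∧ L u - L v = (m : ℂ)
  | .gt u v => ∃ m : ℤ, 0 < m ∧ L u - L v = (m : ℂ)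

/-- The set `𝓡` of all relations `(i, j) ≥ (i - 1, j')` and `(i - 1, j') > (i, j)`. -/
def setR (n : ℕ) : Set (Rel n) :=
  {r | ∃ u v : Vertex n, u.row = v.row + 1 ∧ (r = Rel.ge u v ∨ r = Rel.gt v u)}

/-- The set `𝓡⁰` of all relations `(n, i) ≥ (n, j)` with `i ≠ j`. -/
def setR0 (n : ℕ) : Set (Rel n) :=
  {r | ∃ u v : Vertex n, u.row = n ∧ v.row = n ∧ u ≠ v ∧ r = Rel.ge u v}

/-- The set `𝓢` of the standard relations `(i + 1, j) ≥ (i, j) > (i + 1, j + 1)`. -/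
def setS (n : ℕ) : Set (Rel n) :=
  {r | ∃ u v : Vertex n, u.row = v.row + 1 ∧
    ((u.col = v.col ∧ r = Rel.ge u v) ∨ (u.col = v.col + 1 ∧ r = Rel.gt v u))}

/-- `𝔙(C)`: the positions that occur in the relations of `C`. -/
def verts {n : ℕ} (C : Set (Rel n)) : Set (Vertex n) :=
  {v | ∃ r ∈ C, r.Involves v}

/-- `T(L)` satisfies `C`. -/
def Satisfies {n : ℕ} (C : Set (Rel n)) (L : Tableau n) : Prop :=
  ∀ r ∈ C, r.Holds L

/-- Two sets of relations are disconnected if they have no position in common. -/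
def Disconnected {n : ℕ} (C D : Set (Rel n)) : Prop := Disjoint (verts C) (verts D)

/-- `C` is indecomposable: it is not the union of two nonempty disconnected sets. -/
def Indecomposable {n : ℕ} (C : Set (Rel n)) : Prop :=
  ¬ ∃ C₁ C₂ : Set (Rel n), C₁.Nonempty ∧ C₂.Nonempty ∧ Disconnected C₁ C₂ ∧ C = C₁ ∪ C₂

/-- `D` is an indecomposable set that is disconnected from the rest of `C`. -/
def IsComponent {n : ℕ} (D C : Set (Rel n)) : Prop :=
  D ⊆ C ∧ Indecomposable D ∧ Disconnected D (C \ D)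

/-- `C` is noncritical: for each indecomposable component `D` of `C`, no tableau satisfying `D` has
equal entries at two distinct positions of `𝔙(D)` in a common row below the top row. -/
def NoncriticalSet {n : ℕ} (C : Set (Rel n)) : Prop :=
  ∀ D : Set (Rel n), IsComponent D C → ∀ L : Tableau n, Satisfies D L →
    ∀ u ∈ verts D, ∀ v ∈ verts D, u ≠ v → u.row = v.row → u.row < n → L u ≠ L v

/-! ### Realizations and modules -/

-- the Lie bracket on matrices and on endomorphisms is the commutator
attribute [local instance] LieRing.ofAssociativeRing

/-- A tableau is noncritical if the entries of each row below the top row are distinct. -/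
def NoncriticalTableau {n : ℕ} (L : Tableau n) : Prop :=
  ∀ u v : Vertex n, u ≠ v → u.row = v.row → u.row < n → L u ≠ L v

/-- `𝓑_C(T(L))`: all tableaux `T(L + z)` satisfying `C`, with `z` integral and zero in the
top row. -/
def basisSet {n : ℕ} (C : Set (Rel n)) (L : Tableau n) : Set (Tableau n) :=
  {M | (∃ z : Vertex n → ℤ, (∀ v, v.row = n → z v = 0) ∧ ∀ v, M v = L v + (z v : ℂ)) ∧
    Satisfies C M}

/-- `T(L)` is a `C`-realization. -/
def IsRealization {n : ℕ} (C : Set (Rel n)) (L : Tableau n) : Prop :=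
  Satisfies C L ∧ ∀ M ∈ basisSet C L, NoncriticalTableau M

open Classical in
/-- The tableau `T(M)` as a vector of the space with basis `B`; it is zero if `M ∉ B`. -/
noncomputable def vec {n : ℕ} (B : Set (Tableau n)) (M : Tableau n) : B →₀ ℂ :=
  if h : M ∈ B then Finsupp.single ⟨M, h⟩ 1 else 0

/-- The coefficient `∏_j (l_{ki} - l_{k+1,j}) / ∏_{j ≠ i} (l_{ki} - l_{kj})` at `u = (k, i)`. -/
noncomputable def raiseCoeff {n : ℕ} (L : Tableau n) (u : Vertex n) : ℂ :=
  (∏ w : Vertex n with w.row = u.row + 1, (L u - L w)) /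
    ∏ w : Vertex n with w.row = u.row ∧ w ≠ u, (L u - L w)

/-- The coefficient `∏_j (l_{ki} - l_{k-1,j}) / ∏_{j ≠ i} (l_{ki} - l_{kj})` at `u = (k, i)`. -/
noncomputable def lowerCoeff {n : ℕ} (L : Tableau n) (u : Vertex n) : ℂ :=
  (∏ w : Vertex n with w.row + 1 = u.row, (L u - L w)) /
    ∏ w : Vertex n with w.row = u.row ∧ w ≠ u, (L u - L w)

/-- The Gelfand-Tsetlin formulas define a `𝔤𝔩_n`-module structure on the space `B →₀ ℂ` with basis
`B`: there is a Lie algebra homomorphism from `𝔤𝔩_n(ℂ)` to its endomorphisms under which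
`E_{k,k+1}`, `E_{k+1,k}` and `E_{kk}` act on the tableaux of `B` by these formulas. Here
`k = a + 1` for the index `a : Fin n`, and `b` is the index following `a`. -/
def IsGTModule {n : ℕ} (B : Set (Tableau n)) : Prop :=
  ∃ ρ : Matrix (Fin n) (Fin n) ℂ →ₗ⁅ℂ⁆ Module.End ℂ (B →₀ ℂ), ∀ M ∈ B,
    (∀ a b : Fin n, (b : ℕ) = (a : ℕ) + 1 →
      ρ (Matrix.single a b 1) (vec B M) =
        -∑ u : Vertex n with u.row = (a : ℕ) + 1, raiseCoeff M u • vec B (shift M u 1)) ∧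
    (∀ a b : Fin n, (b : ℕ) = (a : ℕ) + 1 →
      ρ (Matrix.single b a 1) (vec B M) =
        ∑ u : Vertex n with u.row = (a : ℕ) + 1, lowerCoeff M u • vec B (shift M u (-1))) ∧
    (∀ a : Fin n,
      ρ (Matrix.single a a 1) (vec B M) =
        ((a : ℂ) + ∑ u : Vertex n with u.row = (a : ℕ) + 1, M u
          - ∑ u : Vertex n with u.row = (a : ℕ), M u) • vec B M)

/-- `C` is admissible: for every `C`-realization `T(L)` the space `V_C(T(L))` with basis
`𝓑_C(T(L))` is a `𝔤𝔩_n`-module by the Gelfand-Tsetlin formulas. -/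
def Admissible {n : ℕ} (C : Set (Rel n)) : Prop :=
  ∀ L : Tableau n, IsRealization C L → IsGTModule (basisSet C L)

/-! ### The relation-removal method and permutations -/

/-- The relations of `C` that do not involve `v`. -/
def removeVertex {n : ℕ} (C : Set (Rel n)) (v : Vertex n) : Set (Rel n) :=
  {r | r ∈ C ∧ ¬ r.Involves v}

/-- One step of the relation-removal method: a position `v` of `𝔙(C)` is given such that, for some
`C`-realization `T(L)`, infinitely many `T(L + m δ^v)` are `C`-realizations, and all relations that
involve `v` are removed. -/
def RRStep {n : ℕ} (C C' : Set (Rel n)) : Prop :=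
  ∃ v ∈ verts C, (∃ L : Tableau n, IsRealization C L ∧
    {m : ℤ | IsRealization C (shift L v m)}.Infinite) ∧ C' = removeVertex C v

/-- `C'` is obtained from `C` by finitely many (possibly no) steps of the relation-removal
method. -/
def ObtainedByRR {n : ℕ} (C C' : Set (Rel n)) : Prop :=
  Relation.ReflTransGen RRStep C C'

/-- The group `G = S_n × ⋯ × S_1`. -/
abbrev PermGroup (n : ℕ) : Type := ∀ k : Fin n, Equiv.Perm (Fin ((k : ℕ) + 1))

/-- The action of `σ ∈ G` on relations: in row `i`, column `j` is replaced by `σ[i](j)`. -/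
def Rel.permute {n : ℕ} (σ : PermGroup n) : Rel n → Rel n
  | .ge u v => .ge ⟨u.1, σ u.1 u.2⟩ ⟨v.1, σ v.1 v.2⟩
  | .gt u v => .gt ⟨u.1, σ u.1 u.2⟩ ⟨v.1, σ v.1 v.2⟩

/-- The set of relations `σ(C)`. -/
def permuteSet {n : ℕ} (σ : PermGroup n) (C : Set (Rel n)) : Set (Rel n) :=
  Rel.permute σ '' C

end GelfandTsetlin

open GelfandTsetlin

/-! Admissibility is reduced to a condition on single tableaux. By `SerreRelations.exists_lieHom`,
operators satisfying the Serre relations of `𝔤𝔩_n` define a representation, so only products of two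
or three Gelfand-Tsetlin operators matter. A path of moves may leave the basis and return, but the
relation broken on the way puts a zero factor into a numerator (`moveCoeff_mul_eq_zero`,
`moveCoeff_mul_mul_eq_zero`). Hence products obey the unrestricted formulas, and the defining
relations are rational identities as long as no denominator vanishes.

Trouble comes only from two entries of one row that differ by one. In the Serre relation for
adjacent rows the critical target tableaux must lie outside the basis. In `[E_{k,k+1}, E_{k+1,k}]`
the diagonal coefficient is a sum of residues of `∏ (t - l_{k+1,j}) ∏ (t + 1 - l_{k-1,j}) / ∏ (t -
l_{ki}) (t + 1 - l_{ki})`; such a pair of entries makes the denominator vanish doubly, and the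
remaining residues add up correctly if the numerator vanishes doubly there too. The condition
`LocallyAdmissible` provides both facts.

For the relation-removal method, the residue argument is reversed: in a module, a doubly vanishing
denominator factor that is the only one of its kind and meets one zero of the numerator must meet a
second one (`Admissible.exists_tight`). A removed position is bounded on one side at most, so a
tableau for one component of the remaining set extends to a realization of the original set. Before
extending, its entries are spread apart until only the critical pair differs by one. Applying
admissibility there, once as it is and once after lowering suitable entries, yields the local
condition for the smaller set (`LocallyAdmissible.of_removeVertex`). Noncriticality passes down by
the same extension.

For `𝓢`, the second zero comes from a diamond: a chain between two neighbours of a row through the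
row above has a companion through the row below. This property implies the local condition and
survives removal steps, row permutations and disjoint unions, which gives the other parts. -/

namespace GelfandTsetlin

/-! ### A presentation of `𝔤𝔩_n` -/

section SerrePresentation

variable {A : Type*} [LieRing A]

/-- The Serre relations of `𝔤𝔩_n` for raising elements `e i`, lowering elements `f i` (`i + 1 < n`)
and diagonal elements `h i` (`i < n`). -/
structure SerreRelations (n : ℕ) (e f h : ℕ → A) : Prop where
  hh : ∀ i j, i < n → j < n → ⁅h i, h j⁆ = 0
  he : ∀ i j, i < n → j + 1 < n →
    ⁅h i, e j⁆ = (if i = j then e j else 0) - (if i = j + 1 then e j else 0)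
  hf : ∀ i j, i < n → j + 1 < n →
    ⁅h i, f j⁆ = (if i = j + 1 then f j else 0) - (if i = j then f j else 0)
  ef : ∀ i j, i + 1 < n → j + 1 < n → ⁅e i, f j⁆ = if i = j then h i - h (i + 1) else 0
  ee : ∀ i j, i + 1 < n → j + 1 < n → i + 1 < j → ⁅e i, e j⁆ = 0
  ff : ∀ i j, i + 1 < n → j + 1 < n → i + 1 < j → ⁅f i, f j⁆ = 0
  eee_up : ∀ i, i + 2 < n → ⁅e i, ⁅e i, e (i + 1)⁆⁆ = 0
  eee_down : ∀ i, i + 2 < n → ⁅e (i + 1), ⁅e (i + 1), e i⁆⁆ = 0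
  fff_up : ∀ i, i + 2 < n → ⁅f i, ⁅f i, f (i + 1)⁆⁆ = 0
  fff_down : ∀ i, i + 2 < n → ⁅f (i + 1), ⁅f (i + 1), f i⁆⁆ = 0

/-- The iterated bracket `⁅…⁅⁅e i, e (i + 1)⁆, e (i + 2)⁆…, e (i + d)⁆`. -/
def rootVector (e : ℕ → A) (i : ℕ) : ℕ → A
  | 0 => e i
  | d + 1 => ⁅rootVector e i d, e (i + d + 1)⁆

namespace SerreRelations

variable {n : ℕ} {e f h : ℕ → A}

/-- The Chevalley involution. -/
theorem chevalley (H : SerreRelations n e f h) :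
    SerreRelations n (fun i => -f i) (fun i => -e i) (fun i => -h i) where
  hh i j hi hj := by simp [H.hh i j hi hj]
  he i j hi hj := by
    simp only [neg_lie, lie_neg, neg_neg, H.hf i j hi hj]
    split_ifs <;> simp
  hf i j hi hj := by
    simp only [neg_lie, lie_neg, neg_neg, H.he i j hi hj]
    split_ifs <;> simp
  ef i j hi hj := by
    rw [neg_lie, lie_neg, neg_neg, ← lie_skew, H.ef j i hj hi]
    by_cases hij : i = j
    · subst hij; simp; abel
    · simp [hij, Ne.symm hij]
  ee i j hi hj hij := by simp [H.ff i j hi hj hij]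
  ff i j hi hj hij := by simp [H.ee i j hi hj hij]
  eee_up i hi := by simp [H.fff_up i hi]
  eee_down i hi := by simp [H.fff_down i hi]
  fff_up i hi := by simp [H.eee_up i hi]
  fff_down i hi := by simp [H.eee_down i hi]

theorem lie_e_e_of_far (H : SerreRelations n e f h) {i j : ℕ} (hi : i + 1 < n) (hj : j + 1 < n)
    (hij : i + 1 < j ∨ j + 1 < i) : ⁅e i, e j⁆ = 0 := by
  rcases hij with hij | hij
  · exact H.ee i j hi hj hij
  · rw [← lie_skew, H.ee j i hj hi hij, neg_zero]

theorem lie_h_rootVector (H : SerreRelations n e f h) {k i : ℕ} (d : ℕ) (hk : k < n)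
    (hi : i + d + 1 < n) : ⁅h k, rootVector e i d⁆ =
      (if k = i then rootVector e i d else 0) -
        (if k = i + d + 1 then rootVector e i d else 0) := by
  induction d with
  | zero => exact H.he k i hk hi
  | succ d ih =>
    rw [rootVector, leibniz_lie, ih (by omega), H.he k (i + d + 1) hk (by omega)]
    by_cases h1 : k = i
    · subst h1
      simp [show k ≠ k + d + 1 by omega, show k ≠ k + d + 1 + 1 by omega,
        show k ≠ k + (d + 1) + 1 by omega]
    · by_cases h2 : k = i + d + 1
      · subst h2
        simp only [if_neg (show i + d + 1 ≠ i by omega), if_pos, zero_sub, neg_lie, sub_zero,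
          if_neg (show i + d + 1 ≠ i + d + 1 + 1 by omega),
          if_neg (show i + d + 1 ≠ i + (d + 1) + 1 by omega), sub_self]
        exact neg_add_cancel _
      · by_cases h3 : k = i + d + 1 + 1
        · subst h3
          simp [show i + d + 1 + 1 ≠ i by omega, show i + (d + 1) = i + d + 1 by omega]
        · simp [h1, h2, h3, show k ≠ i + (d + 1) + 1 by omega]

theorem lie_e_rootVector_of_far (H : SerreRelations n e f h) {k i : ℕ} (d : ℕ) (hk : k + 1 < n)
    (hi : i + d + 1 < n) (hki : k + 1 < i ∨ i + d + 1 < k) : ⁅e k, rootVector e i d⁆ = 0 := by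
  induction d with
  | zero => exact H.lie_e_e_of_far hk hi (by omega)
  | succ d ih =>
    rw [rootVector, leibniz_lie, ih (by omega) (by omega),
      H.lie_e_e_of_far hk (by omega) (by omega), zero_lie, lie_zero, add_zero]

theorem lie_e_rootVector_succ (H : SerreRelations n e f h) {k : ℕ} (d : ℕ)
    (hk : k + d + 2 < n) : ⁅e k, rootVector e (k + 1) d⁆ = rootVector e k (d + 1) := by
  induction d with
  | zero => rfl
  | succ d ih =>
    rw [rootVector, leibniz_lie, ih (by omega),
      H.lie_e_e_of_far (i := k) (j := k + 1 + d + 1) (by omega) (by omega) (by omega), lie_zero,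
      add_zero]
    change _ = ⁅rootVector e k (d + 1), e (k + (d + 1) + 1)⁆
    rw [show k + 1 + d + 1 = k + (d + 1) + 1 by omega]

theorem lie_e_rootVector_top (i d : ℕ) :
    ⁅e (i + d + 1), rootVector e i d⁆ = -rootVector e i (d + 1) := by
  rw [rootVector, lie_skew]

/-- Adding the simple root of an index inside the support of the root never gives a root. Below the
last two indices this is inherited from a shorter root vector. At the last but one, roots of length
two use a cubic relation, while for longer ones the Jacobi identity only gives `Z = -Z`; this is
where torsion-freeness enters. -/
theorem lie_e_rootVector_mid [IsAddTorsionFree A] (H : SerreRelations n e f h) {k i : ℕ} (d : ℕ)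
    (hi : i + d + 1 < n) (hik : i ≤ k) (hk : k ≤ i + d) : ⁅e k, rootVector e i d⁆ = 0 := by
  induction d with
  | zero =>
    obtain rfl : k = i := by omega
    exact lie_self _
  | succ d ih =>
    rcases Nat.lt_or_ge k (i + d) with h1 | h1
    · rw [rootVector, leibniz_lie, ih (by omega) (by omega),
        H.lie_e_e_of_far (by omega) (by omega) (by omega), zero_lie, lie_zero, add_zero]
    rcases Nat.eq_or_lt_of_le h1 with h2 | h2
    · -- `k` is the last but one index
      cases d with
      | zero =>
        obtain rfl : k = i := by omega
        exact H.eee_up k (by omega)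
      | succ d =>
        have hk' : k = i + d + 1 := by omega
        subst hk'
        have hY : ⁅e (i + d + 1), ⁅e (i + d + 1), e (i + d + 1 + 1)⁆⁆ = 0 :=
          H.eee_up (i + d + 1) (by omega)
        have h3 : ⁅e (i + d + 1), rootVector e i (d + 1)⁆ = 0 := ih (by omega) (by omega)
        have h4 : ⁅rootVector e i d, e (i + d + 1 + 1)⁆ = 0 := by
          rw [← lie_skew, H.lie_e_rootVector_of_far d (by omega) (by omega) (by omega), neg_zero]
        -- `Z = [e, X]` equals both `[X', Y]` and its negative
        have h5 : ⁅e (i + d + 1), rootVector e i (d + 1 + 1)⁆ =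
            ⁅rootVector e i (d + 1), ⁅e (i + d + 1), e (i + d + 1 + 1)⁆⁆ := by
          change ⁅e (i + d + 1), ⁅rootVector e i (d + 1), e (i + d + 1 + 1)⁆⁆ = _
          rw [leibniz_lie, h3, zero_lie, zero_add]
        have h6 : ⁅rootVector e i (d + 1), ⁅e (i + d + 1), e (i + d + 1 + 1)⁆⁆ =
            ⁅rootVector e i (d + 1 + 1), e (i + d + 1)⁆ := by
          have h7 : ⁅rootVector e i d, ⁅e (i + d + 1), e (i + d + 1 + 1)⁆⁆ =
              rootVector e i (d + 1 + 1) := by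
            rw [leibniz_lie, h4, lie_zero, add_zero]
            rfl
          conv_lhs => rw [rootVector]
          rw [lie_lie, hY, lie_zero, zero_sub, h7, lie_skew]
        rw [h6, ← lie_skew (rootVector e i (d + 1 + 1))] at h5
        exact self_eq_neg.mp h5
    · -- `k` is the last index
      obtain rfl : k = i + d + 1 := by omega
      cases d with
      | zero =>
        change ⁅e (i + 1), ⁅e i, e (i + 1)⁆⁆ = 0
        rw [← lie_skew (e i), lie_neg, H.eee_down i (by omega), neg_zero]
      | succ d =>
        have h4 : ⁅e (i + (d + 1) + 1), rootVector e i d⁆ = 0 :=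
          H.lie_e_rootVector_of_far d (by omega) (by omega) (by omega)
        have h5 : ⁅e (i + d + 1 + 1), ⁅e (i + d + 1), e (i + d + 1 + 1)⁆⁆ = 0 := by
          rw [← lie_skew (e (i + d + 1)), lie_neg, H.eee_down (i + d + 1) (by omega), neg_zero]
        have h6 : rootVector e i (d + 1 + 1) =
            ⁅rootVector e i d, ⁅e (i + d + 1), e (i + (d + 1) + 1)⁆⁆ := by
          change ⁅⁅rootVector e i d, e (i + d + 1)⁆, e (i + (d + 1) + 1)⁆ = _
          rw [lie_lie, ← lie_skew (rootVector e i d) (e (i + (d + 1) + 1)), h4, neg_zero, lie_zero,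
            sub_zero]
        rw [h6, leibniz_lie, h4, zero_lie, zero_add]
        exact (congrArg _ h5).trans (lie_zero _)

theorem lie_f_e (H : SerreRelations n e f h) {k j : ℕ} (hk : k + 1 < n) (hj : j + 1 < n) :
    ⁅f k, e j⁆ = if k = j then h (k + 1) - h k else 0 := by
  rw [← lie_skew, H.ef j k hj hk]
  by_cases hkj : k = j
  · subst hkj; simp
  · simp [hkj, Ne.symm hkj]

theorem lie_f_rootVector_of_lt (H : SerreRelations n e f h) {k i : ℕ} (d : ℕ) (hk : k + 1 < n)
    (hki : i + d < k) : ⁅f k, rootVector e i d⁆ = 0 := by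
  induction d with
  | zero => exact (H.lie_f_e hk (by omega)).trans (if_neg (by omega))
  | succ d ih =>
    rw [rootVector, leibniz_lie, H.lie_f_e hk (by omega), if_neg (by omega), lie_zero,
      ih (by omega), zero_lie, add_zero]

theorem lie_f_rootVector_top (H : SerreRelations n e f h) {i : ℕ} (d : ℕ)
    (hi : i + d + 2 < n) : ⁅f (i + d + 1), rootVector e i (d + 1)⁆ = -rootVector e i d := by
  rw [rootVector, leibniz_lie, H.lie_f_e (by omega) (by omega), if_pos rfl,
    H.lie_f_rootVector_of_lt d (by omega) (by omega), zero_lie, zero_add,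
    ← lie_skew _ (h (i + d + 1 + 1) - h (i + d + 1)), sub_lie,
    H.lie_h_rootVector d (by omega) (by omega), H.lie_h_rootVector d (by omega) (by omega)]
  simp [show i + d + 1 + 1 ≠ i by omega, show i + d + 1 ≠ i by omega]

theorem lie_f_rootVector_ne (H : SerreRelations n e f h) {k i : ℕ} (d : ℕ) (hk : k + 1 < n)
    (hi : i + d + 1 < n) (h1 : k ≠ i) (h2 : k ≠ i + d) : ⁅f k, rootVector e i d⁆ = 0 := by
  induction d with
  | zero => exact (H.lie_f_e hk hi).trans (by simp [h1])
  | succ d ih =>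
    rw [rootVector, leibniz_lie, H.lie_f_e hk (by omega), if_neg (by omega), lie_zero, add_zero]
    by_cases h3 : k = i + d
    · cases d with
      | zero => omega
      | succ d =>
        subst h3
        rw [show i + (d + 1) = i + d + 1 by omega, H.lie_f_rootVector_top d (by omega), neg_lie,
          ← lie_skew, H.lie_e_rootVector_of_far d (by omega) (by omega) (by omega), neg_zero,
          neg_zero]
    · rw [ih (by omega) h3, zero_lie]

theorem lie_f_rootVector_bot (H : SerreRelations n e f h) {i : ℕ} (d : ℕ)
    (hi : i + d + 2 < n) : ⁅f i, rootVector e i (d + 1)⁆ = rootVector e (i + 1) d := by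
  induction d with
  | zero =>
    change ⁅f i, ⁅e i, e (i + 1)⁆⁆ = e (i + 1)
    rw [leibniz_lie, H.lie_f_e (by omega) (by omega), H.lie_f_e (by omega) (by omega), if_pos rfl,
      if_neg (by omega), lie_zero, add_zero, sub_lie, H.he _ _ (by omega) (by omega),
      H.he _ _ (by omega) (by omega)]
    simp [show i ≠ i + 1 + 1 by omega]
  | succ d ih =>
    rw [rootVector, leibniz_lie, ih (by omega), H.lie_f_e (by omega) (by omega),
      if_neg (by omega), lie_zero, add_zero, show i + (d + 1) + 1 = i + 1 + d + 1 by omega]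
    rfl

theorem lie_f_rootVector_zero (H : SerreRelations n e f h) {i : ℕ} (hi : i + 1 < n) :
    ⁅f i, rootVector e i 0⁆ = h (i + 1) - h i :=
  (H.lie_f_e hi hi).trans (if_pos rfl)

/-- The element of a Lie ring that corresponds to the matrix unit `E_{ij}`. -/
def _root_.GelfandTsetlin.matrixUnit (e f h : ℕ → A) (i j : ℕ) : A :=
  if i < j then rootVector e i (j - i - 1)
  else if j < i then -rootVector (fun k => -f k) j (i - j - 1) else h i

theorem matrixUnit_of_lt {i j d : ℕ} (hij : j = i + d + 1) :
    matrixUnit e f h i j = rootVector e i d := by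
  subst hij
  rw [matrixUnit, if_pos (by omega), show i + d + 1 - i - 1 = d by omega]

theorem matrixUnit_of_gt {i j d : ℕ} (hij : i = j + d + 1) :
    matrixUnit e f h i j = -rootVector (fun k => -f k) j d := by
  subst hij
  rw [matrixUnit, if_neg (by omega), if_pos (by omega), show j + d + 1 - j - 1 = d by omega]

theorem matrixUnit_self (i : ℕ) : matrixUnit e f h i i = h i := by
  simp [matrixUnit]

/-- The involution acts as `E_{ij} ↦ -E_{ji}`. It transfers the brackets with `e k` to the brackets
with `f k`. -/
theorem matrixUnit_chevalley (i j : ℕ) :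
    matrixUnit (fun i => -f i) (fun i => -e i) (fun i => -h i) i j = -matrixUnit e f h j i := by
  rcases Nat.lt_trichotomy i j with hij | rfl | hij
  · obtain ⟨d, hd⟩ := Nat.exists_eq_add_of_lt hij
    rw [matrixUnit_of_lt hd, matrixUnit_of_gt hd, neg_neg]
  · simp [matrixUnit_self]
  · obtain ⟨d, hd⟩ := Nat.exists_eq_add_of_lt hij
    rw [matrixUnit_of_gt hd, matrixUnit_of_lt hd]
    simp

theorem lie_h_matrixUnit (H : SerreRelations n e f h) {k i j : ℕ} (hk : k < n) (hi : i < n)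
    (hj : j < n) : ⁅h k, matrixUnit e f h i j⁆ =
      (if k = i then matrixUnit e f h k j else 0) -
          (if k = j then matrixUnit e f h i k else 0) := by
  rcases Nat.lt_trichotomy i j with hij | rfl | hij
  · obtain ⟨d, rfl⟩ := Nat.exists_eq_add_of_lt hij
    rw [matrixUnit_of_lt rfl, H.lie_h_rootVector d hk (by omega)]
    congr 1 <;> split_ifs with hc
    · rw [hc, matrixUnit_of_lt rfl]
    · rfl
    · rw [hc, matrixUnit_of_lt rfl]
    · rfl
  · rw [matrixUnit_self, H.hh k i hk hi]
    split_ifs with hc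
    · rw [hc, sub_self]
    · rw [sub_self]
  · obtain ⟨d, rfl⟩ := Nat.exists_eq_add_of_lt hij
    have h1 := H.chevalley.lie_h_rootVector (k := k) (i := j) d hk (by omega)
    rw [matrixUnit_of_gt rfl, lie_neg, ← neg_lie, h1, sub_eq_neg_add,
      sub_eq_add_neg]
    congr 1 <;> split_ifs with hc
    · rw [hc, matrixUnit_of_gt rfl]
    · exact neg_zero
    · rw [hc, matrixUnit_of_gt rfl, neg_neg]
    · exact neg_zero.symm

/-- In every bracket that has to be computed one factor is a generator; brackets of two general
matrix units are never needed. -/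
theorem lie_e_matrixUnit [IsAddTorsionFree A] (H : SerreRelations n e f h) {k i j : ℕ}
    (hk : k + 1 < n) (hi : i < n) (hj : j < n) : ⁅e k, matrixUnit e f h i j⁆ =
      (if k + 1 = i then matrixUnit e f h k j else 0) -
        (if k = j then matrixUnit e f h i (k + 1) else 0) := by
  rcases Nat.lt_trichotomy i j with hij | rfl | hij
  · obtain ⟨d, rfl⟩ := Nat.exists_eq_add_of_lt hij
    rw [matrixUnit_of_lt rfl]
    by_cases h1 : k + 1 = i
    · subst h1
      rw [if_pos rfl, if_neg (by omega), sub_zero, matrixUnit_of_lt (d := d + 1) (by omega),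
        H.lie_e_rootVector_succ d (by omega)]
    rw [if_neg h1, zero_sub]
    by_cases h2 : k = i + d + 1
    · subst h2
      rw [if_pos rfl, matrixUnit_of_lt (d := d + 1) (by omega), lie_e_rootVector_top]
    rw [if_neg h2, neg_zero]
    by_cases h3 : i ≤ k ∧ k ≤ i + d
    · exact H.lie_e_rootVector_mid d hj h3.1 h3.2
    · exact H.lie_e_rootVector_of_far d hk hj (by omega)
  · rw [matrixUnit_self, ← lie_skew, H.he i k hi hk]
    by_cases h1 : k + 1 = i
    · subst h1
      simp [matrixUnit_of_lt (e := e) (f := f) (h := h) (i := k) (j := k + 1) (d := 0) rfl,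
        rootVector]
    · by_cases h2 : k = i
      · subst h2
        simp [matrixUnit_of_lt (e := e) (f := f) (h := h) (i := k) (j := k + 1) (d := 0) rfl,
          rootVector]
      · simp [h1, h2, Ne.symm h1, Ne.symm h2]
  · obtain ⟨d, rfl⟩ := Nat.exists_eq_add_of_lt hij
    rw [matrixUnit_of_gt rfl, lie_neg, ← neg_lie]
    by_cases h1 : k = j
    · subst h1
      cases d with
      | zero =>
        rw [H.chevalley.lie_f_rootVector_zero (by omega)]
        simp [matrixUnit_self]
        abel
      | succ d =>
        rw [H.chevalley.lie_f_rootVector_bot d (by omega), if_neg (by omega), if_pos rfl,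
          zero_sub, matrixUnit_of_gt (d := d) (by omega), neg_neg]
    rw [if_neg h1, sub_zero]
    by_cases h2 : k = j + d
    · subst h2
      cases d with
      | zero => omega
      | succ d =>
        rw [if_pos rfl, matrixUnit_of_gt (d := d) (by omega)]
        exact H.chevalley.lie_f_rootVector_top d (by omega)
    · rw [if_neg (by omega), H.chevalley.lie_f_rootVector_ne d hk (by omega) h1 h2]

theorem lie_f_matrixUnit [IsAddTorsionFree A] (H : SerreRelations n e f h) {k i j : ℕ}
    (hk : k + 1 < n) (hi : i < n) (hj : j < n) : ⁅f k, matrixUnit e f h i j⁆ =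
      (if k = i then matrixUnit e f h (k + 1) j else 0) -
        (if k + 1 = j then matrixUnit e f h i k else 0) := by
  have h1 := H.chevalley.lie_e_matrixUnit hk hj hi
  simp only [matrixUnit_chevalley, neg_lie, lie_neg, neg_neg] at h1
  rw [h1]
  split_ifs <;> simp [sub_eq_neg_add, add_comm]

end SerreRelations

-- The homomorphism defined by the Serre relations.

attribute [local instance] LieRing.ofAssociativeRing

/-- Elements satisfying the Serre relations of `𝔤𝔩_n` define a homomorphism from `𝔤𝔩_n`. -/
theorem SerreRelations.exists_lieHom {R A : Type*} [CommRing R] [LieRing A] [LieAlgebra R A]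
    [IsAddTorsionFree A] {n : ℕ} {e f h : ℕ → A} (H : SerreRelations n e f h) :
    ∃ ρ : Matrix (Fin n) (Fin n) R →ₗ⁅R⁆ A,
      (∀ a b : Fin n, (b : ℕ) = (a : ℕ) + 1 → ρ (Matrix.single a b 1) = e a) ∧
      (∀ a b : Fin n, (b : ℕ) = (a : ℕ) + 1 → ρ (Matrix.single b a 1) = f a) ∧
      ∀ a : Fin n, ρ (Matrix.single a a 1) = h a := by
  let ρ : Matrix (Fin n) (Fin n) R →ₗ[R] A :=
    { toFun := fun x => ∑ i, ∑ j, x i j • matrixUnit e f h i j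
      map_add' := by intro x y; simp [add_smul, Finset.sum_add_distrib]
      map_smul' := by intro c x; simp [mul_smul, Finset.smul_sum] }
  have hρ : ∀ i j : Fin n, ρ (Matrix.single i j 1) = matrixUnit e f h i j := by
    intro i j
    change ∑ a, ∑ b, (Matrix.single i j (1 : R)) a b • matrixUnit e f h a b = _
    rw [Finset.sum_eq_single i, Finset.sum_eq_single j]
    · simp
    · intro b _ hb; simp [Matrix.single, Ne.symm hb]
    · simp
    · intro a _ ha
      exact Finset.sum_eq_zero fun b _ => by simp [Matrix.single, Ne.symm ha]
    · simp
  have hbr : ∀ i j k l : Fin n, ⁅Matrix.single i j (1 : R), Matrix.single k l (1 : R)⁆ =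
      (if j = k then Matrix.single i l 1 else 0) - if i = l then Matrix.single k j 1 else 0 := by
    intro i j k l
    rw [Ring.lie_def]
    congr 1
    · split_ifs with hjk
      · subst hjk; simp
      · exact Matrix.single_mul_single_of_ne _ _ _ _ hjk _
    · split_ifs with hil
      · subst hil; simp
      · exact Matrix.single_mul_single_of_ne _ _ _ _ (Ne.symm hil) _
  -- the elements on which `ρ` is multiplicative form a Lie subalgebra
  let N : LieSubalgebra R (Matrix (Fin n) (Fin n) R) :=
    { carrier := {x | ∀ y, ρ ⁅x, y⁆ = ⁅ρ x, ρ y⁆}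
      add_mem' := by
        intro x y hx hy z
        rw [add_lie, map_add, map_add, add_lie, hx, hy]
      zero_mem' := by intro z; simp
      smul_mem' := by
        intro c x hx z
        rw [smul_lie, map_smul, map_smul, smul_lie, hx]
      lie_mem' := by
        intro x y hx hy z
        rw [lie_lie, map_sub, hx, hy, hy, hx, hx, ← lie_lie] }
  -- By linearity in `y`, membership in `N` is tested on matrix units only.
  have hmem : ∀ x : Matrix (Fin n) (Fin n) R,
      (∀ i j : Fin n, ρ ⁅x, Matrix.single i j 1⁆ = ⁅ρ x, matrixUnit e f h i j⁆) → x ∈ N := by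
    intro x hx y
    induction y using Matrix.induction_on' with
    | h_zero => simp
    | h_add p q hp hq => rw [lie_add, map_add, map_add, lie_add, hp, hq]
    | h_std_basis i j c =>
      have : Matrix.single i j c = c • Matrix.single i j (1 : R) := by simp
      rw [this, lie_smul, map_smul, map_smul, lie_smul, hx, hρ]
  have hE : ∀ a b : Fin n, (b : ℕ) = (a : ℕ) + 1 → Matrix.single a b (1 : R) ∈ N := by
    intro a b hab
    refine hmem _ fun i j => ?_
    have hb := b.isLt
    rw [hbr, hρ, map_sub, hab, matrixUnit_of_lt (d := 0) rfl, rootVector,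
      H.lie_e_matrixUnit (by omega) i.isLt j.isLt]
    simp only [apply_ite ρ, hρ, map_zero, Fin.ext_iff, hab]
  have hF : ∀ a b : Fin n, (b : ℕ) = (a : ℕ) + 1 → Matrix.single b a (1 : R) ∈ N := by
    intro a b hab
    refine hmem _ fun i j => ?_
    have hb := b.isLt
    rw [hbr, hρ, map_sub, hab, matrixUnit_of_gt (d := 0) rfl, rootVector, neg_neg,
      H.lie_f_matrixUnit (by omega) i.isLt j.isLt]
    simp only [apply_ite ρ, hρ, map_zero, Fin.ext_iff, hab]
  have hH : ∀ a : Fin n, Matrix.single a a (1 : R) ∈ N := by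
    intro a
    refine hmem _ fun i j => ?_
    rw [hbr, hρ, map_sub, matrixUnit_self, H.lie_h_matrixUnit a.isLt i.isLt j.isLt]
    simp only [apply_ite ρ, hρ, map_zero, Fin.ext_iff]
  -- Iterated brackets of the generators reach every off-diagonal matrix unit, so `N` is everything.
  have hup : ∀ (d : ℕ) (a b : Fin n), (b : ℕ) = (a : ℕ) + d + 1 →
      Matrix.single a b (1 : R) ∈ N ∧ Matrix.single b a (1 : R) ∈ N := by
    intro d
    induction d with
    | zero => exact fun a b hab => ⟨hE a b hab, hF a b hab⟩
    | succ d ih =>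
      intro a b hab
      have hb := b.isLt
      obtain ⟨h1, h2⟩ := ih a ⟨a + d + 1, by omega⟩ rfl
      have hab' : a ≠ b := by intro hc; simp [hc] at hab; omega
      have h3 := N.lie_mem h1 (hE ⟨a + d + 1, by omega⟩ b (by simp; omega))
      have h4 := N.lie_mem (hF ⟨a + d + 1, by omega⟩ b (by simp; omega)) h2
      rw [hbr, if_pos rfl, if_neg hab', sub_zero] at h3
      rw [hbr, if_pos rfl, if_neg (Ne.symm hab'), sub_zero] at h4
      exact ⟨h3, h4⟩
  have hall : ∀ x, x ∈ N := by
    intro x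
    induction x using Matrix.induction_on' with
    | h_zero => exact N.zero_mem
    | h_add p q hp hq => exact N.add_mem hp hq
    | h_std_basis i j c =>
      have : Matrix.single i j c = c • Matrix.single i j (1 : R) := by simp
      rw [this]
      refine N.smul_mem c ?_
      rcases Nat.lt_trichotomy i j with hij | hij | hij
      · obtain ⟨d, hd⟩ := Nat.exists_eq_add_of_lt hij
        exact (hup d i j hd).1
      · obtain rfl := Fin.ext hij
        exact hH i
      · obtain ⟨d, hd⟩ := Nat.exists_eq_add_of_lt hij
        exact (hup d j i hd).2
  refine ⟨{ ρ with map_lie' := fun {x y} => hall x y }, ?_, ?_, ?_⟩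
  · intro a b hab
    refine (hρ a b).trans ?_
    rw [hab, matrixUnit_of_lt (d := 0) rfl, rootVector]
  · intro a b hab
    refine (hρ b a).trans ?_
    rw [hab, matrixUnit_of_gt (d := 0) rfl, rootVector, neg_neg]
  · intro a
    exact (hρ a a).trans (matrixUnit_self _)

end SerrePresentation

/-! ### A residue identity -/

section Residues

open Polynomial

/-- Subtracting the node polynomial `q = ∏ (X - s)` does not change the values at the nodes and
brings the degree below their number. Lagrange interpolation then reads off the coefficient of
degree `S.card - 1` of `p - q`. -/
theorem sum_eval_div_prod_of_monic (S : Finset ℂ) (p : ℂ[X]) (hp : p.Monic)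
    (hdeg : p.natDegree = S.card) :
    ∑ r ∈ S, p.eval r / ∏ s ∈ S.erase r, (r - s) = p.nextCoeff + ∑ s ∈ S, s := by
  rcases S.eq_empty_or_nonempty with rfl | hS
  · have : p = 1 := hp.natDegree_eq_zero.mp (by simpa using hdeg)
    subst this
    simp [nextCoeff]
  have hcard : 0 < S.card := hS.card_pos
  set q : ℂ[X] := ∏ s ∈ S, (X - C s) with hq
  have hqm : q.Monic := monic_prod_of_monic _ _ fun s _ => monic_X_sub_C s
  have hqdeg : q.natDegree = S.card := by
    rw [hq, natDegree_prod_of_monic _ _ fun s _ => monic_X_sub_C s]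
    simp
  have hqn : q.nextCoeff = -∑ s ∈ S, s := by
    rw [hq, Monic.nextCoeff_prod _ _ fun s _ => monic_X_sub_C s]
    rw [← Finset.sum_neg_distrib]
    exact Finset.sum_congr rfl fun s _ => nextCoeff_X_sub_C s
  have hlt : (p - q).degree < S.card := by
    have h1 : p.degree = q.degree := by
      rw [degree_eq_natDegree hp.ne_zero, degree_eq_natDegree hqm.ne_zero, hdeg, hqdeg]
    refine (degree_sub_lt_left h1 hp.ne_zero (by rw [hp.leadingCoeff,
        hqm.leadingCoeff])).trans_le ?_
    rw [degree_eq_natDegree hp.ne_zero, hdeg]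
  have h2 := Lagrange.coeff_eq_sum (s := S) (v := id) Function.injective_id.injOn hlt
  simp only [id] at h2
  have h3 : (p - q).coeff (S.card - 1) = p.nextCoeff + ∑ s ∈ S, s := by
    rw [coeff_sub, ← sub_neg_eq_add, ← hqn, nextCoeff_of_natDegree_pos (by omega),
      nextCoeff_of_natDegree_pos (by omega), hdeg, hqdeg]
  rw [← h3, h2]
  refine Finset.sum_congr rfl fun r hr => ?_
  have : q.eval r = 0 := by
    rw [hq, eval_prod]
    exact Finset.prod_eq_zero hr (by simp)
  rw [eval_sub, this, sub_zero]

/-- The sum of the residues of `N(t) / ∏ (t - s) (t + 1 - s)` at its simple poles. -/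
noncomputable def residueSum (S : Finset ℂ) (N : ℂ[X]) : ℂ :=
  ∑ r ∈ S, (N.eval r / ((∏ s ∈ S.erase r, (r - s)) * ∏ s ∈ S.erase r, (r + 1 - s)) -
    N.eval (r - 1) / ((∏ s ∈ S.erase r, (r - s)) * ∏ s ∈ S.erase r, (r - 1 - s)))

/-- At a double pole, a point of `S` whose successor is also in `S`, a denominator of `residueSum`
is zero and the quotient is `0` by convention. Only the simple poles survive: the symmetric
difference of `S` and `S - 1`. There the common part of the two sets contributes a square. -/
theorem residueSum_eq (S : Finset ℂ) (N : ℂ[X]) :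
    residueSum S N =
      ∑ r ∈ (S \ S.image (· - 1)) ∪ (S.image (· - 1) \ S), N.eval r /
        ((∏ s ∈ ((S \ S.image (· - 1)) ∪ (S.image (· - 1) \ S)).erase r, (r - s)) *
          (∏ s ∈ S ∩ S.image (· - 1), (r - s)) ^ 2) := by
  set S' := S.image (· - 1) with hS'
  have hinj : Function.Injective (fun x : ℂ => x - 1) := sub_left_injective
  have hmem' : ∀ x, x - 1 ∈ S' ↔ x ∈ S := fun x => by
    rw [hS', Finset.mem_image]
    exact ⟨fun ⟨y, hy, hyx⟩ => by rwa [← hinj hyx], fun hx => ⟨x, hx, rfl⟩⟩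
  have hmem : ∀ x, x ∈ S' ↔ x + 1 ∈ S := fun x => by
    rw [← hmem' (x + 1), add_sub_cancel_right]
  have hdisj : Disjoint (S \ S') (S' \ S) :=
    Finset.disjoint_left.mpr fun x hx hx' => (Finset.mem_sdiff.mp hx').2 (Finset.mem_sdiff.mp hx).1
  rw [residueSum, Finset.sum_sub_distrib, Finset.sum_union hdisj, sub_eq_add_neg]
  have hprodS : ∀ g : ℂ → ℂ, ∏ s ∈ S, g s = (∏ s ∈ S \ S', g s) * ∏ s ∈ S ∩ S', g s := by
    intro g
    rw [mul_comm, ← Finset.prod_inter_mul_prod_sdiff S S']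
  have hprodS' : ∀ g : ℂ → ℂ, ∏ s ∈ S', g s = (∏ s ∈ S' \ S, g s) * ∏ s ∈ S ∩ S', g s := by
    intro g
    rw [mul_comm, Finset.inter_comm, ← Finset.prod_inter_mul_prod_sdiff S' S]
  congr 1
  · rw [← Finset.sum_inter_add_sum_sdiff S S', Finset.sum_eq_zero, zero_add]
    · refine Finset.sum_congr rfl fun r hr => ?_
      obtain ⟨hr1, hr2⟩ := Finset.mem_sdiff.mp hr
      congr 1
      have h1 : ∏ s ∈ S.erase r, (r + 1 - s) = ∏ s ∈ S', (r - s) := by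
        rw [hS', Finset.prod_image hinj.injOn, ← Finset.mul_prod_erase S _ hr1]
        simp only [sub_sub_cancel, one_mul]
        exact Finset.prod_congr rfl fun s _ => by ring
      have h2 : ∏ s ∈ S.erase r, (r - s) =
          (∏ s ∈ (S \ S').erase r, (r - s)) * ∏ s ∈ S ∩ S', (r - s) := by
        rw [mul_comm, ← Finset.prod_inter_mul_prod_sdiff (S.erase r) S']
        congr 1
        · refine Finset.prod_congr ?_ fun _ _ => rfl
          ext x
          simp only [Finset.mem_inter, Finset.mem_erase]
          exact ⟨fun h => ⟨h.1.2, h.2⟩, fun h => ⟨⟨fun hx => hr2 (hx ▸ h.2), h.1⟩, h.2⟩⟩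
        · refine Finset.prod_congr ?_ fun _ _ => rfl
          ext x
          simp only [Finset.mem_sdiff, Finset.mem_erase]
          tauto
      have h3 : ∏ s ∈ ((S \ S') ∪ (S' \ S)).erase r, (r - s) =
          (∏ s ∈ (S \ S').erase r, (r - s)) * ∏ s ∈ S' \ S, (r - s) := by
        rw [Finset.erase_union_distrib, Finset.erase_eq_of_notMem (s := S' \ S) (by simp [hr1]),
          Finset.prod_union (hdisj.mono_left (Finset.erase_subset _ _))]
      rw [h1, h2, h3, hprodS']
      ring
    · intro r hr
      obtain ⟨hr1, hr2⟩ := Finset.mem_inter.mp hr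
      rw [Finset.prod_eq_zero (f := fun s => r + 1 - s) (i := r + 1), mul_zero, div_zero]
      · exact Finset.mem_erase.mpr ⟨by simp, (hmem r).mp hr2⟩
      · simp
  · have hsum : ∀ g : ℂ → ℂ, ∑ r ∈ S, g (r - 1) = ∑ r ∈ S', g r := by
      intro g
      rw [hS', Finset.sum_image hinj.injOn]
    have h0 := hsum fun q => N.eval q /
      ((∏ s ∈ S.erase (q + 1), (q + 1 - s)) * ∏ s ∈ S.erase (q + 1), (q - s))
    simp only [sub_add_cancel] at h0
    rw [h0, ← Finset.sum_inter_add_sum_sdiff S' S, Finset.sum_eq_zero, zero_add,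
      ← Finset.sum_neg_distrib]
    · refine Finset.sum_congr rfl fun r hr => ?_
      obtain ⟨hr2, hr1⟩ := Finset.mem_sdiff.mp hr
      have hr3 := (hmem r).mp hr2
      rw [← div_neg]
      congr 1
      have h1 : -∏ s ∈ S.erase (r + 1), (r - s) = ∏ s ∈ S, (r - s) := by
        rw [← Finset.mul_prod_erase S _ hr3]
        ring
      have h1' : ∏ s ∈ S.erase (r + 1), (r + 1 - s) = ∏ s ∈ S'.erase r, (r - s) := by
        have : S'.erase r = (S.erase (r + 1)).image (· - 1) := by
          rw [Finset.image_erase hinj, add_sub_cancel_right]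
        rw [this, Finset.prod_image hinj.injOn]
        exact Finset.prod_congr rfl fun s _ => by ring
      have h2 : ∏ s ∈ S'.erase r, (r - s) =
          (∏ s ∈ (S' \ S).erase r, (r - s)) * ∏ s ∈ S ∩ S', (r - s) := by
        rw [mul_comm, ← Finset.prod_inter_mul_prod_sdiff (S'.erase r) S]
        congr 1
        · refine Finset.prod_congr ?_ fun _ _ => rfl
          ext x
          simp only [Finset.mem_inter, Finset.mem_erase]
          exact ⟨fun h => ⟨h.2, h.1.2⟩, fun h => ⟨⟨fun hx => hr1 (hx ▸ h.1), h.2⟩, h.1⟩⟩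
        · refine Finset.prod_congr ?_ fun _ _ => rfl
          ext x
          simp only [Finset.mem_sdiff, Finset.mem_erase]
          tauto
      have h3 : ∏ s ∈ ((S \ S') ∪ (S' \ S)).erase r, (r - s) =
          (∏ s ∈ (S' \ S).erase r, (r - s)) * ∏ s ∈ S \ S', (r - s) := by
        rw [Finset.erase_union_distrib, Finset.erase_eq_of_notMem (s := S \ S') (by simp [hr1]),
          mul_comm, Finset.prod_union (hdisj.mono_right (Finset.erase_subset _ _))]
      rw [← mul_neg, h1, h1', h2, h3, hprodS]
      ring
    · intro r hr
      obtain ⟨hr1, hr2⟩ := Finset.mem_inter.mp hr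
      rw [Finset.prod_eq_zero (f := fun s => r - s) (i := r), mul_zero, div_zero]
      · exact Finset.mem_erase.mpr ⟨by simp, hr2⟩
      · simp

/-- Number and sum of the poles, where the poles with multiplicity are `S` together with `S - 1`. -/
theorem card_and_sum_simpleNodes (S : Finset ℂ) :
    ((S \ S.image (· - 1)) ∪ (S.image (· - 1) \ S)).card + 2 * (S ∩ S.image (· - 1)).card =
        2 * S.card ∧
      ∑ s ∈ (S \ S.image (· - 1)) ∪ (S.image (· - 1) \ S), s +
        2 * ∑ s ∈ S ∩ S.image (· - 1), s = 2 * ∑ s ∈ S, s - S.card := by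
  have hinj : Function.Injective (fun x : ℂ => x - 1) := sub_left_injective
  set S' := S.image (· - 1) with hS'
  have hdisj : Disjoint (S \ S') (S' \ S) :=
    Finset.disjoint_left.mpr fun x hx hx' => (Finset.mem_sdiff.mp hx').2 (Finset.mem_sdiff.mp hx).1
  constructor
  · rw [Finset.card_union_of_disjoint hdisj]
    have h1 := Finset.card_inter_add_card_sdiff S S'
    have h2 := Finset.card_inter_add_card_sdiff S' S
    have h3 : S'.card = S.card := Finset.card_image_of_injective _ hinj
    rw [Finset.inter_comm] at h2
    omega
  · rw [Finset.sum_union hdisj]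
    have h1 := Finset.sum_inter_add_sum_sdiff S S' fun s => s
    have h2 := Finset.sum_inter_add_sum_sdiff S' S fun s => s
    have h3 : ∑ s ∈ S', s = ∑ s ∈ S, s - S.card := by
      rw [hS', Finset.sum_image hinj.injOn, Finset.sum_sub_distrib]
      simp
    rw [Finset.inter_comm] at h2
    linear_combination h1 + h2 + h3

/-- If `N` vanishes doubly at the double poles, the residues at the simple poles add up. -/
theorem residueSum_of_double_zeros (S : Finset ℂ) (N : ℂ[X]) (hN : N.Monic)
    (hdeg : N.natDegree = 2 * S.card) (hz : ∀ a ∈ S, a + 1 ∈ S → (X - C a) ^ 2 ∣ N) :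
    residueSum S N = N.nextCoeff + 2 * ∑ s ∈ S, s - S.card := by
  rw [residueSum_eq]
  obtain ⟨hcard, hsum⟩ := card_and_sum_simpleNodes S
  set T := (S \ S.image (· - 1)) ∪ (S.image (· - 1) \ S) with hT
  set D := S ∩ S.image (· - 1) with hD
  -- The factors for distinct poles are coprime, so all double zeros divide out at once; the degree
  -- of the quotient is the number of simple poles.
  have hdvd : ∏ a ∈ D, (X - C a) ^ 2 ∣ N := by
    refine Finset.prod_dvd_of_coprime ?_ ?_
    · intro a _ b _ hab
      exact (isCoprime_X_sub_C_of_isUnit_sub (sub_ne_zero.mpr hab).isUnit).pow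
    · intro a ha
      rw [hD, Finset.mem_inter, Finset.mem_image] at ha
      obtain ⟨ha, b, hb, rfl⟩ := ha
      exact hz _ ha (by simpa using hb)
  obtain ⟨N0, rfl⟩ := hdvd
  have hPm : (∏ a ∈ D, (X - C a) ^ 2).Monic :=
    monic_prod_of_monic _ _ fun a _ => (monic_X_sub_C a).pow 2
  have hN0 : N0.Monic := hPm.of_mul_monic_left hN
  have hPdeg : (∏ a ∈ D, (X - C a) ^ 2).natDegree = 2 * D.card := by
    rw [natDegree_prod_of_monic _ _ fun a _ => (monic_X_sub_C a).pow 2]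
    simp [mul_comm]
  have hPn : (∏ a ∈ D, (X - C a) ^ 2).nextCoeff = -(2 * ∑ a ∈ D, a) := by
    rw [Monic.nextCoeff_prod _ _ fun a _ => (monic_X_sub_C a).pow 2]
    simp [(monic_X_sub_C _).nextCoeff_pow, nextCoeff_X_sub_C, Finset.mul_sum]
  rw [hPm.natDegree_mul hN0] at hdeg
  have h1 := sum_eval_div_prod_of_monic T N0 hN0 (by omega)
  rw [hPm.nextCoeff_mul hN0, hPn]
  have h2 : ∑ r ∈ T, ((∏ a ∈ D, (X - C a) ^ 2) * N0).eval r /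
      ((∏ s ∈ T.erase r, (r - s)) * (∏ s ∈ D, (r - s)) ^ 2) =
      ∑ r ∈ T, N0.eval r / ∏ s ∈ T.erase r, (r - s) := by
    refine Finset.sum_congr rfl fun r hr => ?_
    have hne : (∏ s ∈ D, (r - s)) ^ 2 ≠ 0 := by
      refine pow_ne_zero _ (Finset.prod_ne_zero_iff.mpr fun s hs => sub_ne_zero.mpr ?_)
      rintro rfl
      rw [hD, Finset.mem_inter] at hs
      rw [hT, Finset.mem_union, Finset.mem_sdiff, Finset.mem_sdiff] at hr
      tauto
    rw [eval_mul, eval_prod]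
    simp only [eval_pow, eval_sub, eval_X, eval_C, Finset.prod_pow]
    rw [mul_comm, mul_div_mul_right _ _ hne]
  rw [h2, h1]
  linear_combination hsum

/-- With exactly one double pole, at which `N` vanishes, the residues at the simple poles
add up only if `N` vanishes doubly at the double pole. -/
theorem double_zero_of_residueSum (S : Finset ℂ) (N N0 : ℂ[X]) (hN0 : N0.Monic) (a : ℂ)
    (hN : N = (X - C a) * N0) (hdeg : N.natDegree = 2 * S.card)
    (ha : a ∈ S) (ha' : a + 1 ∈ S) (huniq : ∀ b ∈ S, b + 1 ∈ S → b = a)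
    (hsumN : residueSum S N = N.nextCoeff + 2 * ∑ s ∈ S, s - S.card) : N0.eval a = 0 := by
  rw [residueSum_eq] at hsumN
  obtain ⟨hcard, hsum⟩ := card_and_sum_simpleNodes S
  set T := (S \ S.image (· - 1)) ∪ (S.image (· - 1) \ S) with hT
  have hD : S ∩ S.image (· - 1) = {a} := by
    ext b
    simp only [Finset.mem_inter, Finset.mem_image, Finset.mem_singleton]
    constructor
    · rintro ⟨hb, c, hc, rfl⟩
      exact huniq _ hb (by simpa using hc)
    · rintro rfl
      exact ⟨ha, b + 1, ha', by simp⟩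
  rw [hD] at hcard hsum hsumN
  rw [Finset.card_singleton] at hcard
  rw [Finset.sum_singleton] at hsum
  have haT : a ∉ T := by
    have : a ∈ S ∩ S.image (· - 1) := by simp [hD]
    rw [hT, Finset.mem_union, Finset.mem_sdiff, Finset.mem_sdiff]
    rw [Finset.mem_inter] at this
    tauto
  rw [hN, (monic_X_sub_C a).natDegree_mul hN0, natDegree_X_sub_C] at hdeg
  -- After one factor `X - a` is cancelled, `a` is an ordinary node for `N0`. The sum over `insert a
  -- T` and the hypothesis on `residueSum` differ by the term at `a` alone, so that term is zero.
  have h1 := sum_eval_div_prod_of_monic (insert a T) N0 hN0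
    (by rw [Finset.card_insert_of_notMem haT]; omega)
  rw [Finset.sum_insert haT, Finset.sum_insert haT, Finset.erase_insert haT] at h1
  have h2 : ∑ r ∈ T, N.eval r / ((∏ s ∈ T.erase r, (r - s)) * (∏ s ∈ {a}, (r - s)) ^ 2) =
      ∑ r ∈ T, N0.eval r / ∏ s ∈ (insert a T).erase r, (r - s) := by
    refine Finset.sum_congr rfl fun r hr => ?_
    have hra : r ≠ a := fun h => haT (h ▸ hr)
    rw [Finset.erase_insert_of_ne hra.symm, Finset.prod_insert (by simp [haT]), hN,
      Finset.prod_singleton, eval_mul, eval_sub, eval_X, eval_C, sq, ← mul_assoc,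
      mul_comm (r - a), mul_div_mul_right _ _ (sub_ne_zero.mpr hra), mul_comm]
  rw [h2, hN, (monic_X_sub_C a).nextCoeff_mul hN0, nextCoeff_X_sub_C] at hsumN
  have h3 : N0.eval a / ∏ s ∈ T, (a - s) = 0 := by
    linear_combination h1 - hsumN + hsum
  rcases div_eq_zero_iff.mp h3 with h4 | h4
  · exact h4
  · obtain ⟨s, hs, hs'⟩ := Finset.prod_eq_zero_iff.mp h4
    exact absurd (sub_eq_zero.mp hs' ▸ hs) haT

end Residues

attribute [local instance] LieRing.ofAssociativeRing

/-! ### Shifted tableaux and the coefficients of the Gelfand-Tsetlin formulas -/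

section Coefficients

variable {n : ℕ}

@[simp] theorem shift_self (M : Tableau n) (u : Vertex n) (m : ℤ) :
    shift M u m u = M u + m := by simp [shift]

theorem shift_of_ne (M : Tableau n) {u w : Vertex n} (m : ℤ) (h : w ≠ u) :
    shift M u m w = M w := by simp [shift, h]

theorem shift_comm (M : Tableau n) (u v : Vertex n) (l m : ℤ) :
    shift (shift M u l) v m = shift (shift M v m) u l := by
  funext w
  simp only [shift]
  ring

theorem shift_shift_neg (M : Tableau n) (u : Vertex n) (m : ℤ) :
    shift (shift M u m) u (-m) = M := by
  funext w
  by_cases h : w = u <;> simp [shift, h]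

theorem ne_of_row_ne {u v : Vertex n} (h : u.row ≠ v.row) : u ≠ v := fun huv => h (huv ▸ rfl)

/-- The coefficient of the tableau obtained by moving the entry `u` by `s = ±1`. -/
noncomputable def moveCoeff (s : ℤ) (M : Tableau n) (u : Vertex n) : ℂ :=
  (∏ w : Vertex n with (w.row : ℤ) = u.row + s, (M u - M w)) /
    ∏ w : Vertex n with w.row = u.row ∧ w ≠ u, (M u - M w)

theorem raiseCoeff_eq (M : Tableau n) (u : Vertex n) : raiseCoeff M u = moveCoeff 1 M u := by
  rw [raiseCoeff, moveCoeff]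
  congr 1
  exact Finset.prod_congr (Finset.filter_congr fun w _ => by omega) fun _ _ => rfl

theorem lowerCoeff_eq (M : Tableau n) (u : Vertex n) : lowerCoeff M u = moveCoeff (-1) M u := by
  rw [lowerCoeff, moveCoeff]
  congr 1
  exact Finset.prod_congr (Finset.filter_congr fun w _ => by omega) fun _ _ => rfl

theorem moveCoeff_congr {s : ℤ} {M N : Tableau n} {u : Vertex n} (hu : N u = M u)
    (h : ∀ w : Vertex n, w.row = u.row ∨ (w.row : ℤ) = u.row + s → N w = M w) :
    moveCoeff s N u = moveCoeff s M u := by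
  rw [moveCoeff, moveCoeff]
  congr 1
  · refine Finset.prod_congr rfl fun w hw => ?_
    rw [hu, h w (Or.inr (Finset.mem_filter.mp hw).2)]
  · refine Finset.prod_congr rfl fun w hw => ?_
    rw [hu, h w (Or.inl (Finset.mem_filter.mp hw).2.1)]

theorem moveCoeff_shift {s : ℤ} (M : Tableau n) {u x : Vertex n} (m : ℤ)
    (h1 : x.row ≠ u.row) (h2 : (x.row : ℤ) ≠ u.row + s) :
    moveCoeff s (shift M x m) u = moveCoeff s M u := by
  refine moveCoeff_congr (shift_of_ne _ _ (ne_of_row_ne h1.symm)) fun w hw => ?_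
  refine shift_of_ne _ _ ?_
  rintro rfl
  rcases hw with hw | hw
  · exact h1 hw
  · exact h2 hw

theorem moveCoeff_eq_zero {s : ℤ} {M : Tableau n} {u w : Vertex n}
    (hw : (w.row : ℤ) = u.row + s) (h : M u = M w) : moveCoeff s M u = 0 := by
  rw [moveCoeff, Finset.prod_eq_zero (i := w) (by simp [hw]) (by simp [h]), zero_div]

/-- Dependence of a coefficient on one entry of its numerator. -/
theorem moveCoeff_num_one (s : ℤ) (M : Tableau n) {u x : Vertex n} (hx : (x.row : ℤ) = u.row + s)
    (hxu : x.row ≠ u.row) :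
    ∃ K : ℂ, ∀ N : Tableau n, (∀ w, w ≠ x → N w = M w) → moveCoeff s N u = (N u - N x) * K := by
  refine ⟨(∏ w ∈ (Finset.univ.filter fun w : Vertex n => (w.row : ℤ) = u.row + s).erase x,
      (M u - M w)) /
    ∏ w : Vertex n with w.row = u.row ∧ w ≠ u, (M u - M w), fun N hN => ?_⟩
  have hu : N u = M u := hN u (ne_of_row_ne hxu.symm)
  rw [moveCoeff, ← Finset.mul_prod_erase (Finset.univ.filter fun w : Vertex n =>
      (w.row : ℤ) = u.row + s) _
    (show x ∈ _ by simp [hx]), mul_div_assoc]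
  congr 2
  · refine Finset.prod_congr rfl fun w hw => ?_
    rw [hu, hN w (Finset.ne_of_mem_erase hw)]
  · refine Finset.prod_congr rfl fun w hw => ?_
    rw [hu, hN w (ne_of_row_ne fun h => hxu (h ▸ (Finset.mem_filter.mp hw).2.1))]

/-- Dependence of a coefficient on two entries of its numerator. -/
theorem moveCoeff_num_two (s : ℤ) (M : Tableau n) {u x y : Vertex n}
    (hx : (x.row : ℤ) = u.row + s) (hy : (y.row : ℤ) = u.row + s) (hxu : x.row ≠ u.row)
    (hxy : x ≠ y) : ∃ K : ℂ, ∀ N : Tableau n, (∀ w, w ≠ x → w ≠ y → N w = M w) →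
      moveCoeff s N u = (N u - N x) * (N u - N y) * K := by
  have hyu : y.row ≠ u.row := by omega
  refine ⟨(∏ w ∈ ((Finset.univ.filter fun w : Vertex n =>
      (w.row : ℤ) = u.row + s).erase x).erase y, (M u - M w)) /
    ∏ w : Vertex n with w.row = u.row ∧ w ≠ u, (M u - M w), fun N hN => ?_⟩
  have hu : N u = M u := hN u (ne_of_row_ne hxu.symm) (ne_of_row_ne hyu.symm)
  rw [moveCoeff, ← Finset.mul_prod_erase (Finset.univ.filter fun w : Vertex n =>
      (w.row : ℤ) = u.row + s) _
    (show x ∈ _ by simp [hx]),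
    ← Finset.mul_prod_erase ((Finset.univ.filter fun w : Vertex n =>
        (w.row : ℤ) = u.row + s).erase x) _
    (show y ∈ _ by simp [hy, Ne.symm hxy]), ← mul_assoc, mul_div_assoc]
  congr 2
  · refine Finset.prod_congr rfl fun w hw => ?_
    simp only [Finset.mem_erase] at hw
    rw [hu, hN w hw.2.1 hw.1]
  · refine Finset.prod_congr rfl fun w hw => ?_
    have := (Finset.mem_filter.mp hw).2.1
    rw [hu, hN w (ne_of_row_ne (by omega)) (ne_of_row_ne (by omega))]

/-- Dependence of a coefficient on one entry of its denominator. -/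
theorem moveCoeff_den_one (s : ℤ) (M : Tableau n) {u v : Vertex n} (hs : s ≠ 0)
    (hv : v.row = u.row) (huv : v ≠ u) :
    ∃ K : ℂ, ∀ N : Tableau n, (∀ w, w ≠ v → (w.row = u.row ∨ (w.row : ℤ) = u.row + s) → N w = M w) →
      moveCoeff s N u = K / (N u - N v) := by
  refine ⟨(∏ w : Vertex n with (w.row : ℤ) = u.row + s, (M u - M w)) /
    ∏ w ∈ (Finset.univ.filter fun w : Vertex n => w.row = u.row ∧ w ≠ u).erase v, (M u - M w),
        fun N hN => ?_⟩
  have hu : N u = M u := hN u huv.symm (Or.inl rfl)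
  have h1 : ∏ w : Vertex n with (w.row : ℤ) = u.row + s, (N u - N w) =
      ∏ w : Vertex n with (w.row : ℤ) = u.row + s, (M u - M w) := by
    refine Finset.prod_congr rfl fun w hw => ?_
    have := (Finset.mem_filter.mp hw).2
    rw [hu, hN w (ne_of_row_ne (by omega)) (Or.inr this)]
  have h2 : ∏ w ∈ (Finset.univ.filter fun w : Vertex n => w.row = u.row ∧ w ≠ u).erase v,
      (N u - N w) =
      ∏ w ∈ (Finset.univ.filter fun w : Vertex n => w.row = u.row ∧ w ≠ u).erase v,
          (M u - M w) := by
    refine Finset.prod_congr rfl fun w hw => ?_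
    have h2 := Finset.mem_filter.mp (Finset.mem_of_mem_erase hw)
    rw [hu, hN w (Finset.ne_of_mem_erase hw) (Or.inl h2.2.1)]
  rw [moveCoeff, ← Finset.mul_prod_erase (Finset.univ.filter
      fun w : Vertex n => w.row = u.row ∧ w ≠ u) _
    (show v ∈ _ by simp [hv, huv]), h1, h2, div_div, mul_comm (N u - N v)]

/-- Dependence of a coefficient on an entry of its numerator and one of its denominator. -/
theorem moveCoeff_num_den (s : ℤ) (M : Tableau n) {u v x : Vertex n} (hs : s ≠ 0)
    (hx : (x.row : ℤ) = u.row + s) (hv : v.row = u.row) (huv : v ≠ u) :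
    ∃ K : ℂ, ∀ N : Tableau n, (∀ w, w ≠ x → w ≠ v → N w = M w) →
      moveCoeff s N u = (N u - N x) * K / (N u - N v) := by
  refine ⟨(∏ w ∈ (Finset.univ.filter fun w : Vertex n => (w.row : ℤ) = u.row + s).erase x,
      (M u - M w)) /
    ∏ w ∈ (Finset.univ.filter fun w : Vertex n => w.row = u.row ∧ w ≠ u).erase v, (M u - M w),
        fun N hN => ?_⟩
  have hu : N u = M u := hN u (ne_of_row_ne (by omega)) huv.symm
  have h1 : ∏ w ∈ (Finset.univ.filter fun w : Vertex n => (w.row : ℤ) = u.row + s).erase x,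
      (N u - N w) =
      ∏ w ∈ (Finset.univ.filter fun w : Vertex n => (w.row : ℤ) = u.row + s).erase x,
          (M u - M w) := by
    refine Finset.prod_congr rfl fun w hw => ?_
    have h1 := Finset.mem_filter.mp (Finset.mem_of_mem_erase hw)
    rw [hu, hN w (Finset.ne_of_mem_erase hw) (ne_of_row_ne (by omega))]
  have h2 : ∏ w ∈ (Finset.univ.filter fun w : Vertex n => w.row = u.row ∧ w ≠ u).erase v,
      (N u - N w) =
      ∏ w ∈ (Finset.univ.filter fun w : Vertex n => w.row = u.row ∧ w ≠ u).erase v,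
          (M u - M w) := by
    refine Finset.prod_congr rfl fun w hw => ?_
    have h1 := Finset.mem_filter.mp (Finset.mem_of_mem_erase hw)
    rw [hu, hN w (ne_of_row_ne (by omega)) (Finset.ne_of_mem_erase hw)]
  rw [moveCoeff, ← Finset.mul_prod_erase (Finset.univ.filter
      fun w : Vertex n => w.row = u.row ∧ w ≠ u) _
    (show v ∈ _ by simp [hv, huv]), ← Finset.mul_prod_erase
    (Finset.univ.filter fun w : Vertex n => (w.row : ℤ) = u.row + s) _
    (show x ∈ _ by simp [hx]), h1, h2, ← mul_div_assoc, div_div, mul_comm (N u - N v)]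

end Coefficients

/-! ### Blocked moves -/

section Blocking

variable {n : ℕ}

/-- The nonstrict relation that bounds `u` by `z` from above (`s = 1`) or below (`s = -1`). -/
def geRel (s : ℤ) (z u : Vertex n) : Rel n := if s = 1 then .ge z u else .ge u z

/-- The strict relation that bounds `u` by `z` from above (`s = 1`) or below (`s = -1`). -/
def gtRel (s : ℤ) (z u : Vertex n) : Rel n := if s = 1 then .gt z u else .gt u z

/-- A relation of `C` between `u` and `z` is violated as soon as `M u` is moved by `s = ±1`. -/
def Blocks (C : Set (Rel n)) (s : ℤ) (M : Tableau n) (u z : Vertex n) : Prop :=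
  ((z.row : ℤ) = u.row + s ∧ M z = M u ∧ geRel s z u ∈ C) ∨
    ((z.row : ℤ) + s = u.row ∧ M z = M u + s ∧ gtRel s z u ∈ C)

theorem Blocks.symm {C : Set (Rel n)} {s : ℤ} (hs : s = 1 ∨ s = -1) {M : Tableau n}
    {u z : Vertex n} (h : Blocks C s M u z) : Blocks C (-s) M z u := by
  rcases h with ⟨h1, h2, h3⟩ | ⟨h1, h2, h3⟩
  · refine Or.inl ⟨by omega, h2.symm, ?_⟩
    rcases hs with rfl | rfl <;> simpa [geRel] using h3
  · refine Or.inr ⟨by omega, by rw [h2]; push_cast; ring, ?_⟩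
    rcases hs with rfl | rfl <;> simpa [gtRel] using h3

theorem Blocks.row_ne {C : Set (Rel n)} {s : ℤ} (hs : s = 1 ∨ s = -1) {M : Tableau n}
    {u z : Vertex n} (h : Blocks C s M u z) : z.row ≠ u.row := by
  rcases h with ⟨h1, -⟩ | ⟨h1, -⟩ <;> omega

/-- Moving `u` further than allowed violates the blocking relation. -/
theorem Blocks.not_satisfies {C : Set (Rel n)} {s : ℤ} (hs : s = 1 ∨ s = -1) {M : Tableau n}
    {u z : Vertex n} (h : Blocks C s M u z) {N : Tableau n} {j : ℤ} (hj : 0 < j)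
    (hN : N u - N z = M u - M z + s * j) : ¬ Satisfies C N := by
  intro hsat
  rcases h with ⟨-, h2, h3⟩ | ⟨-, h2, h3⟩
  · rcases hs with rfl | rfl
    · obtain ⟨m, hm, hm'⟩ := hsat _ h3
      have h : ((m : ℤ) : ℂ) = ((-j : ℤ) : ℂ) := by
        rw [← hm']; push_cast at hN ⊢; linear_combination -hN + h2
      have := Int.cast_injective h
      omega
    · obtain ⟨m, hm, hm'⟩ := hsat _ h3
      have h : ((m : ℤ) : ℂ) = ((-j : ℤ) : ℂ) := by
        rw [← hm']; push_cast at hN ⊢; linear_combination hN - h2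
      have := Int.cast_injective h
      omega
  · rcases hs with rfl | rfl
    · obtain ⟨m, hm, hm'⟩ := hsat _ h3
      have h : ((m : ℤ) : ℂ) = ((1 - j : ℤ) : ℂ) := by
        rw [← hm']; push_cast at hN h2 ⊢; linear_combination -hN + h2
      have := Int.cast_injective h
      omega
    · obtain ⟨m, hm, hm'⟩ := hsat _ h3
      have h : ((m : ℤ) : ℂ) = ((1 - j : ℤ) : ℂ) := by
        rw [← hm']; push_cast at hN h2 ⊢; linear_combination hN - h2
      have := Int.cast_injective h
      omega

theorem Rel.Holds.of_sub_eq {r : Rel n} {M N : Tableau n} (h : r.Holds M)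
    (hN : ∀ u v, r.Involves u → r.Involves v → N u - N v = M u - M v) : r.Holds N := by
  cases r with
  | ge u v => exact by rw [Rel.Holds] at h ⊢; rwa [hN u v (Or.inl rfl) (Or.inr rfl)]
  | gt u v => exact by rw [Rel.Holds] at h ⊢; rwa [hN u v (Or.inl rfl) (Or.inr rfl)]

/-- One step changes an integral difference by one, so a broken relation involves `u` and held
before the move with the least allowed difference. Relations of `𝓡⁰` live in the top row and are
unaffected. -/
theorem exists_blocks {C : Set (Rel n)} (hC : C ⊆ setR n ∪ setR0 n) {s : ℤ}
    (hs : s = 1 ∨ s = -1) {M : Tableau n} {u : Vertex n} (hu : u.row < n) (hM : Satisfies C M)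
    (hM' : ¬ Satisfies C (shift M u s)) : ∃ z, Blocks C s M u z := by
  simp only [Satisfies, not_forall] at hM'
  obtain ⟨r, hr, hr'⟩ := hM'
  have hrM := hM r hr
  rcases hC hr with ⟨a, b, hab, rfl | rfl⟩ | ⟨a, b, ha, hb, -, rfl⟩
  · have hne : a ≠ b := ne_of_row_ne (by omega)
    obtain ⟨m, hm, hm'⟩ := hrM
    by_cases hua : a = u
    · subst hua
      rcases hs with rfl | rfl
      · exact absurd ⟨m + 1, by omega, by
          rw [shift_self, shift_of_ne _ _ hne.symm]; push_cast; linear_combination hm'⟩ hr'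
      · refine ⟨b, Or.inl ⟨by omega, ?_, by simpa [geRel] using hr⟩⟩
        by_contra hc
        refine hr' ⟨m - 1, ?_, by
          rw [shift_self, shift_of_ne _ _ hne.symm]; push_cast; linear_combination hm'⟩
        have : m ≠ 0 := by
          rintro rfl
          exact hc (by push_cast at hm'; linear_combination -hm')
        omega
    · by_cases hub : b = u
      · subst hub
        rcases hs with rfl | rfl
        · refine ⟨a, Or.inl ⟨by omega, ?_, by simpa [geRel] using hr⟩⟩
          by_contra hc
          refine hr' ⟨m - 1, ?_, by
            rw [shift_self, shift_of_ne _ _ hne]; push_cast; linear_combination hm'⟩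
          have : m ≠ 0 := by
            rintro rfl
            exact hc (by push_cast at hm'; linear_combination hm')
          omega
        · exact absurd ⟨m + 1, by omega, by
            rw [shift_self, shift_of_ne _ _ hne]; push_cast; linear_combination hm'⟩ hr'
      · exact absurd ⟨m, hm, by rw [shift_of_ne _ _ hua, shift_of_ne _ _ hub, hm']⟩ hr'
  · have hne : a ≠ b := ne_of_row_ne (by omega)
    obtain ⟨m, hm, hm'⟩ := hrM
    by_cases hua : a = u
    · subst hua
      rcases hs with rfl | rfl
      · refine ⟨b, Or.inr ⟨by omega, ?_, by simpa [gtRel] using hr⟩⟩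
        by_contra hc
        refine hr' ⟨m - 1, ?_, by
          rw [shift_self, shift_of_ne _ _ hne.symm]; push_cast; linear_combination hm'⟩
        have : m ≠ 1 := by
          rintro rfl
          exact hc (by push_cast at hm' ⊢; linear_combination hm')
        omega
      · exact absurd ⟨m + 1, by omega, by
          rw [shift_self, shift_of_ne _ _ hne.symm]; push_cast; linear_combination hm'⟩ hr'
    · by_cases hub : b = u
      · subst hub
        rcases hs with rfl | rfl
        · exact absurd ⟨m + 1, by omega, by
            rw [shift_self, shift_of_ne _ _ hne]; push_cast; linear_combination hm'⟩ hr'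
        · refine ⟨a, Or.inr ⟨by omega, ?_, by simpa [gtRel] using hr⟩⟩
          by_contra hc
          refine hr' ⟨m - 1, ?_, by
            rw [shift_self, shift_of_ne _ _ hne]; push_cast; linear_combination hm'⟩
          have : m ≠ 1 := by
            rintro rfl
            exact hc (by push_cast at hm' ⊢; linear_combination -hm')
          omega
      · exact absurd ⟨m, hm, by rw [shift_of_ne _ _ hua, shift_of_ne _ _ hub, hm']⟩ hr'
  · refine absurd (hrM.of_sub_eq fun x y hx hy => ?_) hr'
    rw [shift_of_ne, shift_of_ne]
    · rcases hy with rfl | rfl <;> exact ne_of_row_ne (by omega)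
    · rcases hx with rfl | rfl <;> exact ne_of_row_ne (by omega)

/-- A path of two moves that leaves the satisfying tableaux and returns has coefficient zero. -/
theorem moveCoeff_mul_eq_zero {C : Set (Rel n)} (hC : C ⊆ setR n ∪ setR0 n) {s s' : ℤ}
    (hs : s = 1 ∨ s = -1) (hs' : s' = 1 ∨ s' = -1) {M : Tableau n} {u x : Vertex n}
    (hu : u.row < n) (hM : Satisfies C M) (hM' : ¬ Satisfies C (shift M u s))
    (hN : Satisfies C (shift (shift M u s) x s')) :
    moveCoeff s M u * moveCoeff s' (shift M u s) x = 0 := by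
  -- The broken relation is repaired only by moving `u` back or by moving `z` in the same direction.
  -- If `z` is in row `u.row + s`, the first coefficient has the factor `M u - M z = 0`; otherwise
  -- the repairing move has the vanishing factor.
  obtain ⟨z, hz⟩ := exists_blocks hC hs hu hM hM'
  have hzu : z ≠ u := ne_of_row_ne (hz.row_ne hs)
  by_cases hss : s' = s
  · subst hss
    by_cases hxu : x = u
    · subst hxu
      refine absurd hN (hz.not_satisfies hs (j := 2) (by omega) ?_)
      rw [shift_self, shift_self, shift_of_ne _ _ hzu, shift_of_ne _ _ hzu]
      push_cast
      ring
    by_cases hxz : x = z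
    · subst hxz
      rcases hz with ⟨h1, h2, -⟩ | ⟨h1, h2, -⟩
      · rw [moveCoeff_eq_zero h1 h2.symm, zero_mul]
      · rw [moveCoeff_eq_zero (M := shift M u s') h1.symm, mul_zero]
        rw [shift_self, shift_of_ne _ _ hzu, h2]
    · refine absurd hN (hz.not_satisfies hs (j := 1) (by omega) ?_)
      rw [shift_of_ne _ _ (Ne.symm hxu), shift_self, shift_of_ne _ _ (Ne.symm hxz),
        shift_of_ne _ _ hzu]
      push_cast
      ring
  · obtain rfl : s' = -s := by omega
    by_cases hxu : x = u
    · subst hxu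
      rcases hz with ⟨h1, h2, -⟩ | ⟨h1, h2, -⟩
      · rw [moveCoeff_eq_zero h1 h2.symm, zero_mul]
      · rw [moveCoeff_eq_zero (M := shift M x s) (w := z) (by omega), mul_zero]
        rw [shift_self, shift_of_ne _ _ hzu, h2]
    by_cases hxz : x = z
    · subst hxz
      refine absurd hN (hz.not_satisfies hs (j := 2) (by omega) ?_)
      rw [shift_of_ne _ _ (Ne.symm hxu), shift_self, shift_self, shift_of_ne _ _ hxu]
      push_cast
      ring
    · refine absurd hN (hz.not_satisfies hs (j := 1) (by omega) ?_)
      rw [shift_of_ne _ _ (Ne.symm hxu), shift_self, shift_of_ne _ _ (Ne.symm hxz),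
        shift_of_ne _ _ hzu]
      push_cast
      ring

/-- A path of three moves in one direction that leaves the satisfying tableaux and returns has
coefficient zero. -/
theorem moveCoeff_mul_mul_eq_zero {C : Set (Rel n)} (hC : C ⊆ setR n ∪ setR0 n) {s : ℤ}
    (hs : s = 1 ∨ s = -1) {M : Tableau n} {u x y : Vertex n} (hu : u.row < n) (hx : x.row < n)
    (hM : Satisfies C M)
    (hM' : ¬ Satisfies C (shift M u s) ∨ ¬ Satisfies C (shift (shift M u s) x s))
    (hN : Satisfies C (shift (shift (shift M u s) x s) y s)) :
    moveCoeff s M u * moveCoeff s (shift M u s) x *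
      moveCoeff s (shift (shift M u s) x s) y = 0 := by
  by_cases h1 : Satisfies C (shift M u s)
  · rw [mul_assoc, moveCoeff_mul_eq_zero hC hs hs hx h1 (hM'.resolve_left (not_not.mpr h1)) hN,
      mul_zero]
  by_cases h2 : Satisfies C (shift (shift M u s) x s)
  · rw [moveCoeff_mul_eq_zero hC hs hs hu hM h1 h2, zero_mul]
  obtain ⟨z, hz⟩ := exists_blocks hC hs hu hM h1
  have hzu : z ≠ u := ne_of_row_ne (hz.row_ne hs)
  rcases hz with ⟨h3, h4, -⟩ | ⟨h3, h4, h5⟩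
  · rw [moveCoeff_eq_zero h3 h4.symm, zero_mul, zero_mul]
  -- Now only a move of `z` can repair the relation. If `u` has moved once, the numerator of that
  -- move vanishes at `u`; if `u` has moved twice, one move of `z` is not enough.
  have hz : Blocks C s M u z := Or.inr ⟨h3, h4, h5⟩
  by_cases hxz : x = z
  · subst hxz
    rw [moveCoeff_eq_zero (M := shift M u s) (u := x) (w := u) h3.symm, mul_zero, zero_mul]
    rw [shift_self, shift_of_ne _ _ hzu, h4]
  by_cases hxu : x = u
  · subst hxu
    by_cases hyz : y = z
    · subst hyz
      refine absurd hN (hz.not_satisfies hs (j := 1) (by omega) ?_)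
      rw [shift_of_ne _ _ (Ne.symm hzu), shift_self, shift_self, shift_self, shift_of_ne _ _ hzu,
        shift_of_ne _ _ hzu]
      push_cast
      ring
    · by_cases hyu : y = x
      · subst hyu
        refine absurd hN (hz.not_satisfies hs (j := 3) (by omega) ?_)
        rw [shift_self, shift_self, shift_self, shift_of_ne _ _ hzu,
          shift_of_ne _ _ hzu, shift_of_ne _ _ hzu]
        push_cast
        ring
      · refine absurd hN (hz.not_satisfies hs (j := 2) (by omega) ?_)
        rw [shift_of_ne _ _ (Ne.symm hyu), shift_self, shift_self, shift_of_ne _ _ (Ne.symm hyz),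
          shift_of_ne _ _ hzu, shift_of_ne _ _ hzu]
        push_cast
        ring
  · by_cases hyz : y = z
    · subst hyz
      rw [moveCoeff_eq_zero (u := y) (w := u) h3.symm, mul_zero]
      rw [shift_of_ne _ _ (Ne.symm hxu), shift_self, shift_of_ne _ _ (Ne.symm hxz),
        shift_of_ne _ _ hzu, h4]
    · by_cases hyu : y = u
      · subst hyu
        refine absurd hN (hz.not_satisfies hs (j := 2) (by omega) ?_)
        rw [shift_self, shift_of_ne _ _ (Ne.symm hxu), shift_self, shift_of_ne _ _ (Ne.symm hyz),
          shift_of_ne _ _ (Ne.symm hxz), shift_of_ne _ _ hzu]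
        push_cast
        ring
      · refine absurd hN (hz.not_satisfies hs (j := 1) (by omega) ?_)
        rw [shift_of_ne _ _ (Ne.symm hyu), shift_of_ne _ _ (Ne.symm hxu), shift_self,
          shift_of_ne _ _ (Ne.symm hyz), shift_of_ne _ _ (Ne.symm hxz), shift_of_ne _ _ hzu]
        push_cast
        ring

end Blocking

/-! ### The Gelfand-Tsetlin operators -/

section Operators

variable {n : ℕ}

/-- All tableaux `T(L + z)` with `z` integral and zero in the top row. -/
def latticeSet (L : Tableau n) : Set (Tableau n) :=
  {M | ∃ z : Vertex n → ℤ, (∀ v, v.row = n → z v = 0) ∧ ∀ v, M v = L v + (z v : ℂ)}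

theorem mem_basisSet {C : Set (Rel n)} {L M : Tableau n} :
    M ∈ basisSet C L ↔ M ∈ latticeSet L ∧ Satisfies C M := Iff.rfl

theorem self_mem_latticeSet (L : Tableau n) : L ∈ latticeSet L :=
  ⟨0, fun _ _ => rfl, fun v => by simp⟩

theorem shift_mem_latticeSet {L M : Tableau n} (h : M ∈ latticeSet L) {u : Vertex n}
    (hu : u.row < n) (m : ℤ) : shift M u m ∈ latticeSet L := by
  obtain ⟨z, hz, hM⟩ := h
  refine ⟨fun v => z v + if v = u then m else 0, fun v hv => ?_, fun v => ?_⟩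
  · have : v ≠ u := ne_of_row_ne (by omega)
    simp [hz v hv, this]
  · by_cases h : v = u
    · subst h; simp [hM]; ring
    · simp [hM, h, shift_of_ne]

theorem latticeSet_subset {L M : Tableau n} (h : M ∈ latticeSet L) :
    latticeSet M ⊆ latticeSet L := by
  obtain ⟨z, hz, hM⟩ := h
  rintro N ⟨y, hy, hN⟩
  exact ⟨z + y, fun v hv => by simp [hz v hv, hy v hv], fun v => by
    rw [hN, hM]; push_cast [Pi.add_apply]; ring⟩

theorem IsRealization.of_mem {C : Set (Rel n)} {L M : Tableau n} (hL : IsRealization C L)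
    (hM : M ∈ basisSet C L) : IsRealization C M :=
  ⟨hM.2, fun N hN => hL.2 N ⟨latticeSet_subset hM.1 hN.1, hN.2⟩⟩

theorem IsRealization.not_satisfies {C : Set (Rel n)} {L N : Tableau n} (hL : IsRealization C L)
    (hN : N ∈ latticeSet L) {u w : Vertex n} (huw : u ≠ w) (hrow : u.row = w.row)
    (hu : u.row < n) (h : N u = N w) : ¬ Satisfies C N :=
  fun hsat => hL.2 N ⟨hN, hsat⟩ u w huw hrow hu h

theorem vec_of_mem {B : Set (Tableau n)} {M : Tableau n} (h : M ∈ B) :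
    vec B M = Finsupp.single ⟨M, h⟩ 1 := dif_pos h

theorem vec_of_notMem {B : Set (Tableau n)} {M : Tableau n} (h : M ∉ B) : vec B M = 0 :=
  dif_neg h

/-- The operator that moves the entries of row `k` by `s`. -/
noncomputable def gtOp (B : Set (Tableau n)) (s : ℤ) (k : ℕ) : Module.End ℂ (B →₀ ℂ) :=
  Finsupp.linearCombination ℂ fun M : B =>
    ∑ u : Vertex n with u.row = k, moveCoeff s M u • vec B (shift M u s)

theorem gtOp_vec {B : Set (Tableau n)} (s : ℤ) (k : ℕ) {M : Tableau n} (hM : M ∈ B) :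
    gtOp B s k (vec B M) = ∑ u : Vertex n with u.row = k, moveCoeff s M u • vec B
        (shift M u s) := by
  rw [vec_of_mem hM, gtOp, Finsupp.linearCombination_single, one_smul]

theorem end_ext {B : Set (Tableau n)} {f g : Module.End ℂ (B →₀ ℂ)}
    (h : ∀ M ∈ B, f (vec B M) = g (vec B M)) : f = g := by
  refine Finsupp.lhom_ext' fun M => LinearMap.ext_ring ?_
  have := h M M.2
  rwa [vec_of_mem M.2] at this

/-! ### Products of the operators on the tableaux satisfying `C`. -/

section Basis

variable {C : Set (Rel n)} {L : Tableau n} (hC : C ⊆ setR n ∪ setR0 n)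

-- An intermediate tableau outside the basis counts as zero on the left but is kept on the right.
-- The extra terms vanish: either the path returns, and its coefficient is zero, or its end is
-- outside the basis as well.
include hC in
theorem gtOp_gtOp_vec {s s' : ℤ} (hs : s = 1 ∨ s = -1) (hs' : s' = 1 ∨ s' = -1) {k l : ℕ}
    (hk : k < n) {M : Tableau n} (hM : M ∈ basisSet C L) :
    gtOp (basisSet C L) s' l (gtOp (basisSet C L) s k (vec (basisSet C L) M)) =
      ∑ u : Vertex n with u.row = k, ∑ x : Vertex n with x.row = l,
        (moveCoeff s M u * moveCoeff s' (shift M u s) x) •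
          vec (basisSet C L) (shift (shift M u s) x s') := by
  rw [gtOp_vec s k hM, map_sum]
  refine Finset.sum_congr rfl fun u hu => ?_
  have hu' : u.row = k := (Finset.mem_filter.mp hu).2
  have hlat := shift_mem_latticeSet hM.1 (u := u) (by omega) s
  rw [map_smul]
  by_cases h : Satisfies C (shift M u s)
  · rw [gtOp_vec s' l (mem_basisSet.mpr ⟨hlat, h⟩), Finset.smul_sum]
    exact Finset.sum_congr rfl fun x _ => smul_smul _ _ _
  · rw [vec_of_notMem (B := basisSet C L) fun hmem => h hmem.2, map_zero, smul_zero]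
    refine (Finset.sum_eq_zero fun x _ => ?_).symm
    by_cases h' : shift (shift M u s) x s' ∈ basisSet C L
    · rw [moveCoeff_mul_eq_zero hC hs hs' (by omega) hM.2 h h'.2, zero_smul]
    · rw [vec_of_notMem h', smul_zero]

include hC in
theorem gtOp_gtOp_gtOp_vec {s : ℤ} (hs : s = 1 ∨ s = -1) {k l m : ℕ}
    (hk : k < n) (hl : l < n) {M : Tableau n} (hM : M ∈ basisSet C L) :
    gtOp (basisSet C L) s m (gtOp (basisSet C L) s l (gtOp (basisSet C L) s k
      (vec (basisSet C L) M))) =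
      ∑ u : Vertex n with u.row = k, ∑ x : Vertex n with x.row = l, ∑ y : Vertex n with y.row = m,
        (moveCoeff s M u * moveCoeff s (shift M u s) x * moveCoeff s (shift (shift M u s) x s) y) •
          vec (basisSet C L) (shift (shift (shift M u s) x s) y s) := by
  rw [gtOp_gtOp_vec hC hs hs hk hM, map_sum]
  refine Finset.sum_congr rfl fun u hu => ?_
  have hu' : u.row = k := (Finset.mem_filter.mp hu).2
  have hlat := shift_mem_latticeSet hM.1 (u := u) (by omega) s
  rw [map_sum]
  refine Finset.sum_congr rfl fun x hx => ?_
  have hx' : x.row = l := (Finset.mem_filter.mp hx).2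
  have hlat' := shift_mem_latticeSet hlat (u := x) (by omega) s
  rw [map_smul]
  by_cases h : Satisfies C (shift M u s) ∧ Satisfies C (shift (shift M u s) x s)
  · rw [gtOp_vec s m (mem_basisSet.mpr ⟨hlat', h.2⟩), Finset.smul_sum]
    exact Finset.sum_congr rfl fun y _ => smul_smul _ _ _
  · have h0 : ∀ y, (moveCoeff s M u * moveCoeff s (shift M u s) x *
        moveCoeff s (shift (shift M u s) x s) y) •
          vec (basisSet C L) (shift (shift (shift M u s) x s) y s) = 0 := by
      intro y
      by_cases h' : shift (shift (shift M u s) x s) y s ∈ basisSet C L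
      · rw [moveCoeff_mul_mul_eq_zero hC hs (by omega) (by omega) hM.2
          (not_and_or.mp h) h'.2, zero_smul]
      · rw [vec_of_notMem h', smul_zero]
    rw [Finset.sum_eq_zero fun y _ => h0 y]
    by_cases h1 : Satisfies C (shift (shift M u s) x s)
    · rw [moveCoeff_mul_eq_zero hC hs hs (by omega) hM.2 (fun h2 => h ⟨h2, h1⟩) h1, zero_smul]
    · rw [vec_of_notMem (B := basisSet C L) fun hmem => h1 hmem.2, map_zero, smul_zero]

include hC in
/-- Operators of distinct rows in opposite directions commute. -/
theorem gtOp_mul_opposite {s : ℤ} (hs : s = 1 ∨ s = -1) {k l : ℕ} (hk : k < n) (hl : l < n)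
    (hkl : k ≠ l) : 
    gtOp (basisSet C L) s k * gtOp (basisSet C L) (-s) l =
      gtOp (basisSet C L) (-s) l * gtOp (basisSet C L) s k := by
  refine end_ext fun M hM => ?_
  rw [Module.End.mul_apply, Module.End.mul_apply,
    gtOp_gtOp_vec hC (s := -s) (s' := s) (by omega) hs hl hM,
    gtOp_gtOp_vec hC (s := s) (s' := -s) hs (by omega) hk hM, Finset.sum_comm]
  refine Finset.sum_congr rfl fun u hu => Finset.sum_congr rfl fun x hx => ?_
  have hu' : u.row = k := (Finset.mem_filter.mp hu).2
  have hx' : x.row = l := (Finset.mem_filter.mp hx).2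
  have hux : u ≠ x := ne_of_row_ne (by omega)
  rw [shift_comm]
  congr 1
  -- In this case each coefficient sees the other entry through one linear factor, and the two
  -- orders give the same product. Otherwise neither coefficient depends on the other entry.
  by_cases h : (x.row : ℤ) = u.row + s
  · obtain ⟨K, hK⟩ := moveCoeff_num_one s M h (by omega)
    obtain ⟨K', hK'⟩ := moveCoeff_num_one (-s) M (u := x) (x := u) (by omega) (by omega)
    rw [hK M fun _ _ => rfl, hK' M fun _ _ => rfl, hK _ fun w hw => shift_of_ne _ _ hw,
      hK' _ fun w hw => shift_of_ne _ _ hw, shift_self, shift_self, shift_of_ne _ _ hux,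
      shift_of_ne _ _ hux.symm]
    push_cast
    ring
  · rw [moveCoeff_shift _ _ (by omega) h, moveCoeff_shift _ _ (by omega) (by omega), mul_comm]

include hC in
/-- Operators of distant rows in the same direction commute. -/
theorem gtOp_mul_far {s : ℤ} (hs : s = 1 ∨ s = -1) {k l : ℕ} (hk : k < n) (hl : l < n)
    (hkl : k + 1 < l) : 
    gtOp (basisSet C L) s k * gtOp (basisSet C L) s l =
      gtOp (basisSet C L) s l * gtOp (basisSet C L) s k := by
  refine end_ext fun M hM => ?_
  rw [Module.End.mul_apply, Module.End.mul_apply,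
    gtOp_gtOp_vec hC hs hs hl hM, gtOp_gtOp_vec hC hs hs hk hM, Finset.sum_comm]
  refine Finset.sum_congr rfl fun u hu => Finset.sum_congr rfl fun x hx => ?_
  have hu' : u.row = k := (Finset.mem_filter.mp hu).2
  have hx' : x.row = l := (Finset.mem_filter.mp hx).2
  rw [shift_comm, moveCoeff_shift _ _ (by omega) (by omega),
    moveCoeff_shift _ _ (by omega) (by omega), mul_comm]

end Basis

end Operators

/-! ### Admissibility from a local condition -/

section LocalCondition

variable {n : ℕ}

/-- The entry `z` gives a zero of the numerators of the coefficients that move `u` by `s` and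
back. -/
def Tight (s : ℤ) (M : Tableau n) (u z : Vertex n) : Prop :=
  ((z.row : ℤ) = u.row + s ∧ M z = M u) ∨ ((z.row : ℤ) + s = u.row ∧ M z = M u + s)

theorem Blocks.tight {C : Set (Rel n)} {s : ℤ} {M : Tableau n} {u z : Vertex n}
    (h : Blocks C s M u z) : Tight s M u z :=
  h.imp (fun h => ⟨h.1, h.2.1⟩) fun h => ⟨h.1, h.2.1⟩

/-- If moving `u` by `s` makes it equal to `w`, and one position `x` blocks this move and the
opposite move of `w`, then there is a second zero, and, for `x` below the top row, a second position
that blocks the move of `u`. -/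
def LocallyAdmissible (C : Set (Rel n)) : Prop :=
  ∀ M, IsRealization C M → ∀ s : ℤ, s = 1 ∨ s = -1 → ∀ u w : Vertex n, u.row = w.row →
    u.row < n → M w = M u + s → ∀ x, Blocks C s M u x → Blocks C (-s) M w x →
      (∃ z, z ≠ x ∧ Tight s M u z) ∧ (x.row < n → ∃ t, t ≠ x ∧ Blocks C s M u t)

/-- This disposes of the terms of the Serre relation whose denominators may vanish: their target is
not in the basis. If `N` satisfied `C`, then `u` could be blocked only by `x`, and `x` only by `w`.
So `x` would block both `u` and `w`, and the local condition would give a second position blocking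
`u`. -/
theorem LocallyAdmissible.not_satisfies {C : Set (Rel n)} (hloc : LocallyAdmissible C)
    (hC : C ⊆ setR n ∪ setR0 n) {s : ℤ} (hs : s = 1 ∨ s = -1) {M : Tableau n}
    (hM : IsRealization C M) {u w x : Vertex n} (huw : u.row = w.row) (hu : u.row < n)
    (hx : x.row < n) (hxu : x.row ≠ u.row) (h : M w = M u + s) {N : Tableau n}
    (hNu : N u = M u + s) (hNw : N w = M w + s) (hNx : N x = M x + s)
    (hN : ∀ v, v ≠ u → v ≠ w → v ≠ x → N v = M v) : ¬ Satisfies C N := by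
  intro hsat
  have hs0 : (s : ℂ) ≠ 0 := by rcases hs with rfl | rfl <;> norm_num
  have hne : u ≠ w := by
    rintro rfl
    exact hs0 (by linear_combination -h)
  have hux : u ≠ x := ne_of_row_ne (by omega)
  have hwx : w ≠ x := ne_of_row_ne (by omega)
  -- a position other than `x` cannot block `u`
  have hblock : ∀ t, Blocks C s M u t → t = x := by
    intro t ht
    by_contra htx
    have := ht.row_ne hs
    refine ht.not_satisfies hs (j := 1) (by omega) ?_ hsat
    rw [hNu, hN t (ne_of_row_ne (by omega)) (ne_of_row_ne (by omega)) htx]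
    push_cast
    ring
  have hself := self_mem_latticeSet M
  have hux' : Blocks C s M u x := by
    obtain ⟨t, ht⟩ := exists_blocks hC hs hu hM.1
      (hM.not_satisfies (shift_mem_latticeSet hself hu s) hne huw hu (by
        rw [shift_self, shift_of_ne _ _ hne.symm, h]))
    exact hblock t ht ▸ ht
  -- the move of `x` is blocked by `w`
  have hxw : Blocks C s M x w := by
    -- If `x` could move, `u` would remain blocked, since its move still makes it equal to `w`. The
    -- blocking position is not `x`, whose difference from `u` has changed, and any other one would
    -- block `u` already in `M`.
    by_cases hMx : Satisfies C (shift M x s)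
    · exfalso
      obtain ⟨t, ht⟩ := exists_blocks hC hs hu hMx
        (hM.not_satisfies (shift_mem_latticeSet (shift_mem_latticeSet hself hx s) hu s) hne huw hu
          (by rw [shift_self, shift_of_ne _ _ hne.symm, shift_of_ne _ _ hux, shift_of_ne _ _ hwx,
            h]))
      by_cases htx : t = x
      · subst htx
        have h1 : Tight s (shift M t s) u t := ht.tight
        have h2 := hux'.tight
        rw [Tight, shift_self, shift_of_ne _ _ hux] at h1
        rcases h1 with ⟨h1, h1'⟩ | ⟨h1, h1'⟩ <;> rcases h2 with ⟨h2, h2'⟩ | ⟨h2, h2'⟩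
        · exact hs0 (by linear_combination h1' - h2')
        · omega
        · omega
        · exact hs0 (by linear_combination h1' - h2')
      · rw [Blocks, shift_of_ne _ _ htx, shift_of_ne _ _ hux] at ht
        exact htx (hblock t ht)
    · obtain ⟨t, ht⟩ := exists_blocks hC hs hx hM.1 hMx
      have htx : t ≠ x := ne_of_row_ne (ht.row_ne hs)
      by_cases htu : t = u
      · exfalso
        subst htu
        have h1 := ht.tight
        have h2 := hux'.tight
        rcases h1 with ⟨h1, h1'⟩ | ⟨h1, h1'⟩ <;> rcases h2 with ⟨h2, h2'⟩ | ⟨h2, h2'⟩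
        · omega
        · exact hs0 (by linear_combination -h1' - h2')
        · exact hs0 (by linear_combination -h1' - h2')
        · omega
      · by_cases htw : t = w
        · exact htw ▸ ht
        · refine absurd hsat (ht.not_satisfies hs (j := 1) (by omega) ?_)
          rw [hNx, hN t htu htw htx]
          push_cast
          ring
  obtain ⟨-, h2⟩ := hloc M hM s hs u w huw hu h x hux' (hxw.symm hs)
  obtain ⟨t, htx, ht⟩ := h2 hx
  exact htx (hblock t ht)

/-- The coefficients of the paths through `u`, `v` and `x`, in this order of `u` and `v`, in the
Serre relation. -/
noncomputable def serreTerm (s : ℤ) (M : Tableau n) (u v x : Vertex n) : ℂ :=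
  moveCoeff s M x * moveCoeff s (shift M x s) u * moveCoeff s (shift (shift M x s) u s) v -
    2 * (moveCoeff s M u * moveCoeff s (shift M u s) x *
      moveCoeff s (shift (shift M u s) x s) v) +
    moveCoeff s M u * moveCoeff s (shift M u s) v * moveCoeff s (shift (shift M u s) v s) x

/-- Up to a common factor the three paths contribute consecutive values of a linear function, and
the weights `1, -2, 1` form a second difference. -/
theorem serreTerm_self {s : ℤ} (hs : s = 1 ∨ s = -1) (M : Tableau n) {u x : Vertex n}
    (hx : (x.row : ℤ) = u.row + s ∨ (x.row : ℤ) + s = u.row) : serreTerm s M u u x = 0 := by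
  have hux : u ≠ x := ne_of_row_ne (by omega)
  have hs2 : (s : ℂ) ^ 2 = 1 := by rcases hs with rfl | rfl <;> norm_num
  rw [serreTerm]
  rcases hx with hx | hx
  · obtain ⟨K, hK⟩ := moveCoeff_num_one s M hx (by omega)
    obtain ⟨K', hK'⟩ := moveCoeff_num_one s (shift M u s) hx (by omega)
    rw [moveCoeff_shift M (u := x) (x := u) _ (by omega) (by omega),
      moveCoeff_shift (shift M u s) (u := x) (x := u) _ (by omega) (by omega),
      moveCoeff_shift M (u := x) (x := u) _ (by omega) (by omega),
      hK M fun _ _ => rfl, hK _ fun w hw => shift_of_ne _ _ hw, hK' (shift M u s) fun _ _ => rfl,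
      hK' (shift (shift M u s) x s) fun w hw => shift_of_ne _ _ hw, shift_comm M x u,
      hK' (shift (shift M u s) x s) fun w hw => shift_of_ne _ _ hw]
    simp only [shift_self, shift_of_ne _ _ hux, shift_of_ne _ _ hux.symm]
    ring
  · obtain ⟨K, hK⟩ := moveCoeff_num_one s M (u := x) (x := u) (by omega) (by omega)
    rw [moveCoeff_shift M (u := u) (x := x) _ (by omega) (by omega), shift_comm M x u,
      moveCoeff_shift (shift M u s) (u := u) (x := x) _ (by omega) (by omega),
      hK M fun _ _ => rfl, hK _ fun w hw => shift_of_ne _ _ hw,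
      hK _ fun w hw => by rw [shift_of_ne _ _ hw, shift_of_ne _ _ hw]]
    simp only [shift_self, shift_of_ne _ _ hux.symm]
    ring

/-- For distinct entries only the sum over both orders vanishes. It is a rational identity, and the
hypotheses `h0`, `h1`, `h2` keep its denominators away from zero. -/
theorem serreTerm_add {s : ℤ} (hs : s = 1 ∨ s = -1) (M : Tableau n) {u v x : Vertex n}
    (hx : (x.row : ℤ) = u.row + s ∨ (x.row : ℤ) + s = u.row) (huv : u ≠ v) (hrow : u.row = v.row)
    (h0 : M u ≠ M v) (h1 : M v ≠ M u + s) (h2 : M u ≠ M v + s) :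
    serreTerm s M u v x + serreTerm s M v u x = 0 := by
  have hux : u ≠ x := ne_of_row_ne (by omega)
  have hvx : v ≠ x := ne_of_row_ne (by omega)
  have hs0 : s ≠ 0 := by omega
  have hs2 : (s : ℂ) ^ 2 = 1 := by rcases hs with rfl | rfl <;> norm_num
  have d0 : M u - M v ≠ 0 := sub_ne_zero.mpr h0
  have d0' : M v - M u ≠ 0 := sub_ne_zero.mpr h0.symm
  have d1 : M v - (M u + s) ≠ 0 := sub_ne_zero.mpr h1
  have d2 : M u - (M v + s) ≠ 0 := sub_ne_zero.mpr h2
  rw [serreTerm, serreTerm]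
  rcases hx with hx | hx
  · obtain ⟨K, hK⟩ := moveCoeff_num_den s M hs0 hx hrow.symm huv.symm
    obtain ⟨K', hK'⟩ := moveCoeff_num_den s M (u := v) (v := u) (x := x) hs0 (by omega) hrow huv
    obtain ⟨R, hR⟩ : ∃ R, R = moveCoeff s M x := ⟨_, rfl⟩
    have hsx : ∀ N : Tableau n, (∀ w, w ≠ u → w ≠ v → N w = M w) → moveCoeff s N x = R := by
      intro N hN
      rw [hR]
      refine moveCoeff_congr (hN x hux.symm hvx.symm) fun w hw => ?_
      exact hN w (ne_of_row_ne (by omega)) (ne_of_row_ne (by omega))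
    rw [hsx M (by intros; rfl), hsx (shift M u s) (by intro w h3 h4; simp [shift, h3]),
      hsx (shift M v s) (by intro w h3 h4; simp [shift, h4]),
      hsx (shift (shift M u s) v s) (by intro w h3 h4; simp [shift, h3, h4]),
      hsx (shift (shift M v s) u s) (by intro w h3 h4; simp [shift, h3, h4]),
      hK M (by intros; rfl), hK' M (by intros; rfl),
      hK (shift M x s) (by intro w h3 h4; simp [shift, h3]),
      hK' (shift M x s) (by intro w h3 h4; simp [shift, h3]),
      hK' (shift M u s) (by intro w h3 h4; simp [shift, h4]),
      hK (shift M v s) (by intro w h3 h4; simp [shift, h4]),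
      hK' (shift (shift M x s) u s) (by intro w h3 h4; simp [shift, h3, h4]),
      hK (shift (shift M x s) v s) (by intro w h3 h4; simp [shift, h3, h4]),
      hK' (shift (shift M u s) x s) (by intro w h3 h4; simp [shift, h3, h4]),
      hK (shift (shift M v s) x s) (by intro w h3 h4; simp [shift, h3, h4])]
    simp only [shift_self, shift_of_ne _ _ hux, shift_of_ne _ _ hux.symm, shift_of_ne _ _ hvx,
      shift_of_ne _ _ hvx.symm, shift_of_ne _ _ huv, shift_of_ne _ _ huv.symm]
    field_simp
    ring
  · obtain ⟨K, hK⟩ := moveCoeff_den_one s M hs0 hrow.symm huv.symm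
    obtain ⟨K', hK'⟩ := moveCoeff_den_one s M (u := v) (v := u) hs0 hrow huv
    obtain ⟨R, hR⟩ := moveCoeff_num_two s M (u := x) (x := u) (y := v) (by omega) (by omega)
      (by omega) huv
    have hrows : ∀ w : Vertex n, w.row = u.row ∨ (w.row : ℤ) = u.row + s → w ≠ x :=
      fun w hw => ne_of_row_ne (by omega)
    have hrows' : ∀ w : Vertex n, w.row = v.row ∨ (w.row : ℤ) = v.row + s → w ≠ x :=
      fun w hw => ne_of_row_ne (by omega)
    rw [hK M (by intros; rfl), hK' M (by intros; rfl),
      hK (shift M x s) (fun w _ h4 => by simp [shift, hrows w h4]),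
      hK' (shift M x s) (fun w _ h4 => by simp [shift, hrows' w h4]),
      hK' (shift M u s) (fun w h3 h4 => by simp [shift, h3]),
      hK (shift M v s) (fun w h3 h4 => by simp [shift, h3]),
      hK' (shift (shift M x s) u s) (fun w h3 h4 => by simp [shift, h3, hrows' w h4]),
      hK (shift (shift M x s) v s) (fun w h3 h4 => by simp [shift, h3, hrows w h4]),
      hK' (shift (shift M u s) x s) (fun w h3 h4 => by simp [shift, h3, hrows' w h4]),
      hK (shift (shift M v s) x s) (fun w h3 h4 => by simp [shift, h3, hrows w h4]),
      hR M (by intros; rfl),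
      hR (shift M u s) (by intro w h3 h4; simp [shift, h3]),
      hR (shift M v s) (by intro w h3 h4; simp [shift, h4]),
      hR (shift (shift M u s) v s) (by intro w h3 h4; simp [shift, h3, h4]),
      hR (shift (shift M v s) u s) (by intro w h3 h4; simp [shift, h3, h4])]
    simp only [shift_self, shift_of_ne _ _ hux, shift_of_ne _ _ hux.symm, shift_of_ne _ _ hvx,
      shift_of_ne _ _ hvx.symm, shift_of_ne _ _ huv, shift_of_ne _ _ huv.symm]
    field_simp
    ring

end LocalCondition

/-! ### The defining relations on `V_C` -/

section DefiningRelations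

variable {n : ℕ} {C : Set (Rel n)} {L : Tableau n}

/-- The paths through `(u, v, x)` and `(v, u, x)` end at the same tableau and are paired. Either
`serreTerm_self` or `serreTerm_add` cancels their coefficients, or the entries at `u` and `v` differ
by one and the end tableau is not in the basis. -/
theorem gtOp_serre (hC : C ⊆ setR n ∪ setR0 n) (hloc : LocallyAdmissible C)
    (hL : IsRealization C L) {s : ℤ} (hs : s = 1 ∨ s = -1) {k l : ℕ} (hk : k < n) (hl : l < n)
    (hkl : l = k + 1 ∨ k = l + 1) :
    gtOp (basisSet C L) s k * (gtOp (basisSet C L) s k * gtOp (basisSet C L) s l) -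
      (2 : ℂ) • (gtOp (basisSet C L) s k * (gtOp (basisSet C L) s l * gtOp (basisSet C L) s k)) +
      gtOp (basisSet C L) s l * (gtOp (basisSet C L) s k * gtOp (basisSet C L) s k) = 0 := by
  refine end_ext fun M hM => ?_
  have hMr := hL.of_mem hM
  simp only [LinearMap.add_apply, LinearMap.sub_apply, LinearMap.smul_apply,
    Module.End.mul_apply, LinearMap.zero_apply]
  rw [gtOp_gtOp_gtOp_vec hC hs hl hk hM, gtOp_gtOp_gtOp_vec hC hs hk hl hM,
    gtOp_gtOp_gtOp_vec hC hs hk hk hM]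
  set R : Finset (Vertex n) := Finset.univ.filter fun u => u.row = k with hR
  set S : Finset (Vertex n) := Finset.univ.filter fun u => u.row = l with hS
  set V : Vertex n → Vertex n → Vertex n → (basisSet C L →₀ ℂ) := fun u v x =>
    vec (basisSet C L) (shift (shift (shift M u s) v s) x s) with hV
  have e1 : ∀ x u v, vec (basisSet C L) (shift (shift (shift M x s) u s) v s) = V u v x := by
    intro x u v
    change _ = vec _ _
    rw [shift_comm M x u, shift_comm _ x v]
  have e2 : ∀ x u v, vec (basisSet C L) (shift (shift (shift M u s) x s) v s) = V u v x := by
    intro x u v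
    change _ = vec _ _
    rw [shift_comm _ x v]
  have e3 : ∀ (f : Vertex n → Vertex n → Vertex n → (basisSet C L →₀ ℂ)),
      ∑ u ∈ R, ∑ x ∈ S, ∑ v ∈ R, f u x v = ∑ u ∈ R, ∑ v ∈ R, ∑ x ∈ S, f u x v :=
    fun f => Finset.sum_congr rfl fun u _ => Finset.sum_comm
  rw [Finset.sum_comm, e3, e3]
  set G : Vertex n → Vertex n → (basisSet C L →₀ ℂ) := fun u v =>
    ∑ x ∈ S, serreTerm s M u v x • V u v x with hG
  have hterm : ∀ u ∈ R, ∀ v ∈ R, ∀ x ∈ S,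
      serreTerm s M u v x • V u v x + serreTerm s M v u x • V u v x = 0 := by
    intro u hu v hv x hx
    have hu' : u.row = k := (Finset.mem_filter.mp hu).2
    have hv' : v.row = k := (Finset.mem_filter.mp hv).2
    have hx' : x.row = l := (Finset.mem_filter.mp hx).2
    have hadj : (x.row : ℤ) = u.row + s ∨ (x.row : ℤ) + s = u.row := by omega
    rw [← add_smul]
    by_cases huv : u = v
    · subst huv
      rw [serreTerm_self hs M hadj, add_zero, zero_smul]
    have hM1 : M ∈ basisSet C M := ⟨self_mem_latticeSet M, hM.2⟩
    have h0 : M u ≠ M v := hMr.2 M hM1 u v huv (by omega) (by omega)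
    have hux : u ≠ x := ne_of_row_ne (by omega)
    have hvx : v ≠ x := ne_of_row_ne (by omega)
    have hVN : ¬ Satisfies C (shift (shift (shift M u s) v s) x s) → V u v x = 0 :=
      fun h => vec_of_notMem (B := basisSet C L) fun hmem => h hmem.2
    have hN : ∀ w, w ≠ u → w ≠ v → w ≠ x → shift (shift (shift M u s) v s) x s w = M w :=
      fun w h1 h2 h3 => by simp [shift, h1, h2, h3]
    have hNu : shift (shift (shift M u s) v s) x s u = M u + s := by
      rw [shift_of_ne _ _ hux, shift_of_ne _ _ huv, shift_self]
    have hNv : shift (shift (shift M u s) v s) x s v = M v + s := by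
      rw [shift_of_ne _ _ hvx, shift_self, shift_of_ne _ _ (Ne.symm huv)]
    have hNx : shift (shift (shift M u s) v s) x s x = M x + s := by
      rw [shift_self, shift_of_ne _ _ hvx.symm, shift_of_ne _ _ hux.symm]
    by_cases h1 : M v = M u + s
    · rw [hVN (hloc.not_satisfies hC hs hMr (u := u) (w := v) (x := x) (by omega) (by omega)
        (by omega) (by omega) h1 hNu hNv hNx hN), smul_zero]
    by_cases h2 : M u = M v + s
    · rw [hVN (hloc.not_satisfies hC hs hMr (u := v) (w := u) (x := x) (by omega) (by omega)
        (by omega) (by omega) h2 hNv hNu hNx fun w h3 h4 => hN w h4 h3), smul_zero]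
    rw [serreTerm_add hs M hadj huv (by omega) h0 h1 h2, zero_smul]
  have hGsymm : ∀ u ∈ R, ∀ v ∈ R, G u v + G v u = 0 := by
    intro u hu v hv
    change ∑ x ∈ S, _ + ∑ x ∈ S, _ = 0
    rw [← Finset.sum_add_distrib]
    refine Finset.sum_eq_zero fun x hx => ?_
    have : V v u x = V u v x := by
      change vec _ _ = vec _ _
      rw [shift_comm M v u]
    rw [this]
    exact hterm u hu v hv x hx
  have hsum : ∑ u ∈ R, ∑ v ∈ R, G u v = 0 := by
    have h1 : ∑ u ∈ R, ∑ v ∈ R, G u v + ∑ u ∈ R, ∑ v ∈ R, G u v = 0 := by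
      nth_rewrite 2 [Finset.sum_comm]
      rw [← Finset.sum_add_distrib]
      refine Finset.sum_eq_zero fun u hu => ?_
      rw [← Finset.sum_add_distrib]
      exact Finset.sum_eq_zero fun v hv => hGsymm u hu v hv
    rw [← two_smul ℂ] at h1
    exact (smul_eq_zero.mp h1).resolve_left two_ne_zero
  rw [← hsum, Finset.smul_sum, ← Finset.sum_sub_distrib, ← Finset.sum_add_distrib]
  refine Finset.sum_congr rfl fun u _ => ?_
  rw [Finset.smul_sum, ← Finset.sum_sub_distrib, ← Finset.sum_add_distrib]
  refine Finset.sum_congr rfl fun v _ => ?_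
  rw [Finset.smul_sum, ← Finset.sum_sub_distrib, ← Finset.sum_add_distrib]
  refine Finset.sum_congr rfl fun x _ => ?_
  rw [e1, e2, serreTerm, smul_smul, ← sub_smul, ← add_smul]

/-- The coefficient of `T(M)` in `⁅E_{k,k+1}, E_{k+1,k}⁆ T(M)`. -/
noncomputable def diagCoeff (M : Tableau n) (k : ℕ) : ℂ :=
  ∑ u : Vertex n with u.row = k, (moveCoeff 1 M u * moveCoeff (-1) (shift M u 1) u -
    moveCoeff (-1) M u * moveCoeff 1 (shift M u (-1)) u)

/-- Moving two distinct entries of the row in opposite directions gives the same coefficient in both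
orders, even when a denominator is zero, because the denominators agree identically. Only the paths
back to `M` remain. -/
theorem gtOp_commutator_vec (hC : C ⊆ setR n ∪ setR0 n) {k : ℕ} (hk : k < n) {M : Tableau n}
    (hM : M ∈ basisSet C L) :
    gtOp (basisSet C L) (-1) k (gtOp (basisSet C L) 1 k (vec (basisSet C L) M)) -
      gtOp (basisSet C L) 1 k (gtOp (basisSet C L) (-1) k (vec (basisSet C L) M)) =
        diagCoeff M k • vec (basisSet C L) M := by
  rw [gtOp_gtOp_vec hC (Or.inl rfl) (Or.inr rfl) hk hM,
    gtOp_gtOp_vec hC (Or.inr rfl) (Or.inl rfl) hk hM,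
    Finset.sum_comm (f := fun u x => (moveCoeff (-1) M u * moveCoeff 1 (shift M u (-1)) x) • _),
    ← Finset.sum_sub_distrib, diagCoeff, Finset.sum_smul]
  refine Finset.sum_congr rfl fun u hu => ?_
  have hu' : u.row = k := (Finset.mem_filter.mp hu).2
  rw [← Finset.sum_sub_distrib, Finset.sum_eq_single u]
  · have h1 := shift_shift_neg M u 1
    have h2 := shift_shift_neg M u (-1)
    rw [neg_neg] at h2
    rw [h1, h2, sub_smul]
  · intro x hx hxu
    have hx' : x.row = k := (Finset.mem_filter.mp hx).2
    obtain ⟨K, hK⟩ := moveCoeff_den_one 1 M (u := u) (v := x) (by omega) (by omega) hxu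
    obtain ⟨K', hK'⟩ := moveCoeff_den_one (-1) M (u := x) (v := u) (by omega) (by omega) hxu.symm
    rw [shift_comm, hK M (by intros; rfl), hK' M (by intros; rfl),
      hK' (shift M u 1) fun w hw _ => shift_of_ne _ _ hw,
      hK (shift M x (-1)) fun w hw _ => shift_of_ne _ _ hw, ← sub_smul]
    simp only [shift_self, shift_of_ne _ _ hxu, shift_of_ne _ _ (Ne.symm hxu)]
    rw [div_mul_div_comm, div_mul_div_comm, mul_comm K' K,
      show (M x - M u) * (M u - (M x + ((-1 : ℤ) : ℂ))) =
        (M u - M x) * (M x - (M u + ((1 : ℤ) : ℂ))) by push_cast; ring, sub_self, zero_smul]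
  · intro h
    exact absurd hu h

/-- The eigenvalue of `E_{kk}` on `T(M)`, for `k = a + 1`. -/
noncomputable def weight (M : Tableau n) (a : ℕ) : ℂ :=
  (a : ℂ) + ∑ u : Vertex n with u.row = a + 1, M u - ∑ u : Vertex n with u.row = a, M u

/-- The diagonal operator `E_{kk}`, for `k = a + 1`. -/
noncomputable def weightOp (B : Set (Tableau n)) (a : ℕ) : Module.End ℂ (B →₀ ℂ) :=
  Finsupp.linearCombination ℂ fun M : B => weight (M : Tableau n) a • vec B M

theorem weightOp_vec (B : Set (Tableau n)) (a : ℕ) (M : Tableau n) :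
    weightOp B a (vec B M) = weight M a • vec B M := by
  by_cases hM : M ∈ B
  · rw [vec_of_mem hM, weightOp, Finsupp.linearCombination_single, one_smul, vec_of_mem hM]
  · rw [vec_of_notMem hM, map_zero, smul_zero]

theorem sum_row_shift (M : Tableau n) (u : Vertex n) (m : ℤ) (k : ℕ) :
    ∑ w : Vertex n with w.row = k, shift M u m w =
      ∑ w : Vertex n with w.row = k, M w + if u.row = k then (m : ℂ) else 0 := by
  simp only [shift]
  rw [Finset.sum_add_distrib, Finset.sum_ite_eq']
  simp

theorem weight_shift (M : Tableau n) (u : Vertex n) (m : ℤ) (a : ℕ) :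
    weight (shift M u m) a = weight M a + ((if u.row = a + 1 then (m : ℂ) else 0) -
      if u.row = a then (m : ℂ) else 0) := by
  rw [weight, weight, sum_row_shift, sum_row_shift]
  ring

theorem weightOp_mul_gtOp (B : Set (Tableau n)) (s : ℤ) (a k : ℕ) :
    weightOp B a * gtOp B s k - gtOp B s k * weightOp B a =
      ((if k = a + 1 then (s : ℂ) else 0) - if k = a then (s : ℂ) else 0) • gtOp B s k := by
  refine end_ext fun M hM => ?_
  rw [LinearMap.sub_apply, Module.End.mul_apply, Module.End.mul_apply, weightOp_vec, map_smul,
    LinearMap.smul_apply, gtOp_vec s k hM, map_sum, Finset.smul_sum, Finset.smul_sum,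
    ← Finset.sum_sub_distrib]
  refine Finset.sum_congr rfl fun u hu => ?_
  have hu' : u.row = k := (Finset.mem_filter.mp hu).2
  rw [map_smul, weightOp_vec, weight_shift, hu', smul_smul, smul_smul, smul_smul, ← sub_smul]
  congr 1
  ring

theorem weightOp_mul_weightOp (B : Set (Tableau n)) (a b : ℕ) :
    weightOp B a * weightOp B b = weightOp B b * weightOp B a := by
  refine end_ext fun M _ => ?_
  rw [Module.End.mul_apply, Module.End.mul_apply, weightOp_vec, weightOp_vec, map_smul, map_smul,
    weightOp_vec, weightOp_vec, smul_smul, smul_smul, mul_comm]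

end DefiningRelations

/-! ### The diagonal coefficients as residue sums -/

section Diagonal

open Polynomial

variable {n : ℕ}

theorem card_row {k : ℕ} (hk : k ≤ n) :
    (Finset.univ.filter fun u : Vertex n => u.row = k).card = k := by
  rcases Nat.eq_zero_or_pos k with rfl | h0
  · rw [Finset.card_eq_zero, Finset.filter_eq_empty_iff]
    exact fun u _ => Nat.succ_ne_zero _
  · have : (Finset.univ.filter fun u : Vertex n => u.row = k) =
        Finset.univ.map ⟨Sigma.mk (⟨k - 1, by omega⟩ : Fin n), sigma_mk_injective⟩ := by
      ext ⟨⟨i, hi⟩, j⟩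
      rw [Finset.mem_filter, Finset.mem_map]
      change _ ∧ i + 1 = k ↔ _
      constructor
      · rintro ⟨-, rfl⟩
        exact ⟨j, Finset.mem_univ _, rfl⟩
      · rintro ⟨a, -, ha⟩
        have h1 : k - 1 = i := congrArg (fun v : Vertex n => (v.1 : ℕ)) ha
        exact ⟨Finset.mem_univ _, by omega⟩
    rw [this, Finset.card_map, Finset.card_univ, Fintype.card_fin]
    simp only
    omega

/-- The positions in the rows adjacent to row `k`. -/
def adjacentRows (n k : ℕ) : Finset (Vertex n) :=
  Finset.univ.filter fun w => w.row = k + 1 ∨ w.row + 1 = k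

/-- The root that the entry at `w` contributes to `numPoly`. -/
noncomputable def numRoot (M : Tableau n) (k : ℕ) (w : Vertex n) : ℂ :=
  M w - if w.row = k + 1 then 0 else 1

/-- The polynomial `∏ (t - l_{k+1,j}) ∏ (t + 1 - l_{k-1,j})`. -/
noncomputable def numPoly (M : Tableau n) (k : ℕ) : ℂ[X] :=
  ∏ w ∈ adjacentRows n k, (X - C (numRoot M k w))

theorem numPoly_monic (M : Tableau n) (k : ℕ) : (numPoly M k).Monic :=
  monic_prod_of_monic _ _ fun _ _ => monic_X_sub_C _

theorem adjacentRows_eq (n k : ℕ) : adjacentRows n k =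
    (Finset.univ.filter fun w : Vertex n => w.row = k + 1).disjUnion
      (Finset.univ.filter fun w : Vertex n => w.row + 1 = k)
      (Finset.disjoint_filter.mpr fun w _ h1 h2 => by omega) := by
  ext w
  simp [adjacentRows]

theorem numPoly_natDegree (M : Tableau n) {k : ℕ} (h0 : 0 < k) (hk : k < n) :
    (numPoly M k).natDegree = 2 * k := by
  rw [numPoly, natDegree_prod_of_monic _ _ fun _ _ => monic_X_sub_C _]
  simp only [natDegree_X_sub_C, Finset.sum_const, smul_eq_mul, mul_one]
  rw [adjacentRows_eq, Finset.card_disjUnion, card_row (by omega)]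
  have : (Finset.univ.filter fun w : Vertex n => w.row + 1 = k) =
      Finset.univ.filter fun w : Vertex n => w.row = k - 1 :=
    Finset.filter_congr fun w _ => by omega
  rw [this, card_row (by omega)]
  omega

theorem numPoly_nextCoeff (M : Tableau n) {k : ℕ} (h0 : 0 < k) (hk : k < n) :
    (numPoly M k).nextCoeff = (k - 1 : ℂ) - ∑ w : Vertex n with w.row = k + 1, M w -
      ∑ w : Vertex n with w.row = k - 1, M w := by
  have hf : (Finset.univ.filter fun w : Vertex n => w.row + 1 = k) =
      Finset.univ.filter fun w : Vertex n => w.row = k - 1 :=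
    Finset.filter_congr fun w _ => by omega
  rw [numPoly, Monic.nextCoeff_prod _ _ fun _ _ => monic_X_sub_C _]
  simp only [nextCoeff_X_sub_C]
  rw [adjacentRows_eq, Finset.sum_disjUnion, hf]
  have h1 : ∑ w : Vertex n with w.row = k + 1, -numRoot M k w =
      -∑ w : Vertex n with w.row = k + 1, M w := by
    rw [← Finset.sum_neg_distrib]
    refine Finset.sum_congr rfl fun w hw => ?_
    simp [numRoot, (Finset.mem_filter.mp hw).2]
  have h2 : ∑ w : Vertex n with w.row = k - 1, -numRoot M k w =
      (k - 1 : ℂ) - ∑ w : Vertex n with w.row = k - 1, M w := by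
    have : ∀ w ∈ (Finset.univ.filter fun w : Vertex n => w.row = k - 1),
        -numRoot M k w = 1 - M w := by
      intro w hw
      have hw' : w.row = k - 1 := (Finset.mem_filter.mp hw).2
      rw [numRoot, if_neg (by omega), neg_sub]
    rw [Finset.sum_congr rfl this, Finset.sum_sub_distrib, Finset.sum_const, card_row (by omega)]
    rw [nsmul_eq_mul, mul_one, Nat.cast_sub (by omega), Nat.cast_one]
  rw [h1, h2]
  ring

theorem numPoly_eval (M : Tableau n) (k : ℕ) (t : ℂ) :
    (numPoly M k).eval t = (∏ w : Vertex n with w.row = k + 1, (t - M w)) *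
      ∏ w : Vertex n with w.row + 1 = k, (t + 1 - M w) := by
  rw [numPoly, eval_prod, adjacentRows_eq, Finset.prod_disjUnion]
  congr 1
  · refine Finset.prod_congr rfl fun w hw => ?_
    simp [numRoot, (Finset.mem_filter.mp hw).2]
  · refine Finset.prod_congr rfl fun w hw => ?_
    have hw' := (Finset.mem_filter.mp hw).2
    rw [eval_sub, eval_X, eval_C, numRoot, if_neg (by omega)]
    ring

/-- Tight positions are the linear factors of `numPoly` that vanish at the entry of `u`; two of them
give a double zero. -/
theorem tight_one_iff {M : Tableau n} {u z : Vertex n} :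
    Tight 1 M u z ↔ z ∈ adjacentRows n u.row ∧ numRoot M u.row z = M u := by
  rw [Tight, adjacentRows, Finset.mem_filter, numRoot]
  constructor
  · rintro (⟨h1, h2⟩ | ⟨h1, h2⟩)
    · exact ⟨⟨Finset.mem_univ _, by omega⟩, by rw [if_pos (by omega), h2, sub_zero]⟩
    · exact ⟨⟨Finset.mem_univ _, by omega⟩, by rw [if_neg (by omega), h2]; simp⟩
  · rintro ⟨⟨-, h1 | h1⟩, h2⟩
    · rw [if_pos h1, sub_zero] at h2
      exact Or.inl ⟨by omega, h2⟩
    · rw [if_neg (by omega)] at h2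
      exact Or.inr ⟨by omega, by rw [← h2]; simp⟩

/-- Moving `u` up and back gives the residue at `M u`, moving it down and back the one at `M u - 1`.
At double poles both sides follow the same convention for division by zero. -/
theorem diagCoeff_eq_residueSum (M : Tableau n) (k : ℕ)
    (hinj : ∀ u v : Vertex n, u.row = k → v.row = k → M u = M v → u = v) :
    diagCoeff M k =
      residueSum ((Finset.univ.filter fun u : Vertex n => u.row = k).image M) (numPoly M k) := by
  have hinj' : Set.InjOn M (Finset.univ.filter fun u : Vertex n => u.row = k : Finset _) := by
    intro u hu v hv
    exact hinj u v (by simpa using hu) (by simpa using hv)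
  rw [diagCoeff, residueSum, Finset.sum_image hinj']
  refine Finset.sum_congr rfl fun u hu => ?_
  have hu' : u.row = k := (Finset.mem_filter.mp hu).2
  have herase : ∀ g : ℂ → ℂ, ∏ s ∈ ((Finset.univ.filter fun u : Vertex n => u.row = k).image
      M).erase (M u), g s = ∏ w : Vertex n with w.row = u.row ∧ w ≠ u, g (M w) := by
    intro g
    have : ((Finset.univ.filter fun u : Vertex n => u.row = k).image M).erase (M u) =
        (Finset.univ.filter fun w : Vertex n => w.row = u.row ∧ w ≠ u).image M := by
      ext t
      simp only [Finset.mem_erase, Finset.mem_image, Finset.mem_filter, Finset.mem_univ, true_and]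
      constructor
      · rintro ⟨h1, w, hw, rfl⟩
        exact ⟨w, ⟨by omega, fun h => h1 (h ▸ rfl)⟩, rfl⟩
      · rintro ⟨w, ⟨hw, hwu⟩, rfl⟩
        exact ⟨fun h => hwu (hinj w u (by omega) hu' h), w, by omega, rfl⟩
    rw [this, Finset.prod_image]
    intro v hv w hw
    simp only [Finset.coe_filter, Finset.mem_univ, true_and, Set.mem_ofPred_eq] at hv hw
    exact hinj v w (by omega) (by omega)
  have hp : ∀ (N : Tableau n) (t : ℂ), (∀ w, w ≠ u → N w = M w) → N u = t → moveCoeff 1 N u =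
      (∏ w : Vertex n with w.row = k + 1, (t - M w)) /
        ∏ w : Vertex n with w.row = u.row ∧ w ≠ u, (t - M w) := by
    intro N t hN ht
    rw [moveCoeff, ht]
    congr 1
    · refine Finset.prod_congr (Finset.filter_congr fun w _ => by omega) fun w hw => ?_
      have := (Finset.mem_filter.mp hw).2
      rw [hN w (ne_of_row_ne (by omega))]
    · exact Finset.prod_congr rfl fun w hw => by rw [hN w (Finset.mem_filter.mp hw).2.2]
  have hq : ∀ (N : Tableau n) (t : ℂ), (∀ w, w ≠ u → N w = M w) → N u = t → moveCoeff (-1) N u =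
      (∏ w : Vertex n with w.row + 1 = k, (t - M w)) /
        ∏ w : Vertex n with w.row = u.row ∧ w ≠ u, (t - M w) := by
    intro N t hN ht
    rw [moveCoeff, ht]
    congr 1
    · refine Finset.prod_congr (Finset.filter_congr fun w _ => by omega) fun w hw => ?_
      have := (Finset.mem_filter.mp hw).2
      rw [hN w (ne_of_row_ne (by omega))]
    · exact Finset.prod_congr rfl fun w hw => by rw [hN w (Finset.mem_filter.mp hw).2.2]
  have hsh : ∀ m : ℤ, ∀ w, w ≠ u → shift M u m w = M w := fun m w hw => shift_of_ne _ _ hw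
  rw [hp M _ (fun _ _ => rfl) rfl, hq M _ (fun _ _ => rfl) rfl, hp _ _ (hsh (-1)) (shift_self ..),
    hq _ _ (hsh 1) (shift_self ..), herase, herase, herase, numPoly_eval, numPoly_eval]
  push_cast
  rw [div_mul_div_comm, div_mul_div_comm, sub_add_cancel, ← sub_eq_add_neg,
    mul_comm (∏ w : Vertex n with w.row + 1 = k, (M u - M w))]

/-- The right side is the coefficient of `1/t` at infinity of the rational function whose residues
are summed. -/
theorem weight_sub_weight (M : Tableau n) {a : ℕ} (ha : a + 1 < n)
    (hinj : ∀ u v : Vertex n, u.row = a + 1 → v.row = a + 1 → M u = M v → u = v) :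
    weight M a - weight M (a + 1) = (numPoly M (a + 1)).nextCoeff +
      2 * ∑ s ∈ (Finset.univ.filter fun u : Vertex n => u.row = a + 1).image M, s -
        ((Finset.univ.filter fun u : Vertex n => u.row = a + 1).image M).card := by
  have hinj' : Set.InjOn M (Finset.univ.filter fun u : Vertex n => u.row = a + 1 : Finset _) := by
    intro u hu v hv
    exact hinj u v (by simpa using hu) (by simpa using hv)
  rw [Finset.sum_image hinj', Finset.card_image_of_injOn hinj', card_row (by omega),
    numPoly_nextCoeff M (by omega) ha, weight, weight]
  simp only [add_tsub_cancel_right]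
  push_cast
  ring

theorem diagCoeff_eq_weight_sub (M : Tableau n) {a : ℕ} (ha : a + 1 < n)
    (hinj : ∀ u v : Vertex n, u.row = a + 1 → v.row = a + 1 → M u = M v → u = v)
    (htight : ∀ u w : Vertex n, u.row = a + 1 → w.row = a + 1 → M w = M u + 1 →
      ∃ x z, z ≠ x ∧ Tight 1 M u x ∧ Tight 1 M u z) :
    diagCoeff M (a + 1) = weight M a - weight M (a + 1) := by
  have hinj' : Set.InjOn M (Finset.univ.filter fun u : Vertex n => u.row = a + 1 : Finset _) := by
    intro u hu v hv
    exact hinj u v (by simpa using hu) (by simpa using hv)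
  rw [weight_sub_weight M ha hinj, diagCoeff_eq_residueSum M _ hinj]
  refine residueSum_of_double_zeros _ _ (numPoly_monic _ _) ?_ ?_
  · rw [numPoly_natDegree M (by omega) ha, Finset.card_image_of_injOn hinj', card_row (by omega)]
  · intro t ht ht'
    simp only [Finset.mem_image, Finset.mem_filter, Finset.mem_univ, true_and] at ht ht'
    obtain ⟨u, hu, rfl⟩ := ht
    obtain ⟨w, hw, hw'⟩ := ht'
    obtain ⟨x, z, hzx, hx, hz⟩ := htight u w hu hw hw'
    rw [tight_one_iff, hu] at hx hz
    rw [numPoly, ← Finset.mul_prod_erase _ _ hx.1,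
      ← Finset.mul_prod_erase _ _ (Finset.mem_erase.mpr ⟨hzx, hz.1⟩), hx.2, hz.2, ← mul_assoc, ← sq]
    exact dvd_mul_right _ _

/-- The converse direction: `huniq` leaves one double pole, `x` supplies one zero of the numerator
there, and the correct diagonal coefficient forces another. -/
theorem exists_tight_of_diagCoeff (M : Tableau n) {a : ℕ} (ha : a + 1 < n)
    (hinj : ∀ u v : Vertex n, u.row = a + 1 → v.row = a + 1 → M u = M v → u = v)
    (hdiag : diagCoeff M (a + 1) = weight M a - weight M (a + 1)) {u w x : Vertex n}
    (hu : u.row = a + 1) (hw : w.row = a + 1) (huw : M w = M u + 1)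
    (huniq : ∀ p q : Vertex n, p.row = a + 1 → q.row = a + 1 → M q = M p + 1 → p = u)
    (hx : Tight 1 M u x) : ∃ z, z ≠ x ∧ Tight 1 M u z := by
  have hinj' : Set.InjOn M (Finset.univ.filter fun u : Vertex n => u.row = a + 1 : Finset _) := by
    intro u hu v hv
    exact hinj u v (by simpa using hu) (by simpa using hv)
  rw [weight_sub_weight M ha hinj, diagCoeff_eq_residueSum M _ hinj] at hdiag
  rw [tight_one_iff, hu] at hx
  have h0 := double_zero_of_residueSum _ (numPoly M (a + 1))
    (∏ w ∈ (adjacentRows n (a + 1)).erase x, (X - C (numRoot M (a + 1) w)))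
    (monic_prod_of_monic _ _ fun _ _ => monic_X_sub_C _) (M u)
    (by rw [numPoly, ← Finset.mul_prod_erase _ _ hx.1, hx.2])
    (by rw [numPoly_natDegree M (by omega) ha, Finset.card_image_of_injOn hinj',
      card_row (by omega)])
    (Finset.mem_image_of_mem _ (by simp [hu]))
    (Finset.mem_image.mpr ⟨w, by simp [hw], huw⟩)
    (by
      intro b hb hb'
      simp only [Finset.mem_image, Finset.mem_filter, Finset.mem_univ, true_and] at hb hb'
      obtain ⟨p, hp, rfl⟩ := hb
      obtain ⟨q, hq, hq'⟩ := hb'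
      rw [huniq p q hp hq hq'])
    hdiag
  rw [eval_prod, Finset.prod_eq_zero_iff] at h0
  obtain ⟨z, hz, hz'⟩ := h0
  rw [eval_sub, eval_X, eval_C, sub_eq_zero] at hz'
  obtain ⟨hzx, hz⟩ := Finset.mem_erase.mp hz
  exact ⟨z, hzx, by rw [tight_one_iff, hu]; exact ⟨hz, hz'.symm⟩⟩

end Diagonal

/-! ### The module structure -/

section Admissibility

variable {n : ℕ} {C : Set (Rel n)}

theorem SerreRelations.of_ring {A : Type*} [Ring A] {p f h : ℕ → A}
    (hh : ∀ i j, h i * h j = h j * h i)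
    (hp : ∀ i j, h i * p j - p j * h i = (if i = j then p j else 0) - if i = j + 1 then p j else 0)
    (hf : ∀ i j, h i * f j - f j * h i = (if i = j + 1 then f j else 0) - if i = j then f j else 0)
    (hfp : ∀ i j, i + 1 < n → j + 1 < n →
      f j * p i - p i * f j = if i = j then h i - h (i + 1) else 0)
    (hpp : ∀ i j, i + 1 < n → j + 1 < n → i + 1 < j → p i * p j = p j * p i)
    (hff : ∀ i j, i + 1 < n → j + 1 < n → i + 1 < j → f i * f j = f j * f i)
    (hppp : ∀ i j, i + 1 < n → j + 1 < n → (j = i + 1 ∨ i = j + 1) →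
      p i * (p i * p j) - (p i * (p j * p i) + p i * (p j * p i)) + p j * (p i * p i) = 0)
    (hfff : ∀ i j, i + 1 < n → j + 1 < n → (j = i + 1 ∨ i = j + 1) →
      f i * (f i * f j) - (f i * (f j * f i) + f i * (f j * f i)) + f j * (f i * f i) = 0) :
    SerreRelations n (fun i => -p i) f h := by
  have key : ∀ {a b : A}, a * (a * b) - (a * (b * a) + a * (b * a)) + b * (a * a) = 0 →
      ⁅a, ⁅a, b⁆⁆ = 0 := by
    intro a b hab
    rw [LieRing.of_associative_ring_bracket, LieRing.of_associative_ring_bracket, ← hab]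
    noncomm_ring
  refine ⟨fun i j _ _ => ?_, fun i j _ _ => ?_, fun i j _ _ => ?_, fun i j hi hj => ?_,
    fun i j hi hj hij => ?_, fun i j hi hj hij => ?_, fun i hi => ?_, fun i hi => ?_,
    fun i hi => ?_, fun i hi => ?_⟩
  · rw [LieRing.of_associative_ring_bracket, hh, sub_self]
  · rw [lie_neg, LieRing.of_associative_ring_bracket, hp, neg_sub]
    split_ifs <;> simp
  · rw [LieRing.of_associative_ring_bracket, hf]
  · rw [neg_lie, LieRing.of_associative_ring_bracket, neg_sub, hfp i j hi hj]
  · rw [neg_lie, lie_neg, neg_neg, LieRing.of_associative_ring_bracket, hpp i j hi hj hij, sub_self]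
  · rw [LieRing.of_associative_ring_bracket, hff i j hi hj hij, sub_self]
  · simp only [neg_lie, lie_neg, neg_neg, neg_eq_zero]
    exact key (hppp _ _ (by omega) (by omega) (by omega))
  · simp only [neg_lie, lie_neg, neg_neg, neg_eq_zero]
    exact key (hppp _ _ (by omega) (by omega) (by omega))
  · exact key (hfff _ _ (by omega) (by omega) (by omega))
  · exact key (hfff _ _ (by omega) (by omega) (by omega))

/-- If `M w = M u + 1`, then `u` cannot move up and `w` cannot move down, since the two entries
would coincide; so both are blocked. A position blocking `w` is tight for `u` too. This gives two
zeros unless both are blocked by the same position, which is the case covered by the local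
condition. -/
theorem LocallyAdmissible.diagCoeff_eq (hloc : LocallyAdmissible C)
    (hC : C ⊆ setR n ∪ setR0 n) {M : Tableau n} (hM : IsRealization C M) {a : ℕ}
    (ha : a + 1 < n) : diagCoeff M (a + 1) = weight M a - weight M (a + 1) := by
  refine diagCoeff_eq_weight_sub M ha ?_ ?_
  · intro u v hu hv huv
    by_contra hne
    exact hM.2 M ⟨self_mem_latticeSet M, hM.1⟩ u v hne (by omega) (by omega) huv
  · intro u w hu hw huw
    have hne : u ≠ w := by
      rintro rfl
      simp at huw
    have hself := self_mem_latticeSet M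
    obtain ⟨x, hx⟩ := exists_blocks hC (Or.inl rfl) (u := u) (by omega) hM.1
      (hM.not_satisfies (shift_mem_latticeSet hself (by omega) 1) hne (by omega) (by omega)
        (by rw [shift_self, shift_of_ne _ _ hne.symm, huw]; simp))
    obtain ⟨y, hy⟩ := exists_blocks hC (Or.inr rfl) (u := w) (by omega) hM.1
      (hM.not_satisfies (shift_mem_latticeSet hself (by omega) (-1)) hne (by omega) (by omega)
        (by rw [shift_self, shift_of_ne _ _ hne, huw]; simp))
    have hy' : Tight 1 M u y := by
      rcases hy.tight with ⟨h1, h2⟩ | ⟨h1, h2⟩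
      · exact Or.inr ⟨by omega, by rw [h2, huw]; simp⟩
      · exact Or.inl ⟨by omega, by rw [h2, huw]; simp⟩
    by_cases hxy : y = x
    · subst hxy
      obtain ⟨⟨z, hz, hz'⟩, -⟩ := hloc M hM 1 (Or.inl rfl) u w (by omega) (by omega)
        (by rw [huw]; simp) y hx hy
      exact ⟨y, z, hz, hx.tight, hz'⟩
    · exact ⟨x, y, hxy, hx.tight, hy'⟩

theorem ite_sub_ite_smul {A : Type*} [AddCommGroup A] [Module ℂ A] (p q : Prop) [Decidable p]
    [Decidable q] (g : A) :
    ((if p then (1 : ℂ) else 0) - if q then 1 else 0) • g =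
      (if p then g else 0) - if q then g else 0 := by
  simp [sub_smul]

theorem LocallyAdmissible.serreRelations (hloc : LocallyAdmissible C)
    (hC : C ⊆ setR n ∪ setR0 n) {L : Tableau n} (hL : IsRealization C L) :
    SerreRelations n (fun i => -gtOp (basisSet C L) 1 (i + 1))
      (fun i => gtOp (basisSet C L) (-1) (i + 1)) (fun i => weightOp (basisSet C L) i) := by
  refine SerreRelations.of_ring (p := fun i => gtOp (basisSet C L) 1 (i + 1))
      (fun i j => weightOp_mul_weightOp _ _ _) (fun i j => ?_)
    (fun i j => ?_) (fun i j hi hj => ?_)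
    (fun i j hi hj hij => gtOp_mul_far hC (Or.inl rfl) hi hj (by omega))
    (fun i j hi hj hij => gtOp_mul_far hC (Or.inr rfl) hi hj (by omega))
    (fun i j hi hj hij => ?_) (fun i j hi hj hij => ?_)
  · rw [weightOp_mul_gtOp]
    convert ite_sub_ite_smul (j + 1 = i + 1) (j + 1 = i) (gtOp (basisSet C L) 1 (j + 1)) using 2
    · simp
    · split_ifs <;> first | rfl | omega
    · split_ifs <;> first | rfl | omega
  · rw [weightOp_mul_gtOp]
    convert ite_sub_ite_smul (j + 1 = i) (j + 1 = i + 1) (gtOp (basisSet C L) (-1) (j + 1)) using 2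
    · split_ifs <;> simp
    · split_ifs <;> first | rfl | omega
    · split_ifs <;> first | rfl | omega
  · split_ifs with hij
    · subst hij
      refine end_ext fun M hM => ?_
      rw [LinearMap.sub_apply, Module.End.mul_apply, Module.End.mul_apply,
        gtOp_commutator_vec hC hi hM, LinearMap.sub_apply, weightOp_vec, weightOp_vec, ← sub_smul,
        hloc.diagCoeff_eq hC (hL.of_mem hM) hi]
    · rw [gtOp_mul_opposite (L := L) hC (Or.inl rfl) (k := i + 1) (l := j + 1) hi hj (by omega),
        sub_self]
  · rw [← two_smul ℂ]
    exact gtOp_serre hC hloc hL (Or.inl rfl) hi hj (by omega)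
  · rw [← two_smul ℂ]
    exact gtOp_serre hC hloc hL (Or.inr rfl) hi hj (by omega)

theorem LocallyAdmissible.admissible (hloc : LocallyAdmissible C) (hC : C ⊆ setR n ∪ setR0 n) :
    Admissible C := by
  intro L hL
  have : IsAddTorsionFree (Module.End ℂ (basisSet C L →₀ ℂ)) := .of_isTorsionFree ℂ _
  obtain ⟨ρ, h1, h2, h3⟩ := (hloc.serreRelations hC hL).exists_lieHom (R := ℂ)
  refine ⟨ρ, fun M hM => ⟨fun a b hab => ?_, fun a b hab => ?_, fun a => ?_⟩⟩
  · rw [h1 a b hab, LinearMap.neg_apply, gtOp_vec _ _ hM]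
    simp only [raiseCoeff_eq]
  · rw [h2 a b hab, gtOp_vec _ _ hM]
    simp only [lowerCoeff_eq]
  · rw [h3 a, weightOp_vec]
    rfl

/-- The relation `[E_{k,k+1}, E_{k+1,k}] = E_{kk} - E_{k+1,k+1}` is the only consequence of a module
structure that the argument uses. -/
theorem IsGTModule.diagCoeff_eq (hC : C ⊆ setR n ∪ setR0 n) {M : Tableau n}
    (hM : Satisfies C M) (h : IsGTModule (basisSet C M)) {a : ℕ} (ha : a + 1 < n) :
    diagCoeff M (a + 1) = weight M a - weight M (a + 1) := by
  obtain ⟨ρ, hρ⟩ := h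
  have hMB : M ∈ basisSet C M := ⟨self_mem_latticeSet M, hM⟩
  let p : Fin n := ⟨a, by omega⟩
  let q : Fin n := ⟨a + 1, ha⟩
  have hpq : p ≠ q := fun h => by simp [p, q] at h
  have hE : ρ (Matrix.single p q 1) = -gtOp (basisSet C M) 1 (a + 1) := by
    refine end_ext fun N hN => ?_
    rw [(hρ N hN).1 p q rfl, LinearMap.neg_apply, gtOp_vec _ _ hN]
    simp only [raiseCoeff_eq]
    rfl
  have hF : ρ (Matrix.single q p 1) = gtOp (basisSet C M) (-1) (a + 1) := by
    refine end_ext fun N hN => ?_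
    rw [(hρ N hN).2.1 p q rfl, gtOp_vec _ _ hN]
    simp only [lowerCoeff_eq]
    rfl
  have hbr : ⁅Matrix.single p q (1 : ℂ), Matrix.single q p (1 : ℂ)⁆ =
      Matrix.single p p 1 - Matrix.single q q 1 := by
    rw [LieRing.of_associative_ring_bracket]
    simp
  have h1 := congrArg (fun f => f (vec (basisSet C M) M)) (ρ.map_lie (Matrix.single p q 1)
      (Matrix.single q p 1))
  rw [hbr, hE, hF, map_sub, LieRing.of_associative_ring_bracket, LinearMap.sub_apply,
    LinearMap.sub_apply, (hρ M hMB).2.2 p, (hρ M hMB).2.2 q] at h1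
  have h2 := gtOp_commutator_vec (L := M) hC ha hMB
  rw [Module.End.mul_apply, Module.End.mul_apply, LinearMap.neg_apply, LinearMap.neg_apply,
    map_neg, sub_neg_eq_add, neg_add_eq_sub, h2, ← sub_smul, vec_of_mem hMB,
    Finsupp.smul_single, Finsupp.smul_single] at h1
  have h3 := Finsupp.single_injective _ h1
  simp only [smul_eq_mul, mul_one] at h3
  rw [← h3]
  simp only [weight, p, q]

end Admissibility

/-! ### Connected positions -/

section Connected

variable {n : ℕ} {C D : Set (Rel n)} {M : Tableau n}

/-- Two positions occur in a common relation of `C`. -/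
def Adj (C : Set (Rel n)) (a b : Vertex n) : Prop := ∃ r ∈ C, r.Involves a ∧ r.Involves b

/-- Two positions are joined by a chain of relations of `C`. -/
def Conn (C : Set (Rel n)) : Vertex n → Vertex n → Prop := Relation.ReflTransGen (Adj C)

theorem Conn.refl (C : Set (Rel n)) (a : Vertex n) : Conn C a a := Relation.ReflTransGen.refl

theorem Conn.of_mem {r : Rel n} (hr : r ∈ C) {a b : Vertex n} (ha : r.Involves a)
    (hb : r.Involves b) : Conn C a b := Relation.ReflTransGen.single ⟨r, hr, ha, hb⟩

theorem Conn.trans {a b c : Vertex n} (h : Conn C a b) (h' : Conn C b c) : Conn C a c :=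
  Relation.ReflTransGen.trans h h'

theorem Conn.symm {a b : Vertex n} (h : Conn C a b) : Conn C b a := by
  induction h with
  | refl => exact .refl C a
  | tail _ h ih => obtain ⟨r, hr, h1, h2⟩ := h; exact (Conn.of_mem hr h2 h1).trans ih

theorem Conn.mono (hCD : C ⊆ D) {a b : Vertex n} (h : Conn C a b) : Conn D a b := by
  induction h with
  | refl => exact .refl D a
  | tail _ h ih => obtain ⟨r, hr, h1, h2⟩ := h; exact ih.trans (Conn.of_mem (hCD hr) h1 h2)

theorem Conn.mem_verts {a b : Vertex n} (h : Conn C a b) (hab : a ≠ b) : a ∈ verts C := by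
  rcases Relation.ReflTransGen.cases_head h with rfl | ⟨c, ⟨r, hr, ha, -⟩, -⟩
  · exact absurd rfl hab
  · exact ⟨r, hr, ha⟩

/-- A set of positions that is closed under adjacency is closed under connectedness. -/
theorem Conn.mem_of_closed {S : Set (Vertex n)}
    (hS : ∀ r ∈ C, ∀ a b, r.Involves a → r.Involves b → a ∈ S → b ∈ S) {a b : Vertex n}
    (h : Conn C a b) (ha : a ∈ S) : b ∈ S := by
  induction h with
  | refl => exact ha
  | tail _ h ih => obtain ⟨r, hr, h1, h2⟩ := h; exact hS r hr _ _ h1 h2 ih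

theorem Rel.Holds.exists_sub_eq {r : Rel n} (h : r.Holds M) {a b : Vertex n} (ha : r.Involves a)
    (hb : r.Involves b) : ∃ m : ℤ, M a - M b = m := by
  cases r with
  | ge p q =>
    obtain ⟨m, -, hm⟩ := h
    rcases ha with rfl | rfl <;> rcases hb with rfl | rfl
    · exact ⟨0, by simp⟩
    · exact ⟨m, hm⟩
    · exact ⟨-m, by rw [← neg_sub, hm]; simp⟩
    · exact ⟨0, by simp⟩
  | gt p q =>
    obtain ⟨m, -, hm⟩ := h
    rcases ha with rfl | rfl <;> rcases hb with rfl | rfl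
    · exact ⟨0, by simp⟩
    · exact ⟨m, hm⟩
    · exact ⟨-m, by rw [← neg_sub, hm]; simp⟩
    · exact ⟨0, by simp⟩

theorem Satisfies.exists_sub_eq (hM : Satisfies C M) {a b : Vertex n} (h : Conn C a b) :
    ∃ m : ℤ, M a - M b = m := by
  refine h.mem_of_closed (S := {b | ∃ m : ℤ, M a - M b = m}) ?_ ⟨0, by simp⟩
  rintro r hr b c hb hc ⟨m, hm⟩
  obtain ⟨l, hl⟩ := (hM r hr).exists_sub_eq hb hc
  exact ⟨m + l, by push_cast; rw [← hm, ← hl]; ring⟩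

/-- The relations of `C` with a position connected to `u`. -/
def relClass (C : Set (Rel n)) (u : Vertex n) : Set (Rel n) :=
  {r | r ∈ C ∧ ∃ a, r.Involves a ∧ Conn C u a}

theorem isComponent_relClass (C : Set (Rel n)) (u : Vertex n) : IsComponent (relClass C u) C := by
  have hcl : ∀ r ∈ relClass C u, ∀ a, r.Involves a → Conn C u a := by
    rintro r ⟨hr, b, hb, hub⟩ a ha
    exact hub.trans (Conn.of_mem hr hb ha)
  refine ⟨fun r hr => hr.1, ?_, ?_⟩
  · rintro ⟨C₁, C₂, ⟨r₁, h₁⟩, ⟨r₂, h₂⟩, hdis, heq⟩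
    have hinv : ∀ r : Rel n, ∃ a, r.Involves a := by
      intro r
      cases r with
      | ge p q => exact ⟨p, Or.inl rfl⟩
      | gt p q => exact ⟨p, Or.inl rfl⟩
    obtain ⟨a₁, ha₁⟩ := hinv r₁
    obtain ⟨a₂, ha₂⟩ := hinv r₂
    have h1 : Conn C u a₁ := hcl r₁ (heq ▸ Or.inl h₁) _ ha₁
    have h2 : Conn C u a₂ := hcl r₂ (heq ▸ Or.inr h₂) _ ha₂
    have h12 : Conn C a₁ a₂ := h1.symm.trans h2
    have h3 : a₂ ∈ verts C₁ := by
      refine h12.mem_of_closed (S := verts C₁) ?_ ⟨r₁, h₁, ha₁⟩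
      rintro r hr a b ha hb ⟨r', hr', ha'⟩
      have hr2 : r ∈ relClass C u := ⟨hr, a, ha, hcl r' (heq ▸ Or.inl hr') _ ha'⟩
      rw [heq] at hr2
      rcases hr2 with hr2 | hr2
      · exact ⟨r, hr2, hb⟩
      · exact absurd ⟨r, hr2, ha⟩ (Set.disjoint_left.mp hdis ⟨r', hr', ha'⟩)
    exact Set.disjoint_left.mp hdis h3 ⟨r₂, h₂, ha₂⟩
  · refine Set.disjoint_left.mpr ?_
    rintro a ⟨r, hr, ha⟩ ⟨r', ⟨hr', hr''⟩, ha'⟩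
    exact hr'' ⟨hr', a, ha', hcl r hr a ha⟩

theorem Indecomposable.conn (hD : Indecomposable D) {u w : Vertex n} (hu : u ∈ verts D)
    (hw : w ∈ verts D) : Conn D u w := by
  have hdis := (isComponent_relClass D u).2.2
  obtain ⟨r, hr, h1⟩ := hu
  obtain ⟨r', hr', h1'⟩ := hw
  by_cases hmem : r' ∈ relClass D u
  · obtain ⟨-, a, ha, hua⟩ := hmem
    exact hua.trans (Conn.of_mem hr' ha h1')
  · exact absurd ⟨relClass D u, D \ relClass D u, ⟨r, hr, u, h1, .refl D u⟩, ⟨r', hr', hmem⟩, hdis,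
      (Set.union_sdiff_cancel fun r hr => hr.1).symm⟩ hD

/-- A component containing the position `u` contains all of `relClass C u`, and `relClass C u` is
itself a component. So noncriticality can be tested on connected pairs. -/
theorem noncriticalSet_iff : NoncriticalSet C ↔ ∀ (u w : Vertex n) (M : Tableau n),
    Satisfies (relClass C u) M → Conn C u w → u ≠ w → u.row = w.row → u.row < n → M u ≠ M w := by
  constructor
  · intro h u w M hM hconn huw hrow hu
    obtain ⟨r, hr, h1⟩ := hconn.mem_verts huw
    obtain ⟨r', hr', h1'⟩ := hconn.symm.mem_verts huw.symm
    exact h _ (isComponent_relClass C u) M hM u ⟨r, ⟨hr, u, h1, .refl C u⟩, h1⟩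
      w ⟨r', ⟨hr', w, h1', hconn⟩, h1'⟩ huw hrow hu
  · intro h D hD M hM u hu w hw huw hrow hun
    refine h u w M (fun r hr => hM r ?_) ((hD.2.1.conn hu hw).mono hD.1) huw hrow hun
    obtain ⟨hr, a, ha, hua⟩ := hr
    have hcl : ∀ r ∈ C, ∀ a, r.Involves a → a ∈ verts D → r ∈ D := by
      intro r hr a ha haD
      by_contra hrD
      exact Set.disjoint_left.mp hD.2.2 haD ⟨r, ⟨hr, hrD⟩, ha⟩
    exact hcl r hr a ha (hua.mem_of_closed (S := verts D)
      (fun r hr a b ha hb h => ⟨r, hcl r hr a ha h, hb⟩) hu)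

theorem NoncriticalSet.ne (hC : NoncriticalSet C) (hM : Satisfies C M) {u w : Vertex n}
    (hconn : Conn C u w) (huw : u ≠ w) (hrow : u.row = w.row) (hu : u.row < n) : M u ≠ M w :=
  noncriticalSet_iff.mp hC u w M (fun r hr => hM r hr.1) hconn huw hrow hu

/-- A number that identifies the class of connected positions. -/
noncomputable def connIndex (C : Set (Rel n)) (u : Vertex n) : ℕ :=
  sInf ((fun v => (Fintype.equivFin (Vertex n) v : ℕ)) '' {v | Conn C u v})

theorem connIndex_eq_iff {u w : Vertex n} : connIndex C u = connIndex C w ↔ Conn C u w := by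
  constructor
  · intro h
    obtain ⟨a, ha, ha'⟩ : connIndex C u ∈ _ := Nat.sInf_mem ⟨_, u, Conn.refl C u, rfl⟩
    obtain ⟨b, hb, hb'⟩ : connIndex C w ∈ _ := Nat.sInf_mem ⟨_, w, Conn.refl C w, rfl⟩
    have hab : a = b := (Fintype.equivFin (Vertex n)).injective
      (Fin.val_injective (ha'.trans (h.trans hb'.symm)))
    exact Conn.trans ha (hab ▸ Conn.symm hb)
  · intro h
    have : {v | Conn C u v} = {v | Conn C w v} :=
      Set.ext fun v => ⟨fun hv => h.symm.trans hv, fun hv => h.trans hv⟩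
    rw [connIndex, connIndex, this]

end Connected

/-! ### Integral potentials -/

section Potential

variable {n : ℕ} {C : Set (Rel n)} {M : Tableau n} {s : ℤ}

/-- `C` requires the entry of `p` to exceed the entry of `q` by at least `c` in the direction
`s = ±1`. -/
def Edge (C : Set (Rel n)) (s : ℤ) (p q : Vertex n) (c : ℤ) : Prop :=
  (geRel s p q ∈ C ∧ (p.row : ℤ) = q.row + s ∧ c = 0) ∨
    (gtRel s p q ∈ C ∧ (p.row : ℤ) + s = q.row ∧ c = 1) ∨
    (geRel s p q ∈ C ∧ p.row = n ∧ q.row = n ∧ c = 0)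

theorem edge_neg (hs : s = 1 ∨ s = -1) {p q : Vertex n} {c : ℤ} :
    Edge C (-s) p q c ↔ Edge C s q p c := by
  have h1 : geRel (-s) p q = geRel s q p := by rcases hs with rfl | rfl <;> simp [geRel]
  have h2 : gtRel (-s) p q = gtRel s q p := by rcases hs with rfl | rfl <;> simp [gtRel]
  have h3 : (p.row : ℤ) = q.row + -s ↔ (q.row : ℤ) = p.row + s := by omega
  have h4 : (p.row : ℤ) + -s = q.row ↔ (q.row : ℤ) + s = p.row := by omega
  rw [Edge, Edge, h1, h2, h3, h4]
  tauto

theorem Edge.adj (hs : s = 1 ∨ s = -1) {p q : Vertex n} {c : ℤ} (h : Edge C s p q c) :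
    Adj C p q := by
  have h1 : (geRel s p q).Involves p ∧ (geRel s p q).Involves q := by
    rcases hs with rfl | rfl <;> simp [geRel, Rel.Involves]
  have h2 : (gtRel s p q).Involves p ∧ (gtRel s p q).Involves q := by
    rcases hs with rfl | rfl <;> simp [gtRel, Rel.Involves]
  rcases h with ⟨h, -⟩ | ⟨h, -⟩ | ⟨h, -⟩
  · exact ⟨_, h, h1⟩
  · exact ⟨_, h, h2⟩
  · exact ⟨_, h, h1⟩

theorem Edge.exists_sub_eq (hs : s = 1 ∨ s = -1) (hM : Satisfies C M) {p q : Vertex n} {c : ℤ}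
    (h : Edge C s p q c) : ∃ m : ℤ, c ≤ m ∧ M p - M q = s * m := by
  have hge : geRel s p q ∈ C → ∃ m : ℤ, 0 ≤ m ∧ M p - M q = s * m := by
    intro h
    rcases hs with rfl | rfl
    · obtain ⟨m, h1, h2⟩ := hM _ h
      exact ⟨m, h1, by rw [h2]; simp⟩
    · obtain ⟨m, h1, h2⟩ := hM _ h
      exact ⟨m, h1, by rw [← neg_sub, h2]; simp⟩
  rcases h with ⟨h, -, rfl⟩ | ⟨h, -, rfl⟩ | ⟨h, -, -, rfl⟩
  · exact hge h
  · rcases hs with rfl | rfl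
    · obtain ⟨m, h1, h2⟩ := hM _ h
      exact ⟨m, by omega, by rw [h2]; simp⟩
    · obtain ⟨m, h1, h2⟩ := hM _ h
      exact ⟨m, by omega, by rw [← neg_sub, h2]; simp⟩
  · exact hge h

/-- `l` satisfies the requirements of `C` in the direction `s`. -/
def IsPotential (C : Set (Rel n)) (s : ℤ) (l : Vertex n → ℤ) : Prop :=
  ∀ p q c, Edge C s p q c → l q + c ≤ l p

/-- The offset `κ` cancels in every relation, so classes of connected positions can be displaced
independently, even by non-integral amounts. -/
theorem IsPotential.satisfies (hC : C ⊆ setR n ∪ setR0 n) (hs : s = 1 ∨ s = -1)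
    {l : Vertex n → ℤ} (hl : IsPotential C s l) {κ : Vertex n → ℂ}
    (hκ : ∀ a b, Adj C a b → κ a = κ b) : Satisfies C fun t => (s * l t : ℤ) + κ t := by
  intro r hr
  have hadj : ∀ a b, r.Involves a → r.Involves b → κ a = κ b := fun a b ha hb =>
    hκ a b ⟨r, hr, ha, hb⟩
  have key : ∀ p q c, Edge C 1 p q c → s * l q + c ≤ s * l p := by
    intro p q c h
    rcases hs with rfl | rfl
    · linarith [hl p q c h]
    · linarith [hl q p c ((edge_neg (Or.inl rfl)).mpr h)]
  rcases hC hr with ⟨a, b, hab, rfl | rfl⟩ | ⟨a, b, ha, hb, -, rfl⟩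
  · have := key a b 0 (Or.inl ⟨by simpa [geRel] using hr, by omega, rfl⟩)
    exact ⟨s * l a - s * l b, by omega, by
      simp only [hadj a b (Or.inl rfl) (Or.inr rfl)]; push_cast; ring⟩
  · have := key b a 1 (Or.inr (Or.inl ⟨by simpa [gtRel] using hr, by omega, rfl⟩))
    exact ⟨s * l b - s * l a, by omega, by
      simp only [hadj b a (Or.inl rfl) (Or.inr rfl)]; push_cast; ring⟩
  · have := key a b 0 (Or.inr (Or.inr ⟨by simpa [geRel] using hr, ha, hb, rfl⟩))
    exact ⟨s * l a - s * l b, by omega, by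
      simp only [hadj a b (Or.inl rfl) (Or.inr rfl)]; push_cast; ring⟩

/-- The integral part of the entry of `t` in the direction `s`. -/
noncomputable def level (s : ℤ) (M : Tableau n) (t : Vertex n) : ℤ := s * ⌊(M t).re⌋

theorem level_sub_level (hs : s = 1 ∨ s = -1) {p q : Vertex n} {m : ℤ} (h : M p - M q = s * m) :
    level s M p - level s M q = m := by
  have h1 : M p = M q + ((s * m : ℤ) : ℂ) := by push_cast; rw [← h]; ring
  have h2 : (M p).re = (M q).re + ((s * m : ℤ) : ℝ) := by
    rw [h1, Complex.add_re, Complex.intCast_re]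
  rw [level, level, h2, Int.floor_add_intCast]
  rcases hs with rfl | rfl <;> ring

theorem isPotential_level (hs : s = 1 ∨ s = -1) (hM : Satisfies C M) :
    IsPotential C s (level s M) := by
  intro p q c h
  obtain ⟨m, hm, hm'⟩ := h.exists_sub_eq hs hM
  have := level_sub_level hs hm'
  omega

theorem sub_eq_level_sub_level (hs : s = 1 ∨ s = -1) (hM : Satisfies C M) {p q : Vertex n}
    (h : Conn C p q) : M p - M q = s * (level s M p - level s M q : ℤ) := by
  obtain ⟨m, hm⟩ := hM.exists_sub_eq h
  have hss : (s : ℂ) * s = 1 := by rcases hs with rfl | rfl <;> simp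
  have hm' : M p - M q = s * (s * m : ℤ) := by rw [hm]; push_cast; rw [← mul_assoc, hss, one_mul]
  rw [level_sub_level hs hm', hm']

/-- Integral potentials define realizations whose entries differ by integers only within the
classes of connected positions. -/
theorem NoncriticalSet.isRealization (hnc : NoncriticalSet C) (hC : C ⊆ setR n ∪ setR0 n)
    (hs : s = 1 ∨ s = -1) {l : Vertex n → ℤ} (hl : IsPotential C s l) :
    IsRealization C fun t => (s * l t : ℤ) + connIndex C t * Complex.I := by
  refine ⟨hl.satisfies hC hs fun a b hab => ?_, ?_⟩
  · rw [connIndex_eq_iff.mpr (Relation.ReflTransGen.single hab)]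
  · rintro N ⟨⟨z, -, hz⟩, hN⟩ u w huw hrow hu heq
    by_cases hconn : Conn C u w
    · exact hnc.ne hN hconn huw hrow hu heq
    -- Distinct classes have distinct imaginary parts, and integral shifts preserve these.
    · refine hconn (connIndex_eq_iff.mp ?_)
      have := congrArg Complex.im heq
      rw [hz, hz] at this
      simpa using this

end Potential

/-! ### Removal of a position -/

section Removal

variable {n : ℕ} {C D : Set (Rel n)} {M : Tableau n} {s : ℤ}

theorem geRel_involves (hs : s = 1 ∨ s = -1) {p q t : Vertex n} :
    (geRel s p q).Involves t ↔ t = p ∨ t = q := by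
  rcases hs with rfl | rfl <;> simp [geRel, Rel.Involves, or_comm]

theorem gtRel_involves (hs : s = 1 ∨ s = -1) {p q t : Vertex n} :
    (gtRel s p q).Involves t ↔ t = p ∨ t = q := by
  rcases hs with rfl | rfl <;> simp [gtRel, Rel.Involves, or_comm]

/-- An edge persists in every subset that contains the relations involving its two ends. -/
theorem Edge.of_forall (hs : s = 1 ∨ s = -1) {p q : Vertex n} {c : ℤ} (h : Edge C s p q c)
    (hD : ∀ r ∈ C, (∀ t, r.Involves t ↔ t = p ∨ t = q) → r ∈ D) : Edge D s p q c := by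
  rcases h with ⟨h, h'⟩ | ⟨h, h'⟩ | ⟨h, h'⟩
  · exact Or.inl ⟨hD _ h fun t => geRel_involves hs, h'⟩
  · exact Or.inr (Or.inl ⟨hD _ h fun t => gtRel_involves hs, h'⟩)
  · exact Or.inr (Or.inr ⟨hD _ h fun t => geRel_involves hs, h'⟩)

theorem Edge.removeVertex (hs : s = 1 ∨ s = -1) {p q v : Vertex n} {c : ℤ} (h : Edge C s p q c)
    (hp : p ≠ v) (hq : q ≠ v) : Edge (removeVertex C v) s p q c :=
  h.of_forall hs fun r hr hr' => ⟨hr, fun hv => by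
    rcases (hr' v).mp hv with rfl | rfl
    · exact hp rfl
    · exact hq rfl⟩

theorem Edge.relClass (hs : s = 1 ∨ s = -1) {u p q : Vertex n} {c : ℤ} (h : Edge C s p q c)
    (hp : Conn C u p) : Edge (relClass C u) s p q c :=
  h.of_forall hs fun _ hr hr' => ⟨hr, p, (hr' p).mpr (Or.inl rfl), hp⟩

theorem Edge.conn (hs : s = 1 ∨ s = -1) {p q : Vertex n} {c : ℤ} (h : Edge C s p q c) :
    Conn C p q := Relation.ReflTransGen.single (h.adj hs)

theorem Edge.nonneg_le_one {p q : Vertex n} {c : ℤ} (h : Edge C s p q c) : 0 ≤ c ∧ c ≤ 1 := by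
  rcases h with ⟨-, -, rfl⟩ | ⟨-, -, rfl⟩ | ⟨-, -, -, rfl⟩ <;> simp

theorem Edge.ne (hC : C ⊆ setR n ∪ setR0 n) (hs : s = 1 ∨ s = -1) {p q : Vertex n} {c : ℤ}
    (h : Edge C s p q c) : p ≠ q := by
  rintro rfl
  have key : Rel.ge p p ∉ C := by
    intro hr
    rcases hC hr with ⟨a, b, hab, h | h⟩ | ⟨a, b, -, -, hab, h⟩
    · injection h with h1 h2
      subst h1
      subst h2
      omega
    · cases h
    · injection h with h1 h2
      exact hab (h1.symm.trans h2)
  rcases h with ⟨-, h, -⟩ | ⟨-, h, -⟩ | ⟨h, -⟩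
  · omega
  · omega
  · rcases hs with rfl | rfl <;> exact key (by simpa [geRel] using h)

/-- No relation bounds `v` from above, or none bounds it from below. -/
def Extremal (C : Set (Rel n)) (v : Vertex n) : Prop :=
  (∀ p c, ¬ Edge C 1 p v c) ∨ ∀ q c, ¬ Edge C 1 v q c

theorem Extremal.of_direction {v : Vertex n} (h : Extremal C v) (hs : s = 1 ∨ s = -1) :
    (∀ p c, ¬ Edge C s p v c) ∨ ∀ q c, ¬ Edge C s v q c := by
  rcases hs with rfl | rfl
  · exact h
  · exact h.symm.imp (fun h p c h' => h p c ((edge_neg (Or.inl rfl)).mp h'))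
      (fun h p c h' => h p c ((edge_neg (Or.inl rfl)).mp h'))

/-- A relation bounding `v` from above and one bounding it from below would confine `m` to a finite
interval. -/
theorem extremal_of_infinite (hC : C ⊆ setR n ∪ setR0 n) {v : Vertex n} {L : Tableau n}
    (hL : Satisfies C L) (h : {m : ℤ | IsRealization C (shift L v m)}.Infinite) : Extremal C v := by
  by_contra hext
  simp only [Extremal, not_or, not_forall, not_not] at hext
  obtain ⟨⟨p, c, hp⟩, ⟨q, d, hq⟩⟩ := hext
  have hpv := hp.ne hC (Or.inl rfl)
  have hqv := (hq.ne hC (Or.inl rfl)).symm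
  obtain ⟨a, -, ha⟩ := hp.exists_sub_eq (Or.inl rfl) hL
  obtain ⟨b, -, hb⟩ := hq.exists_sub_eq (Or.inl rfl) hL
  refine h ((Set.finite_Icc (d - b) (a - c)).subset fun m hm => ?_)
  obtain ⟨a', ha', ha''⟩ := hp.exists_sub_eq (Or.inl rfl) hm.1
  obtain ⟨b', hb', hb''⟩ := hq.exists_sub_eq (Or.inl rfl) hm.1
  rw [shift_self, shift_of_ne _ _ hpv] at ha''
  rw [shift_self, shift_of_ne _ _ hqv] at hb''
  have h1 : ((a' : ℤ) : ℂ) = ((a - m : ℤ) : ℂ) := by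
    push_cast at *; linear_combination ha - ha''
  have h2 : ((b' : ℤ) : ℂ) = ((b + m : ℤ) : ℂ) := by
    push_cast at *; linear_combination hb - hb''
  have h1 := Int.cast_injective h1
  have h2 := Int.cast_injective h2
  exact ⟨by omega, by omega⟩

theorem removeVertex_subset (C : Set (Rel n)) (v : Vertex n) : removeVertex C v ⊆ C :=
  fun _ hr => hr.1

theorem notMem_verts_removeVertex (C : Set (Rel n)) (v : Vertex n) :
    v ∉ verts (removeVertex C v) := fun ⟨_, hr, hv⟩ => hr.2 hv

/-- A potential on the rest of `C` extends to an extremal position. -/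
theorem IsPotential.exists_update (hs : s = 1 ∨ s = -1) {v : Vertex n}
    (hv : Extremal C v) {l : Vertex n → ℤ} (hl : IsPotential (removeVertex C v) s l) :
    ∃ k : ℤ, IsPotential C s (Function.update l v (10 * k + 5)) := by
  have hB : ∀ t, |l t| ≤ ∑ t, |l t| := fun t =>
    Finset.single_le_sum (f := fun t => |l t|) (fun _ _ => abs_nonneg _) (Finset.mem_univ t)
  set B := ∑ t, |l t|
  rcases hv.of_direction hs with hv | hv
  -- Here `v` is bounded only from below, by values of at most `B + 1`, so any large value serves;
  -- the form `10 * k + 5` keeps it away from the values of `spread`.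
  · refine ⟨B + 1, fun p q c h => ?_⟩
    have hc := h.nonneg_le_one
    have hq : q ≠ v := by rintro rfl; exact hv p c h
    rw [Function.update_of_ne hq]
    by_cases hp : p = v
    · subst hp
      rw [Function.update_self]
      have := abs_le.mp (hB q)
      omega
    · rw [Function.update_of_ne hp]
      exact hl p q c (h.removeVertex hs hp hq)
  · refine ⟨-(B + 1), fun p q c h => ?_⟩
    have hc := h.nonneg_le_one
    have hp : p ≠ v := by rintro rfl; exact hv q c h
    rw [Function.update_of_ne hp]
    by_cases hq : q = v
    · subst hq
      rw [Function.update_self]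
      have := abs_le.mp (hB p)
      omega
    · rw [Function.update_of_ne hq]
      exact hl p q c (h.removeVertex hs hp hq)

/-- A potential on one class of the remaining positions extends to all positions, with values
congruent to `5` modulo `10` outside this class. -/
theorem exists_isPotential_extending (hs : s = 1 ∨ s = -1)
    {v : Vertex n} (hv : Extremal C v) (hM : Satisfies C M) {u : Vertex n} (huv : u ≠ v)
    {l : Vertex n → ℤ} (hl : ∀ p q c, Conn (removeVertex C v) u p →
      Edge (removeVertex C v) s p q c → l q + c ≤ l p) :
    ∃ l', IsPotential C s l' ∧ (∀ t, Conn (removeVertex C v) u t → l' t = l t) ∧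
      ∀ t, ¬ Conn (removeVertex C v) u t → ∃ k, l' t = 10 * k + 5 := by
  classical
  have hsat : Satisfies (removeVertex C v) M := fun r hr => hM r hr.1
  -- On the other classes the levels of `M` are multiplied by ten, which keeps every requirement
  -- because `c ≤ 1`, and shifted by five.
  have hglue : IsPotential (removeVertex C v) s fun t =>
      if Conn (removeVertex C v) u t then l t else 10 * level s M t + 5 := by
    intro p q c h
    beta_reduce
    by_cases hp : Conn (removeVertex C v) u p
    · rw [if_pos hp, if_pos (hp.trans (h.conn hs))]
      exact hl p q c hp h
    · rw [if_neg hp, if_neg fun hq => hp (Conn.trans hq (h.conn hs).symm)]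
      have h1 := isPotential_level hs hsat p q c h
      have h2 := h.nonneg_le_one
      omega
  obtain ⟨k, hk⟩ := hglue.exists_update hs hv
  have hvK : ¬ Conn (removeVertex C v) u v := fun h =>
    notMem_verts_removeVertex C v (h.symm.mem_verts huv.symm)
  refine ⟨_, hk, fun t ht => ?_, fun t ht => ?_⟩
  · rw [Function.update_of_ne (by rintro rfl; exact hvK ht), if_pos ht]
  · by_cases htv : t = v
    · subst htv
      exact ⟨k, Function.update_self ..⟩
    · exact ⟨level s M t, by rw [Function.update_of_ne htv, if_neg ht]⟩

/-- A tableau with a coincidence in one class of the remaining set extends to a tableau satisfying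
`C`, where the two positions are still connected; this contradicts noncriticality of `C`. -/
theorem NoncriticalSet.removeVertex (hnc : NoncriticalSet C) (hC : C ⊆ setR n ∪ setR0 n)
    {v : Vertex n} (hv : Extremal C v) (hM : Satisfies C M) :
    NoncriticalSet (removeVertex C v) := by
  rw [noncriticalSet_iff]
  intro u w N hN hconn huw hrow hun heq
  have huv : u ≠ v := by
    rintro rfl
    exact notMem_verts_removeVertex C u (hconn.mem_verts huw)
  obtain ⟨l, hl, hl', -⟩ := exists_isPotential_extending (Or.inl rfl) hv hM huv
    (l := level 1 N) fun p q c hp h =>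
      isPotential_level (Or.inl rfl) hN p q c (h.relClass (Or.inl rfl) hp)
  refine hnc.ne (hl.satisfies hC (Or.inl rfl) (κ := 0) fun _ _ _ => rfl)
    (hconn.mono (removeVertex_subset C v)) huw hrow hun ?_
  simp only [hl' u (.refl _ u), hl' w hconn, level, heq, Pi.zero_apply]

/-- Spreads the integers apart, leaving only the step from `0` to `1`. -/
def spread (j : ℤ) : ℤ := if j ≤ 0 then 10 * j else 10 * (j - 1) + 1

theorem Tight.neg_iff {u w z : Vertex n} (hrow : u.row = w.row) (huw : M w = M u - 1) :
    Tight (-1) M u z ↔ Tight 1 M w z := by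
  rw [Tight, Tight, huw]
  constructor
  · rintro (⟨h1, h2⟩ | ⟨h1, h2⟩)
    · exact Or.inr ⟨by omega, by rw [h2]; push_cast; ring⟩
    · exact Or.inl ⟨by omega, by rw [h2]; push_cast; ring⟩
  · rintro (⟨h1, h2⟩ | ⟨h1, h2⟩)
    · exact Or.inr ⟨by omega, by rw [h2]; push_cast; ring⟩
    · exact Or.inl ⟨by omega, by rw [h2]; push_cast; ring⟩

/-- The module relations at a tableau with a single pair of entries of a row that differ by one
force a second tight entry. -/
theorem Admissible.exists_tight (hadm : Admissible C) (hC : C ⊆ setR n ∪ setR0 n)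
    (hs : s = 1 ∨ s = -1) (hM : IsRealization C M) {u w x : Vertex n} (hrow : u.row = w.row)
    (hu : u.row < n) (huw : M w = M u + s)
    (huniq : ∀ p q : Vertex n, p.row = u.row → q.row = u.row → M q = M p + s → p = u)
    (hx : Tight s M u x) : ∃ z, z ≠ x ∧ Tight s M u z := by
  obtain ⟨a, ha⟩ : ∃ a, u.row = a + 1 := ⟨_, rfl⟩
  have hmod := hadm M hM
  have hdiag := hmod.diagCoeff_eq hC hM.1 (a := a) (by omega)
  have hinj : ∀ p q : Vertex n, p.row = a + 1 → q.row = a + 1 → M p = M q → p = q := by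
    intro p q hp hq hpq
    by_contra hne
    exact hM.2 M ⟨self_mem_latticeSet M, hM.1⟩ p q hne (by omega) (by omega) hpq
  rcases hs with rfl | rfl
  · exact exists_tight_of_diagCoeff M (by omega) hinj hdiag (w := w) ha (by omega)
      (by rw [huw]; simp) (fun p q hp hq h => huniq p q (by omega) (by omega) (by rw [h]; simp)) hx
  -- The positions tight for `u` downwards are those tight for `w` upwards, so the double pole is
  -- now at `M w` and the roles of `u` and `w` are exchanged.
  · have huw' : M w = M u - 1 := by rw [huw]; push_cast; ring
    simp only [Tight.neg_iff hrow huw'] at hx ⊢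
    refine exists_tight_of_diagCoeff M (by omega) hinj hdiag (w := u) (by omega) ha
      (by rw [huw']; ring) (fun p q hp hq h => ?_) hx
    have := huniq q p (by omega) (by omega) (by rw [h]; push_cast; ring)
    subst this
    exact hinj _ _ hp (by omega) (by rw [huw', h]; ring)

theorem re_eq_of_eq (hs : s = 1 ∨ s = -1) {a b j : ℤ} {i k : ℕ}
    (h : ((s * a : ℤ) : ℂ) + i * Complex.I = (s * b : ℤ) + k * Complex.I + (s * j : ℤ)) :
    a = b + j := by
  have := congrArg Complex.re h
  simp only [Complex.add_re, Complex.intCast_re, Complex.mul_re, Complex.natCast_re, Complex.I_re,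
    Complex.natCast_im, Complex.I_im] at this
  have h2 : s * a = s * b + s * j := by
    have : ((s * a : ℤ) : ℝ) = ((s * b + s * j : ℤ) : ℝ) := by push_cast at this ⊢; linarith
    exact_mod_cast this
  rcases hs with rfl | rfl <;> omega

/-- If the entries of one class of the remaining positions can be spread apart, with the positions
in `Ω` lowered by one, then the module relations produce a second tight entry in the new tableau. -/
theorem Admissible.exists_tight_removeVertex (hadm : Admissible C) (hC : C ⊆ setR n ∪ setR0 n)
    (hnc : NoncriticalSet C) {v : Vertex n} (hv : Extremal C v) {L : Tableau n}
    (hL : Satisfies C L) (hM : IsRealization (removeVertex C v) M) (hs : s = 1 ∨ s = -1)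
    {u w x : Vertex n} (huv : u ≠ v) (hrow : u.row = w.row) (hu : u.row < n)
    (huw : M w = M u + s) (hw : Conn (removeVertex C v) u w) (hx : Conn (removeVertex C v) u x)
    (hux : Tight s M u x) (Ω : Set (Vertex n)) [DecidablePred (· ∈ Ω)] (hxΩ : x ∉ Ω)
    (hΩ : ∀ t ∈ Ω, t.row ≠ u.row) {l : Vertex n → ℤ}
    (hl : ∀ t, l t = spread (level s M t - level s M u) - if t ∈ Ω then 1 else 0)
    (hpot : ∀ p q c, Conn (removeVertex C v) u p → Edge (removeVertex C v) s p q c →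
      l q + c ≤ l p) :
    ∃ z, z ≠ x ∧ Conn (removeVertex C v) u z ∧
      (((z.row : ℤ) = u.row + s ∧ l z = 0) ∨ ((z.row : ℤ) + s = u.row ∧ l z = 1)) := by
  -- Admissibility of `C` says nothing about `M`, which need not satisfy `C`; it is applied to the
  -- realization built from the extended potential.
  obtain ⟨l', hl', h1, h2⟩ := exists_isPotential_extending hs hv hL huv hpot
  have hR := hnc.isRealization hC hs hl'
  have hdiff : ∀ t, Conn (removeVertex C v) u t → M t - M u = s * (level s M t - level s M u : ℤ) :=
    fun t ht => sub_eq_level_sub_level hs hM.1 ht.symm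
  have hlev : ∀ t j, M t = M u + s * (j : ℤ) → level s M t - level s M u = j := fun t j h =>
    level_sub_level hs (by rw [h]; ring)
  have huΩ : u ∉ Ω := fun h => hΩ u h rfl
  have hwΩ : w ∉ Ω := fun h => hΩ w h hrow.symm
  have hlu : l' u = 0 := by rw [h1 u (.refl _ u), hl, if_neg huΩ]; simp [spread]
  have hlw : l' w = 1 := by
    rw [h1 w hw, hl, if_neg hwΩ, hlev w 1 (by rw [huw]; simp)]; simp [spread]
  have hκ : ∀ t, Conn (removeVertex C v) u t → connIndex C t = connIndex C u := fun t ht =>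
    connIndex_eq_iff.mpr (ht.mono (removeVertex_subset C v)).symm
  -- In the row of `u`, values are `0` or `1` modulo `10` inside the class of `u` and `5` outside. A
  -- step of one therefore starts at relative level `0`, which only `u` has in its row.
  have huniq : ∀ p q : Vertex n, p.row = u.row → q.row = u.row →
      ((s * l' q : ℤ) : ℂ) + connIndex C q * Complex.I =
        (s * l' p : ℤ) + connIndex C p * Complex.I + s → p = u := by
    intro p q hp hq h
    have h3 : l' q = l' p + 1 := re_eq_of_eq hs (i := connIndex C q) (k := connIndex C p)
      (by rw [h]; simp)
    have h4 : ∀ t, t.row = u.row → Conn (removeVertex C v) u t →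
        l' t = spread (level s M t - level s M u) := fun t ht ht' => by
      rw [h1 t ht', hl, if_neg fun h => hΩ t h ht, sub_zero]
    have h5 : Conn (removeVertex C v) u p := by
      by_contra hp'
      obtain ⟨k, hk⟩ := h2 p hp'
      by_cases hq' : Conn (removeVertex C v) u q
      · have := h4 q hq hq'
        rw [spread] at this
        split_ifs at this <;> omega
      · obtain ⟨k', hk'⟩ := h2 q hq'
        omega
    have h6 : Conn (removeVertex C v) u q := by
      by_contra hq'
      obtain ⟨k, hk⟩ := h2 q hq'
      have := h4 p hp h5
      rw [spread] at this
      split_ifs at this <;> omega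
    rw [h4 p hp h5, h4 q hq h6] at h3
    have h7 : level s M p - level s M u = 0 := by
      rw [spread, spread] at h3
      split_ifs at h3 <;> omega
    have h8 : M p = M u := by
      have := hdiff p h5
      rw [h7] at this
      simpa [sub_eq_zero] using this
    by_contra hne
    exact hM.2 M ⟨self_mem_latticeSet M, hM.1⟩ p u hne hp (by omega) h8
  have hx' : Tight s (fun t => ((s * l' t : ℤ) : ℂ) + connIndex C t * Complex.I) u x := by
    have h3 : l' x = spread (level s M x - level s M u) := by
      rw [h1 x hx, hl, if_neg hxΩ, sub_zero]
    rcases hux with ⟨h4, h5⟩ | ⟨h4, h5⟩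
    · refine Or.inl ⟨h4, ?_⟩
      rw [hlev x 0 (by rw [h5]; simp)] at h3
      simp only [h3, hlu, hκ x hx]
      simp [spread]
    · refine Or.inr ⟨h4, ?_⟩
      rw [hlev x 1 (by rw [h5]; simp)] at h3
      simp only [h3, hlu, hκ x hx]
      simp [spread]
      ring
  obtain ⟨z, hzx, hz⟩ := hadm.exists_tight hC hs hR (u := u) (w := w) (x := x) hrow hu
    (by simp only [hlu, hlw, hκ w hw]; push_cast; ring) huniq hx'
  refine ⟨z, hzx, ?_⟩
  -- The value found is `0` or `1`, not `5` modulo `10`, so its position lies in the class of `u`.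
  have h3 : ∀ j, (j = 0 ∨ j = 1) → l' z = l' u + j → Conn (removeVertex C v) u z ∧ l z = j := by
    intro j hj h
    have hz : Conn (removeVertex C v) u z := by
      by_contra hz
      obtain ⟨k, hk⟩ := h2 z hz
      omega
    exact ⟨hz, by rw [← h1 z hz, h, hlu, zero_add]⟩
  rcases hz with ⟨h4, h5⟩ | ⟨h4, h5⟩
  · obtain ⟨h6, h7⟩ := h3 0 (Or.inl rfl) (re_eq_of_eq hs
      (i := connIndex C z) (k := connIndex C u) (by beta_reduce at h5; rw [h5]; simp))
    exact ⟨h6, Or.inl ⟨h4, h7⟩⟩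
  · obtain ⟨h6, h7⟩ := h3 1 (Or.inr rfl) (re_eq_of_eq hs
      (i := connIndex C z) (k := connIndex C u) (by beta_reduce at h5; rw [h5]; simp))
    exact ⟨h6, Or.inr ⟨h4, h7⟩⟩

theorem Blocks.conn (hs : s = 1 ∨ s = -1) {u z : Vertex n} (h : Blocks C s M u z) :
    Conn C u z := by
  rcases h with ⟨-, -, h⟩ | ⟨-, -, h⟩
  · exact Conn.of_mem h ((geRel_involves hs).mpr (Or.inr rfl)) ((geRel_involves hs).mpr
        (Or.inl rfl))
  · exact Conn.of_mem h ((gtRel_involves hs).mpr (Or.inr rfl)) ((gtRel_involves hs).mpr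
        (Or.inl rfl))

/-- Both halves of the local condition come from spreading the class of `u` and asking the module
for a second tight entry. The plain spreading finds a tight entry of `M`. For the blocking position,
entries that are tight without blocking are first pushed away. -/
theorem LocallyAdmissible.of_removeVertex (hadm : Admissible C) (hC : C ⊆ setR n ∪ setR0 n)
    (hnc : NoncriticalSet C) {v : Vertex n} (hv : Extremal C v) {L : Tableau n}
    (hL : Satisfies C L) : LocallyAdmissible (removeVertex C v) := by
  classical
  intro M hM s hs u w hrow hu huw x hxu hxw
  have hx := hxu.conn hs
  have hw : Conn (removeVertex C v) u w := hx.trans (hxw.conn (by omega)).symm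
  have huv : u ≠ v := by
    rintro rfl
    exact notMem_verts_removeVertex C u (hx.mem_verts (ne_of_row_ne (hxu.row_ne hs).symm))
  have hdiff : ∀ t j, Conn (removeVertex C v) u t → level s M t - level s M u = j →
      M t = M u + s * (j : ℤ) := fun t j ht hj => by
    rw [← hj, ← sub_eq_level_sub_level hs hM.1 ht.symm]; ring
  have hlev : ∀ t j, M t = M u + s * (j : ℤ) → level s M t - level s M u = j := fun t j h =>
    level_sub_level hs (by rw [h]; ring)
  have hinj : ∀ t, t.row = u.row → Conn (removeVertex C v) u t →
      level s M t - level s M u = 0 → t = u := by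
    intro t ht hut h
    by_contra hne
    exact hM.2 M ⟨self_mem_latticeSet M, hM.1⟩ t u hne ht (by omega)
      (by rw [hdiff t 0 hut h]; simp)
  have hedge : ∀ p q c, Edge (removeVertex C v) s p q c →
      level s M q - level s M u + c ≤ level s M p - level s M u := fun p q c h => by
    have := isPotential_level hs hM.1 p q c h
    omega
  have key := hadm.exists_tight_removeVertex hC hnc hv hL hM hs huv hrow hu huw hw hx hxu.tight
  refine ⟨?_, fun hxn => ?_⟩
  -- Since `spread` is `0` only at `0` and `1` only at `1`, the second tight entry is tight in `M`
  -- itself.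
  · obtain ⟨z, hzx, hz, hz'⟩ := key ∅ (by simp) (by simp)
      (l := fun t => spread (level s M t - level s M u)) (fun t => by simp) fun p q c hp h => by
        have h1 := hedge p q c h
        have h2 := h.nonneg_le_one
        simp only [spread]
        split_ifs <;> omega
    refine ⟨z, hzx, hz'.imp (fun ⟨h1, h2⟩ => ⟨h1, ?_⟩) fun ⟨h1, h2⟩ => ⟨h1, ?_⟩⟩
    · rw [hdiff z 0 hz (by simp only [spread] at h2; split_ifs at h2 <;> omega)]; simp
    · rw [hdiff z 1 hz (by simp only [spread] at h2; split_ifs at h2 <;> omega)]; simp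
  -- Suppose only `x` blocks `u`. Then every other position that could be tight for `u` can be
  -- lowered by one in the direction `s`. The set `Ω` is chosen to be closed under the forced
  -- consequences: it takes all low positions on the side of `u` opposite to `s`, and those of
  -- relative level `0` in row `u.row + s`.
  · by_contra! huniq
    obtain ⟨z, hzx, hz, hz'⟩ := key
      {t | t ≠ x ∧ (((t.row : ℤ) * s ≤ u.row * s - 1 ∧ level s M t - level s M u ≤ 1) ∨
        ((t.row : ℤ) = u.row + s ∧ level s M t - level s M u = 0))} (by simp)
      (by
        rintro t ⟨-, h | h⟩ ht
        · rw [ht] at h; omega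
        · omega)
      (fun t => rfl) fun p q c hp h => by
        have h1 := hedge p q c h
        have h2 := h.nonneg_le_one
        have hq := hp.trans (h.conn hs)
        have hqu := fun hrow => hinj q hrow hq
        have hmono : spread (level s M q - level s M u) + c ≤
            spread (level s M p - level s M u) := by
          simp only [spread]
          split_ifs <;> omega
        -- An edge onto `u` without slack blocks the move of `u`, hence starts at `x`.
        have hblock : q = u → level s M p - level s M u = c →
            ((p.row : ℤ) = u.row + s ∨ (p.row : ℤ) + s = u.row) → p = x := by
          rintro rfl hlevel hrow
          by_contra hpx
          refine huniq p hpx ?_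
          rcases h with ⟨h, h', rfl⟩ | ⟨h, h', rfl⟩ | ⟨h, h', h'', rfl⟩
          · exact Or.inl ⟨h', by rw [hdiff p 0 hp hlevel]; simp, h⟩
          · exact Or.inr ⟨h', by rw [hdiff p 1 hp hlevel]; simp, h⟩
          · omega
        by_cases hpΩ : p ∈ {t : Vertex n | t ≠ x ∧
            (((t.row : ℤ) * s ≤ u.row * s - 1 ∧ level s M t - level s M u ≤ 1) ∨
            ((t.row : ℤ) = u.row + s ∧ level s M t - level s M u = 0))}
        · by_cases hqΩ : q ∈ {t : Vertex n | t ≠ x ∧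
              (((t.row : ℤ) * s ≤ u.row * s - 1 ∧ level s M t - level s M u ≤ 1) ∨
              ((t.row : ℤ) = u.row + s ∧ level s M t - level s M u = 0))}
          · rw [if_pos hpΩ, if_pos hqΩ]
            omega
          · rw [if_pos hpΩ, if_neg hqΩ]
            -- Lowering `p` alone can break only an edge without slack after spreading: equal levels
            -- with `c = 0`, or the step from `0` to `1` with `c = 1`.
            suffices h3 : ¬ (c = 0 ∧ level s M q - level s M u = level s M p - level s M u) ∧
                ¬ (c = 1 ∧ level s M q - level s M u = 0 ∧ level s M p - level s M u = 1) by
              simp only [spread]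
              split_ifs <;> omega
            have hx1 : ((x.row : ℤ) = u.row + s ∧ level s M x - level s M u = 0) ∨
                ((x.row : ℤ) + s = u.row ∧ level s M x - level s M u = 1) :=
              hxu.tight.imp (fun h => ⟨h.1, hlev x 0 (by rw [h.2]; simp)⟩)
                (fun h => ⟨h.1, hlev x 1 (by rw [h.2]; simp)⟩)
            simp only [Set.mem_ofPred_eq, not_and, not_or] at hpΩ hqΩ
            obtain ⟨hpx, hpΩ⟩ := hpΩ
            have hqx : q = x → (q.row : ℤ) = x.row ∧
                level s M q - level s M u = level s M x - level s M u := by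
              rintro rfl; exact ⟨rfl, rfl⟩
            have hrows : (c = 0 ∧ (p.row : ℤ) = q.row + s) ∨ (c = 1 ∧ (p.row : ℤ) + s = q.row) ∨
                (c = 0 ∧ p.row = n ∧ q.row = n) := by
              rcases h with ⟨-, h, h'⟩ | ⟨-, h, h'⟩ | ⟨-, h, h', h''⟩
              · exact Or.inl ⟨h', h⟩
              · exact Or.inr (Or.inl ⟨h', h⟩)
              · exact Or.inr (Or.inr ⟨h'', h, h'⟩)
            -- In these cases `q` would lie in `Ω` too, unless `q = u`, where `hblock` gives `p =
            -- x`, or `q = x`. The latter is excluded by the rows and levels; for two positions of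
            -- the top row this needs `hxn`.
            refine ⟨?_, ?_⟩
            · rintro ⟨rfl, h3⟩
              by_cases hqx' : q = x
              · have h4 := hqx hqx'
                rcases hs with rfl | rfl <;> omega
              · have h4 := hqΩ hqx'
                by_cases h5 : q.row = u.row ∧ level s M q - level s M u = 0
                · exact hpx (hblock (hqu h5.1 h5.2) (by omega) (by omega))
                · rcases hs with rfl | rfl <;> omega
            · rintro ⟨rfl, h3, h4⟩
              by_cases hqx' : q = x
              · have h4 := hqx hqx'
                rcases hs with rfl | rfl <;> omega
              · have h4 := hqΩ hqx'
                by_cases h5 : q.row = u.row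
                · exact hpx (hblock (hqu h5 h3) (by omega) (by omega))
                · rcases hs with rfl | rfl <;> omega
        · rw [if_neg hpΩ]
          split_ifs <;> omega
    -- After the lowering no position other than `x` has the value `0` in row `u.row + s` or `1` in
    -- row `u.row - s`.
    simp only [Set.mem_ofPred_eq, hzx, ne_eq, not_false_eq_true, true_and] at hz'
    rcases hz' with ⟨h1, h2⟩ | ⟨h1, h2⟩
    · rw [spread] at h2
      rcases hs with rfl | rfl <;> split_ifs at h2 <;> omega
    · rw [spread] at h2
      rcases hs with rfl | rfl <;> split_ifs at h2 <;> omega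

end Removal

/-! ### Removal steps preserve noncriticality and admissibility. -/

section Preservation

variable {n : ℕ} {C C' : Set (Rel n)}

theorem RRStep.preserves (h : RRStep C C') (hC : C ⊆ setR n ∪ setR0 n) (hnc : NoncriticalSet C)
    (hadm : Admissible C) :
    C' ⊆ setR n ∪ setR0 n ∧ NoncriticalSet C' ∧ Admissible C' := by
  obtain ⟨v, -, ⟨L, hL, hinf⟩, rfl⟩ := h
  have hv := extremal_of_infinite hC hL.1 hinf
  have hC' := (removeVertex_subset C v).trans hC
  exact ⟨hC', hnc.removeVertex hC hv hL.1,
    (LocallyAdmissible.of_removeVertex hadm hC hnc hv hL.1).admissible hC'⟩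

theorem ObtainedByRR.preserves (h : ObtainedByRR C C') (hC : C ⊆ setR n ∪ setR0 n)
    (hnc : NoncriticalSet C) (hadm : Admissible C) : NoncriticalSet C' ∧ Admissible C' := by
  have : C' ⊆ setR n ∪ setR0 n ∧ NoncriticalSet C' ∧ Admissible C' := by
    induction h with
    | refl => exact ⟨hC, hnc, hadm⟩
    | tail _ h ih => exact h.preserves ih.1 ih.2.1 ih.2.2
  exact this.2

end Preservation

/-! ### Sets of relations with the diamond property -/

section Diamond

variable {n : ℕ} {C C' : Set (Rel n)}

/-- A chain `w > x ≥ u` through the row above is accompanied by a chain `w ≥ y > u` through the row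
below, and conversely. -/
def Diamond (C : Set (Rel n)) : Prop :=
  (∀ u w x, .gt w x ∈ C → .ge x u ∈ C → ∃ y, .ge w y ∈ C ∧ .gt y u ∈ C) ∧
    ∀ u w y, w.row < n → .ge w y ∈ C → .gt y u ∈ C → ∃ x, .gt w x ∈ C ∧ .ge x u ∈ C

theorem ge_mem_setR {a b : Vertex n} : .ge a b ∈ setR n ↔ a.row = b.row + 1 := by
  constructor
  · rintro ⟨u, v, h, h' | h'⟩
    · injection h' with h1 h2
      rw [h1, h2, h]
    · cases h'
  · exact fun h => ⟨a, b, h, Or.inl rfl⟩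

theorem gt_mem_setR {a b : Vertex n} : .gt a b ∈ setR n ↔ b.row = a.row + 1 := by
  constructor
  · rintro ⟨u, v, h, h' | h'⟩
    · cases h'
    · injection h' with h1 h2
      rw [h1, h2, h]
  · exact fun h => ⟨b, a, h, Or.inr rfl⟩

/-- The entries of `u` and `w` differ by one. In the companion chain the strict relation uses up
this difference and the other relation is an equality, so its middle position blocks both moves. -/
theorem Diamond.exists_blocks (hd : Diamond C) (hC : C ⊆ setR n) {M : Tableau n}
    (hM : Satisfies C M) {u w x : Vertex n} (hrow : u.row = w.row) (hu : u.row < n)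
    (huw : M w = M u + 1) (hux : Blocks C 1 M u x) (hwx : Blocks C (-1) M w x) :
    ∃ t, t ≠ x ∧ Blocks C 1 M u t ∧ Blocks C (-1) M w t := by
  have key : ∀ t, .ge w t ∈ C → .gt t u ∈ C →
      (t.row : ℤ) + 1 = u.row ∧ Blocks C 1 M u t ∧ Blocks C (-1) M w t := by
    intro t h1 h2
    have hr1 := ge_mem_setR.mp (hC h1)
    have hr2 := gt_mem_setR.mp (hC h2)
    obtain ⟨a, ha, ha'⟩ := hM _ h1
    obtain ⟨b, hb, hb'⟩ := hM _ h2
    have hab : a + b = 1 := by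
      have : ((a + b : ℤ) : ℂ) = (1 : ℤ) := by
        push_cast; rw [← ha', ← hb', huw]; ring
      exact_mod_cast this
    obtain rfl : b = 1 := by omega
    obtain rfl : a = 0 := by omega
    have ht : M t = M u + 1 := by linear_combination hb'
    exact ⟨by omega, Or.inr ⟨by omega, by rw [ht]; simp, by simpa [gtRel] using h2⟩,
      Or.inl ⟨by omega, by rw [ht, huw], by simpa [geRel] using h1⟩⟩
  have key' : ∀ t, .gt w t ∈ C → .ge t u ∈ C →
      (t.row : ℤ) = u.row + 1 ∧ Blocks C 1 M u t ∧ Blocks C (-1) M w t := by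
    intro t h1 h2
    have hr1 := gt_mem_setR.mp (hC h1)
    have hr2 := ge_mem_setR.mp (hC h2)
    obtain ⟨a, ha, ha'⟩ := hM _ h1
    obtain ⟨b, hb, hb'⟩ := hM _ h2
    have hab : a + b = 1 := by
      have : ((a + b : ℤ) : ℂ) = (1 : ℤ) := by
        push_cast; rw [← ha', ← hb', huw]; ring
      exact_mod_cast this
    obtain rfl : a = 1 := by omega
    obtain rfl : b = 0 := by omega
    have ht : M t = M u := by linear_combination hb'
    exact ⟨by omega, Or.inl ⟨by omega, ht, by simpa [geRel] using h2⟩,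
      Or.inr ⟨by omega, by rw [ht, huw]; simp, by simpa [gtRel] using h1⟩⟩
  rcases hux with ⟨h1, -, h2⟩ | ⟨h1, -, h2⟩ <;> rcases hwx with ⟨h3, -, h4⟩ | ⟨h3, -, h4⟩
  · omega
  · obtain ⟨y, hy, hy'⟩ := hd.1 u w x (by simpa [gtRel] using h4) (by simpa [geRel] using h2)
    obtain ⟨h5, h6⟩ := key y hy hy'
    exact ⟨y, ne_of_row_ne (by omega), h6⟩
  · obtain ⟨y, hy, hy'⟩ := hd.2 u w x (by omega) (by simpa [geRel] using h4)
      (by simpa [gtRel] using h2)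
    obtain ⟨h5, h6⟩ := key' y hy hy'
    exact ⟨y, ne_of_row_ne (by omega), h6⟩
  · omega

theorem Diamond.locallyAdmissible (hd : Diamond C) (hC : C ⊆ setR n) : LocallyAdmissible C := by
  intro M hM s hs u w hrow hu huw x hux hwx
  suffices h : ∃ t, t ≠ x ∧ Blocks C s M u t by
    obtain ⟨t, ht, ht'⟩ := h
    exact ⟨⟨t, ht, ht'.tight⟩, fun _ => ⟨t, ht, ht'⟩⟩
  rcases hs with rfl | rfl
  · obtain ⟨t, h1, h2, -⟩ := hd.exists_blocks hC hM.1 hrow hu (by rw [huw]; simp) hux hwx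
    exact ⟨t, h1, h2⟩
  · obtain ⟨t, h1, -, h2⟩ := hd.exists_blocks hC hM.1 hrow.symm (by omega)
      (by rw [huw]; push_cast; ring) (by simpa using hwx) hux
    exact ⟨t, h1, h2⟩

/-- A noncritical set of relations between adjacent rows that has the diamond property. -/
structure IsDiamondSet (C : Set (Rel n)) : Prop where
  subset : C ⊆ setR n
  diamond : Diamond C
  noncritical : NoncriticalSet C

theorem IsDiamondSet.admissible (h : IsDiamondSet C) : Admissible C :=
  (h.diamond.locallyAdmissible h.subset).admissible (h.subset.trans Set.subset_union_left)

/-- The middle position of a companion chain is bounded from both sides, so it is not extremal and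
cannot be the removed position. -/
theorem IsDiamondSet.of_rrStep (h : IsDiamondSet C) (hstep : RRStep C C') : IsDiamondSet C' := by
  have hC := h.subset.trans (Set.subset_union_left (t := setR0 n))
  have hnc := (hstep.preserves hC h.noncritical h.admissible).2.1
  obtain ⟨v, -, ⟨L, hL, hinf⟩, rfl⟩ := hstep
  have hv := extremal_of_infinite hC hL.1 hinf
  have hge : ∀ {a b : Vertex n}, .ge a b ∈ C → Edge C 1 a b 0 := fun {a b} h' =>
    Or.inl ⟨by simpa [geRel] using h', by have := ge_mem_setR.mp (h.subset h'); omega, rfl⟩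
  have hgt : ∀ {a b : Vertex n}, .gt a b ∈ C → Edge C 1 a b 1 := fun {a b} h' =>
    Or.inr (Or.inl ⟨by simpa [gtRel] using h', by have := gt_mem_setR.mp (h.subset h'); omega, rfl⟩)
  refine ⟨(removeVertex_subset C v).trans h.subset, ⟨?_, ?_⟩, hnc⟩
  · rintro u w x ⟨h1, h1'⟩ ⟨h2, h2'⟩
    obtain ⟨y, h3, h4⟩ := h.diamond.1 u w x h1 h2
    have hy : v ≠ y := by
      rintro rfl
      exact hv.elim (fun hv => hv w 0 (hge h3)) (fun hv => hv u 1 (hgt h4))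
    simp only [Rel.Involves, not_or] at h1' h2'
    exact ⟨y, ⟨h3, by simp [Rel.Involves, hy, h1'.1]⟩, ⟨h4, by simp [Rel.Involves, hy, h2'.2]⟩⟩
  · rintro u w x hw ⟨h1, h1'⟩ ⟨h2, h2'⟩
    obtain ⟨y, h3, h4⟩ := h.diamond.2 u w x hw h1 h2
    have hy : v ≠ y := by
      rintro rfl
      exact hv.elim (fun hv => hv w 1 (hgt h3)) (fun hv => hv u 0 (hge h4))
    simp only [Rel.Involves, not_or] at h1' h2'
    exact ⟨y, ⟨h3, by simp [Rel.Involves, hy, h1'.1]⟩, ⟨h4, by simp [Rel.Involves, hy, h2'.2]⟩⟩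

theorem IsDiamondSet.of_obtainedByRR (h : IsDiamondSet C) (hC' : ObtainedByRR C C') :
    IsDiamondSet C' := by
  induction hC' with
  | refl => exact h
  | tail _ hstep ih => exact ih.of_rrStep hstep

end Diamond

/-! ### The standard relations -/

section Standard

variable {n : ℕ}

theorem Vertex.bounds (v : Vertex n) : 1 ≤ v.col ∧ v.col ≤ v.row ∧ v.row ≤ n := by
  have h1 := v.1.isLt
  have h2 := v.2.isLt
  simp only [Vertex.row, Vertex.col]
  omega

theorem Vertex.exists_of_bounds {r c : ℕ} (h1 : 1 ≤ c) (h2 : c ≤ r) (h3 : r ≤ n) :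
    ∃ v : Vertex n, v.row = r ∧ v.col = c :=
  ⟨⟨⟨r - 1, by omega⟩, ⟨c - 1, by simp only; omega⟩⟩, by simp only [Vertex.row]; omega,
    by simp only [Vertex.col]; omega⟩

theorem Vertex.ext_row_col {u v : Vertex n} (h1 : u.row = v.row) (h2 : u.col = v.col) : u = v := by
  obtain ⟨⟨a, ha⟩, b, hb⟩ := u
  obtain ⟨⟨c, hc⟩, d, hd⟩ := v
  simp only [Vertex.row, Vertex.col, Nat.add_right_cancel_iff] at h1 h2
  subst h1
  subst h2
  rfl

theorem ge_mem_setS {a b : Vertex n} : .ge a b ∈ setS n ↔ a.row = b.row + 1 ∧ a.col = b.col := by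
  constructor
  · rintro ⟨u, v, h, ⟨hc, h'⟩ | ⟨-, h'⟩⟩
    · injection h' with h1 h2
      rw [h1, h2]
      exact ⟨h, hc⟩
    · cases h'
  · exact fun ⟨h, hc⟩ => ⟨a, b, h, Or.inl ⟨hc, rfl⟩⟩

theorem gt_mem_setS {a b : Vertex n} :
    .gt a b ∈ setS n ↔ b.row = a.row + 1 ∧ b.col = a.col + 1 := by
  constructor
  · rintro ⟨u, v, h, ⟨-, h'⟩ | ⟨hc, h'⟩⟩
    · cases h'
    · injection h' with h1 h2
      rw [h1, h2]
      exact ⟨h, hc⟩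
  · exact fun ⟨h, hc⟩ => ⟨b, a, h, Or.inr ⟨hc, rfl⟩⟩

theorem setS_subset_setR : setS n ⊆ setR n := by
  rintro r ⟨u, v, h, ⟨-, h'⟩ | ⟨-, h'⟩⟩
  · exact ⟨u, v, h, Or.inl h'⟩
  · exact ⟨u, v, h, Or.inr h'⟩

/-- The chains join columns `j` and `j + 1` of a row `k`. The corner `(k - 1, j)` exists because row
`k` has a column `j + 1`; the corner `(k + 1, j + 1)` exists when `k < n`. -/
theorem diamond_setS : Diamond (setS n) := by
  simp only [Diamond, ge_mem_setS, gt_mem_setS]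
  refine ⟨fun u w x h1 h2 => ?_, fun u w y h h1 h2 => ?_⟩
  · have hu := u.bounds
    have hw := w.bounds
    obtain ⟨y, hy, hy'⟩ := Vertex.exists_of_bounds (n := n) (r := w.row - 1) (c := w.col)
      (by omega) (by omega) (by omega)
    exact ⟨y, by omega, by omega⟩
  · have hu := u.bounds
    have hw := w.bounds
    obtain ⟨y, hy, hy'⟩ := Vertex.exists_of_bounds (n := n) (r := w.row + 1) (c := w.col + 1)
      (by omega) (by omega) (by omega)
    exact ⟨y, by omega, by omega⟩

end Standard

/-! ### Permutations and disjoint unions -/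

section Permute

variable {n : ℕ} {C : Set (Rel n)}

/-- The permutation of the positions given by `σ`. -/
def permVertex (σ : PermGroup n) : Vertex n ≃ Vertex n := Equiv.sigmaCongrRight σ

theorem permute_ge (σ : PermGroup n) (u v : Vertex n) :
    Rel.permute σ (.ge u v) = .ge (permVertex σ u) (permVertex σ v) := rfl

theorem permute_gt (σ : PermGroup n) (u v : Vertex n) :
    Rel.permute σ (.gt u v) = .gt (permVertex σ u) (permVertex σ v) := rfl

theorem ge_mem_permuteSet {σ : PermGroup n} {u v : Vertex n} :
    .ge (permVertex σ u) (permVertex σ v) ∈ permuteSet σ C ↔ .ge u v ∈ C := by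
  constructor
  · rintro ⟨r, hr, h⟩
    cases r with
    | ge a b =>
      rw [permute_ge] at h
      injection h with h1 h2
      rwa [← (permVertex σ).injective h1, ← (permVertex σ).injective h2]
    | gt a b => cases h
  · exact fun h => ⟨_, h, rfl⟩

theorem gt_mem_permuteSet {σ : PermGroup n} {u v : Vertex n} :
    .gt (permVertex σ u) (permVertex σ v) ∈ permuteSet σ C ↔ .gt u v ∈ C := by
  constructor
  · rintro ⟨r, hr, h⟩
    cases r with
    | gt a b =>
      rw [permute_gt] at h
      injection h with h1 h2
      rwa [← (permVertex σ).injective h1, ← (permVertex σ).injective h2]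
    | ge a b => cases h
  · exact fun h => ⟨_, h, rfl⟩

theorem Diamond.permuteSet (h : Diamond C) (σ : PermGroup n) : Diamond (permuteSet σ C) := by
  refine ⟨fun u w x => ?_, fun u w x => ?_⟩ <;>
  · obtain ⟨u, rfl⟩ := (permVertex σ).surjective u
    obtain ⟨w, rfl⟩ := (permVertex σ).surjective w
    obtain ⟨x, rfl⟩ := (permVertex σ).surjective x
    rw [ge_mem_permuteSet, gt_mem_permuteSet]
    first
    | intro h1 h2
      obtain ⟨y, h3, h4⟩ := h.1 u w x h1 h2
      exact ⟨_, ge_mem_permuteSet.mpr h3, gt_mem_permuteSet.mpr h4⟩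
    | intro hw h1 h2
      obtain ⟨y, h3, h4⟩ := h.2 u w x hw h1 h2
      exact ⟨_, gt_mem_permuteSet.mpr h3, ge_mem_permuteSet.mpr h4⟩

theorem permute_involves {σ : PermGroup n} {r : Rel n} {v : Vertex n} :
    (r.permute σ).Involves (permVertex σ v) ↔ r.Involves v := by
  cases r <;> simp [permute_ge, permute_gt, Rel.Involves]

theorem permute_holds {σ : PermGroup n} {r : Rel n} {M : Tableau n} :
    (r.permute σ).Holds M ↔ r.Holds (M ∘ permVertex σ) := by
  cases r <;> rfl

theorem conn_permuteSet {σ : PermGroup n} {u w : Vertex n} :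
    Conn (permuteSet σ C) (permVertex σ u) (permVertex σ w) ↔ Conn C u w := by
  constructor
  · intro h
    have := h.mem_of_closed (S := permVertex σ '' {t | Conn C u t}) ?_ ⟨u, .refl C u, rfl⟩
    · obtain ⟨t, ht, h⟩ := this
      rwa [← (permVertex σ).injective h]
    · rintro _ ⟨r, hr, rfl⟩ a b ha hb ⟨t, ht, rfl⟩
      obtain ⟨b, rfl⟩ := (permVertex σ).surjective b
      rw [permute_involves] at ha hb
      exact ⟨b, Conn.trans ht (Conn.of_mem hr ha hb), rfl⟩
  · intro h
    refine h.mem_of_closed (S := {t | Conn (permuteSet σ C) (permVertex σ u) (permVertex σ t)}) ?_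
      (Conn.refl _ _)
    intro r hr a b ha hb h
    exact Conn.trans h (Conn.of_mem (C := permuteSet σ C) (r := r.permute σ) ⟨r, hr, rfl⟩
      (permute_involves.mpr ha) (permute_involves.mpr hb))

theorem NoncriticalSet.permuteSet (h : NoncriticalSet C) (σ : PermGroup n) :
    NoncriticalSet (permuteSet σ C) := by
  rw [noncriticalSet_iff] at h ⊢
  intro u w M
  obtain ⟨u, rfl⟩ := (permVertex σ).surjective u
  obtain ⟨w, rfl⟩ := (permVertex σ).surjective w
  intro hM huw hne hrow hu
  refine h u w (M ∘ permVertex σ) (fun r hr => ?_) (conn_permuteSet.mp huw)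
    (fun h => hne (by rw [h])) hrow hu
  obtain ⟨hr, a, ha, hua⟩ := hr
  exact permute_holds.mp (hM _ ⟨⟨r, hr, rfl⟩, _, permute_involves.mpr ha, conn_permuteSet.mpr hua⟩)

theorem IsDiamondSet.permuteSet (h : IsDiamondSet C) (σ : PermGroup n) :
    IsDiamondSet (permuteSet σ C) := by
  refine ⟨?_, h.diamond.permuteSet σ, h.noncritical.permuteSet σ⟩
  rintro _ ⟨r, hr, rfl⟩
  have hr := h.subset hr
  cases r with
  | ge a b =>
    have hab := ge_mem_setR.mp hr
    exact ge_mem_setR.mpr hab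
  | gt a b =>
    have hab := gt_mem_setR.mp hr
    exact gt_mem_setR.mpr hab

/-- Rows below the top decrease strictly, because `l_{kj} > l_{k+1,j+1} ≥ l_{k,j+1}`. Connectedness
to `u` is carried along since only the relations of its class are assumed. -/
theorem isDiamondSet_setS (n : ℕ) : IsDiamondSet (setS n) := by
  refine ⟨setS_subset_setR, diamond_setS, noncriticalSet_iff.mpr fun u w M hM hconn => ?_⟩
  have key : ∀ d, ∀ a b : Vertex n, Conn (setS n) u a → a.row = b.row → a.row < n →
      b.col = a.col + d + 1 → M a ≠ M b := by
    have : ∀ d, ∀ a b : Vertex n, Conn (setS n) u a → a.row = b.row → a.row < n →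
        b.col = a.col + d + 1 → ∃ m : ℤ, 0 < m ∧ M a - M b = m := by
      intro d
      induction d with
      | zero =>
        intro a b ha hab hn hcol
        have hb := b.bounds
        obtain ⟨x, hx, hx'⟩ := Vertex.exists_of_bounds (n := n) (r := a.row + 1) (c := a.col + 1)
          (by omega) (by omega) (by omega)
        have h1 : .gt a x ∈ setS n := gt_mem_setS.mpr ⟨hx, hx'⟩
        have h2 : .ge x b ∈ setS n := ge_mem_setS.mpr ⟨by omega, by omega⟩
        obtain ⟨k, hk, hk'⟩ := hM _ ⟨h1, a, Or.inl rfl, ha⟩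
        obtain ⟨l, hl, hl'⟩ := hM _ ⟨h2, x, Or.inl rfl,
          ha.trans (Conn.of_mem h1 (Or.inl rfl) (Or.inr rfl))⟩
        exact ⟨k + l, by omega, by push_cast; rw [← hk', ← hl']; ring⟩
      | succ d ih =>
        intro a b ha hab hn hcol
        have hb := b.bounds
        obtain ⟨c, hc, hc'⟩ := Vertex.exists_of_bounds (n := n) (r := a.row + 1) (c := a.col + 1)
          (by omega) (by omega) (by omega)
        obtain ⟨x, hx, hx'⟩ := Vertex.exists_of_bounds (n := n) (r := a.row) (c := a.col + 1)
          (by omega) (by omega) (by omega)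
        have h1 : .gt a c ∈ setS n := gt_mem_setS.mpr ⟨hc, hc'⟩
        have h2 : .ge c x ∈ setS n := ge_mem_setS.mpr ⟨by omega, by omega⟩
        have hac := ha.trans (Conn.of_mem h1 (Or.inl rfl) (Or.inr rfl))
        obtain ⟨k, hk, hk'⟩ := hM _ ⟨h1, a, Or.inl rfl, ha⟩
        obtain ⟨l, hl, hl'⟩ := hM _ ⟨h2, c, Or.inl rfl, hac⟩
        obtain ⟨m, hm, hm'⟩ := ih x b (hac.trans (Conn.of_mem h2 (Or.inl rfl) (Or.inr rfl)))
          (by omega) (by omega) (by omega)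
        exact ⟨k + l + m, by omega, by push_cast; rw [← hk', ← hl', ← hm']; ring⟩
    intro d a b ha hab hn hcol heq
    obtain ⟨m, hm, hm'⟩ := this d a b ha hab hn hcol
    rw [heq, sub_self] at hm'
    have : (m : ℤ) = 0 := by exact_mod_cast hm'.symm
    omega
  intro hne hrow hu
  rcases lt_trichotomy u.col w.col with h | h | h
  · exact key (w.col - u.col - 1) u w (.refl _ u) hrow hu (by omega)
  · exact absurd (Vertex.ext_row_col hrow h) hne
  · exact (key (u.col - w.col - 1) w u hconn hrow.symm (by omega) (by omega)).symm

/-- Relations sharing a position belong to the same member, so neither the two relations of a chain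
nor a connecting path can pass from one member to another. -/
theorem IsDiamondSet.sUnion {𝒟 : Set (Set (Rel n))} (h : ∀ D ∈ 𝒟, IsDiamondSet D)
    (hdis : 𝒟.Pairwise Disconnected) : IsDiamondSet (⋃₀ 𝒟) := by
  have heq : ∀ D ∈ 𝒟, ∀ D' ∈ 𝒟, ∀ v, v ∈ verts D → v ∈ verts D' → D' = D := by
    intro D hD D' hD' v hv hv'
    by_contra hne
    exact Set.disjoint_left.mp (hdis hD' hD hne) hv' hv
  refine ⟨Set.sUnion_subset fun D hD => (h D hD).subset, ⟨?_, ?_⟩, noncriticalSet_iff.mpr ?_⟩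
  · rintro u w x ⟨D, hD, h1⟩ ⟨D', hD', h2⟩
    obtain rfl := heq D hD D' hD' x ⟨_, h1, Or.inr rfl⟩ ⟨_, h2, Or.inl rfl⟩
    obtain ⟨y, h3, h4⟩ := (h D' hD).diamond.1 u w x h1 h2
    exact ⟨y, ⟨D', hD, h3⟩, ⟨D', hD, h4⟩⟩
  · rintro u w x hw ⟨D, hD, h1⟩ ⟨D', hD', h2⟩
    obtain rfl := heq D hD D' hD' x ⟨_, h1, Or.inr rfl⟩ ⟨_, h2, Or.inl rfl⟩
    obtain ⟨y, h3, h4⟩ := (h D' hD).diamond.2 u w x hw h1 h2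
    exact ⟨y, ⟨D', hD, h3⟩, ⟨D', hD, h4⟩⟩
  · intro u w M hM hconn hne hrow hu
    obtain ⟨r, ⟨D, hD, hr⟩, hur⟩ := hconn.mem_verts hne
    have hconn' : w ∈ {t | Conn D u t ∧ t ∈ verts D} := by
      refine hconn.mem_of_closed ?_ ⟨.refl D u, r, hr, hur⟩
      rintro q ⟨D', hD', hq⟩ a b ha hb ⟨hua, haD⟩
      obtain rfl := heq D hD D' hD' a haD ⟨q, hq, ha⟩
      exact ⟨hua.trans (Conn.of_mem hq ha hb), q, hq, hb⟩
    refine noncriticalSet_iff.mp (h D hD).noncritical u w M (fun r hr => ?_) hconn'.1 hne hrow hu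
    obtain ⟨hr, a, ha, hua⟩ := hr
    exact hM r ⟨⟨D, hD, hr⟩, a, ha, hua.mono (Set.subset_sUnion_of_mem hD)⟩

end Permute

end GelfandTsetlin

theorem mainTheorem4 (n : ℕ) (hn : 2 ≤ n) :
    -- the relation-removal method preserves admissibility
    (∀ C₁ C₂ : Set (Rel n), C₁ ⊆ setR n ∪ setR0 n → NoncriticalSet C₁ → Admissible C₁ →
      ObtainedByRR C₁ C₂ → NoncriticalSet C₂ ∧ Admissible C₂) ∧
    -- sets obtained from the standard relations
    (∀ C : Set (Rel n), ObtainedByRR (setS n) C → NoncriticalSet C ∧ Admissible C) ∧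
    -- their permutations
    (∀ (C : Set (Rel n)) (σ : PermGroup n), ObtainedByRR (setS n) C →
      NoncriticalSet (permuteSet σ C) ∧ Admissible (permuteSet σ C)) ∧
    -- unions of pairwise disconnected permuted sets
    (∀ 𝒟 : Set (Set (Rel n)),
      (∀ D ∈ 𝒟, ∃ (C : Set (Rel n)) (σ : PermGroup n),
        ObtainedByRR (setS n) C ∧ D = permuteSet σ C) →
      𝒟.Pairwise Disconnected →
      NoncriticalSet (⋃₀ 𝒟) ∧ Admissible (⋃₀ 𝒟)) := by
  refine ⟨fun C₁ C₂ hC hnc hadm h => h.preserves hC hnc hadm, fun C hC => ?_, fun C σ hC => ?_,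
    fun 𝒟 h𝒟 hdis => ?_⟩
  · have h := (isDiamondSet_setS n).of_obtainedByRR hC
    exact ⟨h.noncritical, h.admissible⟩
  · have h := ((isDiamondSet_setS n).of_obtainedByRR hC).permuteSet σ
    exact ⟨h.noncritical, h.admissible⟩
  · have h : IsDiamondSet (⋃₀ 𝒟) := .sUnion (fun D hD => by
      obtain ⟨C, σ, hC, rfl⟩ := h𝒟 D hD
      exact ((isDiamondSet_setS n).of_obtainedByRR hC).permuteSet σ) hdis
    exact ⟨h.noncritical, h.admissible⟩
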